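/- **Setting.** *Simple types and terms.* Simple types are $\sigma ::= \mathbb B\mid\mathbb N\mid \mathsf{list}_\sigma\mid\sigma\times\sigma\mid\sigma\to\sigma$. Terms are those of the simply typed $\lambda$-calculus with pairs, $\mathsf{tt},\mathsf{ff}$, $0,S$, $[\,],::$, case analysis on $\mathbb B,\mathbb N$ and lists, and $\mathsf{letrec}\ f\,x=e : I\to\sigma$ with $I\in\{\mathbb N,\mathsf{list}_\sigma\}$, subject to $\mathcal Def(f,x,e)$: the value of $e$ at $x$ depends on $f$ only at arguments of size smaller than $|x|$ (the number itself, or the length of the list). Types and terms have their standard set-theoretic interpretation (total functions). Basic predicates are typed symbols, axiomatized by an arbitrary set of closed assertions, besides the built-in $=$, $|t|\le|u|$, $|t|<|u|$, $\mathrm{All}$ and $\mathrm{All2}$. $\mathrm{All}(l,\lambda y.\phi)$ says that all elements of $l$ satisfy $\phi$, and $\mathrm{All2}(l_1,l_2,\lambda y_1y_2.\phi)$ that $l_1,l_2$ have the same length and are elementwise related by $\phi$; both are given by their defining clauses on $[\,]$ and $::$ (equivalences on $::$, and $\mathrm{All2}$ fails on $[\,]$ against $h::t$ and conversely). *Logics.*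 Assertions are built from predicates with connectives and quantifiers over all simple types. $\Gamma\mid\Psi\vdash_{\mathsf{HOL}}\phi$ is natural deduction with the axioms of the predicates, conversion of well-typed terms, substitution of equals, induction on lists, numbers and booleans, and strong induction on size. $\Gamma\mid\Psi\vdash_{\mathsf{UHOL}} t:\sigma\mid\phi$ and $\Gamma\mid\Psi\vdash_{\mathsf{RHOL}} t_1:\sigma_1\sim t_2:\sigma_2\mid\phi(\mathbf r_1,\mathbf r_2)$ are the syntax-directed unary and relational program logics over HOL: for each term constructor one unary rule, resp. one synchronous relational rule and two one-sided ones, plus structural rules. *Relational refinement types* are given by $$\tau ::= \mathbb B\mid\mathbb N\mid\tau\to\tau,\qquad T,U ::= \tau\mid \mathsf{list}_T\mid \Pi(x::T).\,U\mid\{x::T\mid\phi\},$$ where a variable $x::T$ stands for a left copy $x_1$ and a right copy $x_2$, both available in later types and assertions. The erasure $|T|$ is the simple type obtained by forgetting assertions and dependency ($|\tau|=\tau$, $|\mathsf{list}_T|=\mathsf{list}_{|T|}$, $|\Pi(x::T).U|=|T|\to|U|$, $|\{x::T\mid\phi\}|=|T|$). For unary $\tau$ put $\lfloor\mathbb B\rfloor(x)=\lfloor\mathbb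 N\rfloor(x)=\top$ and $\lfloor\tau\to\sigma\rfloor(x)=\forall y.\lfloor\tau\rfloor(y)\Rightarrow\lfloor\sigma\rfloor(x\,y)$. The relational refinement is - $\lfloor\tau\rfloor(x_1,x_2)=\lfloor\tau\rfloor(x_1)\wedge\lfloor\tau\rfloor(x_2)$; - $\lfloor\mathsf{list}_\tau\rfloor(x_1,x_2)=\bigwedge_{i\in\{1,2\}}\mathrm{All}(x_i,\lambda y.\lfloor\tau\rfloor(y))$ for unary $\tau$; - $\lfloor\mathsf{list}_T\rfloor(x_1,x_2)=\mathrm{All2}(x_1,x_2,\lambda y_1y_2.\lfloor T\rfloor(y_1,y_2))$ for every other $T$; - $\lfloor\{y::T\mid\phi\}\rfloor(x_1,x_2)=\lfloor T\rfloor(x_1,x_2)\wedge\phi[x_1/y_1][x_2/y_2]$; - $\lfloor\Pi(y::T).U\rfloor(x_1,x_2)=\forall y_1y_2.\lfloor T\rfloor(y_1,y_2)\Rightarrow\lfloor U\rfloor(x_1y_1,x_2y_2)$. For a context $\Gamma$ of declarations $x::T$, $|\Gamma|$ declares $x_1,x_2:|T|$ and $\lfloor\Gamma\rfloor$ is the set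 of the $\lfloor T\rfloor(x_1,x_2)$, for $x::T$ in $\Gamma$. Write $\Gamma\vdash\phi$ for $|\Gamma|\mid\lfloor\Gamma\rfloor\vdash_{\mathsf{HOL}}\phi$. *Subtyping* $\Gamma\vdash T\preceq U$, between well-formed types with $|T|=|U|$, is generated by reflexivity; transitivity; $\mathsf{list}_T\preceq\mathsf{list}_U$ if $T\preceq U$, provided that $U$ is unary if $T$ is; $\{x::T\mid\phi\}\preceq T$; $T\preceq\{x::U\mid\phi\}$ if $T\preceq U$ and $\Gamma,x::T\vdash\phi$; $\Pi(x::T_1).U_1\preceq\Pi(x::T_2).U_2$ if $T_2\preceq T_1$ and $\Gamma,x::T_2\vdash U_1\preceq U_2$. *Typing* $\Gamma\vdash t_1\sim t_2::T$ is generated by subsumption and the following rules. - $\Gamma\vdash x_1\sim x_2::T$ for $x::T$ in $\Gamma$. - $\lambda x_1.u_1\sim\lambda x_2.u_2::\Pi(x::T).U$ if $\Gamma,x::T\vdash u_1\sim u_2::U$. - $t_1u_1\sim t_2u_2::U[u_1/x_1][u_2/x_2]$ if $t_1\sim t_2::\Pi(x::T).U$ and $u_1\sim u_2::T$. - $\mathsf{tt}\sim\mathsf{tt}::\mathbb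 B$, $\mathsf{ff}\sim\mathsf{ff}::\mathbb B$, $0\sim0::\mathbb N$, and $S\,t_1\sim S\,t_2::\mathbb N$ if $t_1\sim t_2::\mathbb N$. - $[\,]\sim[\,]::\mathsf{list}_T$ for well-formed $T$, and $h_1::t_1\sim h_2::t_2::\mathsf{list}_T$ if $h_1\sim h_2::T$ and $t_1\sim t_2::\mathsf{list}_T$. - $\mathsf{case}\ t_1\ \mathsf{of}\ [\,]\mapsto u_1;\,\_::\_\mapsto v_1\ \sim\ \mathsf{case}\ t_2\ \mathsf{of}\ [\,]\mapsto u_2;\,\_::\_\mapsto v_2::U$ if $t_1\sim t_2::\mathsf{list}_T$, $\Gamma\vdash t_1=[\,]\Leftrightarrow t_2=[\,]$, $u_1\sim u_2::U$ and $v_1\sim v_2::\Pi(h::T).\Pi(t::\mathsf{list}_T).U$; similarly for numbers (with $t_1=0\Leftrightarrow t_2=0$, $v_1\sim v_2::\Pi(n::\mathbb N).U$) and booleans (with $t_1=\mathsf{tt}\Leftrightarrow t_2=\mathsf{tt}$). - $\mathsf{letrec}\ f_1\,x_1=e_1\sim\mathsf{letrec}\ f_2\,x_2=e_2::\Pi(x::T).U$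 if $\Pi(x::T).U$ is well-formed, $\mathcal Def(f_1,x_1,e_1)$, $\mathcal Def(f_2,x_2,e_2)$ and $\Gamma,\ x::T,\ f::\Pi(y::\{y::T\mid(|y_1|,|y_2|)<(|x_1|,|x_2|)\}).\,U[y/x]\vdash e_1\sim e_2::U$. Here $(a,b)<(c,d)$ means $a\le c$, $b\le d$ and at least one of them strict. *Set-theoretic interpretation.* Given an interpretation of the basic predicates, a valuation $\theta$ of $|\Gamma|$ interprets $T$ as a relation $(\!|T|\!)_\theta$ on the set interpreting $|T|$: all pairs for $\tau$ and for $\mathsf{list}_\tau$ with $\tau$ unary; lists of equal length elementwise related by $(\!|T|\!)_\theta$ for other $\mathsf{list}_T$; pairs $(F_1,F_2)$ with $(F_1v_1,F_2v_2)\in(\!|U|\!)_{\theta[v_1/x_1,v_2/x_2]}$ for all $(v_1,v_2)\in(\!|T|\!)_\theta$, for $\Pi(x::T).U$; and pairs in $(\!|T|\!)_\theta$ that satisfy $\phi$, for $\{x::T\mid\phi\}$. We write $\theta\models\Gamma$ if $(\theta(x_1),\theta(x_2))\in(\!|T|\!)_\theta$ for every $x::T$ in $\Gamma$. **Theorem (soundness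 of the embedding of relational refinement types).** 1. If $\Gamma\vdash t_1\sim t_2::T$, then $|\Gamma|\mid\lfloor\Gamma\rfloor\vdash_{\mathsf{RHOL}} t_1:|T|\sim t_2:|T|\mid\lfloor T\rfloor(\mathbf r_1,\mathbf r_2)$. 2. If $\Gamma\vdash T\preceq U$, then $|\Gamma|,x_1,x_2:|T|\mid\lfloor\Gamma\rfloor,\lfloor T\rfloor(x_1,x_2)\vdash_{\mathsf{HOL}}\lfloor U\rfloor(x_1,x_2)$. 3. (Soundness of relational refinement types.) If $\Gamma\vdash t_1\sim t_2::T$, then, for every interpretation of the basic predicates that satisfies their axioms and every valuation $\theta\models\Gamma$, $((\!|t_1|\!)_\theta,(\!|t_2|\!)_\theta)\in(\!|T|\!)_\theta$. -/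

import Mathlib

universe u

namespace RelHOL

/-! ## PCF: types, terms, set-theoretic semantics -/

/-- Simple types. -/
inductive Ty where
  | bool
  | nat
  | list (α : Ty)
  | prod (α β : Ty)
  | arr (α β : Ty)

/-- Simply typed contexts, most recently declared variable first. -/
abbrev Ctx := List Ty

/-- Typed variables (de Bruijn indices). -/
inductive Var : Ctx → Ty → Type where
  | zero {Γ : Ctx} {α : Ty} : Var (α :: Γ) α
  | succ {Γ : Ctx} {α β : Ty} (x : Var Γ α) : Var (β :: Γ) α

/-- The types that may be the domain of a recursive definition. -/
inductive Ind : Ty → Prop where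
  | nat : Ind .nat
  | list (α : Ty) : Ind (.list α)

/-- Simply typed terms. Abstractions carry no type annotation; the type of a term is its index.
In `letrec h e` (`letrec f x = e`) the body `e` lives in the context `Γ, x : α, f : α → β`. -/
inductive Tm : Ctx → Ty → Type where
  | var {Γ : Ctx} {α : Ty} (x : Var Γ α) : Tm Γ α
  | pair {Γ : Ctx} {α β : Ty} (t : Tm Γ α) (u : Tm Γ β) : Tm Γ (.prod α β)
  | fst {Γ : Ctx} {α β : Ty} (t : Tm Γ (.prod α β)) : Tm Γ α
  | snd {Γ : Ctx} {α β : Ty} (t : Tm Γ (.prod α β)) : Tm Γ β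
  | app {Γ : Ctx} {α β : Ty} (t : Tm Γ (.arr α β)) (u : Tm Γ α) : Tm Γ β
  | lam {Γ : Ctx} {α β : Ty} (t : Tm (α :: Γ) β) : Tm Γ (.arr α β)
  | tt {Γ : Ctx} : Tm Γ .bool
  | ff {Γ : Ctx} : Tm Γ .bool
  | zero {Γ : Ctx} : Tm Γ .nat
  | succ {Γ : Ctx} (t : Tm Γ .nat) : Tm Γ .nat
  | nil {Γ : Ctx} {α : Ty} : Tm Γ (.list α)
  | cons {Γ : Ctx} {α : Ty} (h : Tm Γ α) (t : Tm Γ (.list α)) : Tm Γ (.list α)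
  | caseNat {Γ : Ctx} {σ : Ty} (t : Tm Γ .nat) (u : Tm Γ σ) (v : Tm Γ (.arr .nat σ)) : Tm Γ σ
  | caseBool {Γ : Ctx} {σ : Ty} (t : Tm Γ .bool) (u v : Tm Γ σ) : Tm Γ σ
  | caseList {Γ : Ctx} {α σ : Ty} (t : Tm Γ (.list α)) (u : Tm Γ σ)
      (v : Tm Γ (.arr α (.arr (.list α) σ))) : Tm Γ σ
  | letrec {Γ : Ctx} {α β : Ty} (h : Ind α) (e : Tm (.arr α β :: α :: Γ) β) : Tm Γ (.arr α β)

/-- Interpretation of types: functions are all total functions. -/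
@[reducible] def Ty.den : Ty → Type
  | .bool => Bool
  | .nat => ℕ
  | .list α => List α.den
  | .prod α β => α.den × β.den
  | .arr α β => α.den → β.den

/-- Every type is inhabited. -/
def Ty.point : (α : Ty) → α.den
  | .bool => false
  | .nat => (0 : ℕ)
  | .list _ => []
  | .prod α β => (α.point, β.point)
  | .arr _ β => fun _ => β.point

instance (α : Ty) : Nonempty α.den := ⟨α.point⟩

/-- Size of a value of an inductive type: the number itself, the length of the list. -/
def Ty.size : (α : Ty) → α.den → ℕ
  | .nat => fun n => n
  | .list _ => fun l => l.length
  | .bool | .prod _ _ | .arr _ _ => fun _ => 0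

/-- Valuations of a context. -/
abbrev Env (Γ : Ctx) : Type := ∀ ⦃α : Ty⦄, Var Γ α → α.den

def Env.nil : Env [] := fun _ x => nomatch x

def Env.cons {Γ : Ctx} {α : Ty} (v : α.den) (ρ : Env Γ) : Env (α :: Γ)
  | _, .zero => v
  | _, .succ x => ρ x

/-- Set-theoretic interpretation of terms. `letrec f x = e` denotes the solution `F` of
`F v = ⟦e⟧ρ[x ↦ v, f ↦ F]`; it exists and is unique when the definition satisfies `WDef`. -/
noncomputable def Tm.den : {Γ : Ctx} → {α : Ty} → Tm Γ α → Env Γ → α.den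
  | _, _, .var x, ρ => ρ x
  | _, _, .pair t u, ρ => (t.den ρ, u.den ρ)
  | _, _, .fst t, ρ => (t.den ρ).1
  | _, _, .snd t, ρ => (t.den ρ).2
  | _, _, .app t u, ρ => t.den ρ (u.den ρ)
  | _, _, .lam t, ρ => fun v => t.den (ρ.cons v)
  | _, _, .tt, _ => true
  | _, _, .ff, _ => false
  | _, _, .zero, _ => (0 : ℕ)
  | _, _, .succ t, ρ => Nat.succ (t.den ρ)
  | _, _, .nil, _ => []
  | _, _, .cons h t, ρ => List.cons (h.den ρ) (t.den ρ)
  | _, _, .caseNat t u v, ρ =>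
      match (t.den ρ : ℕ) with
      | 0 => u.den ρ
      | n + 1 => v.den ρ n
  | _, _, .caseBool t u v, ρ =>
      match (t.den ρ : Bool) with
      | true => u.den ρ
      | false => v.den ρ
  | _, _, .caseList (α := α) t u v, ρ =>
      match (t.den ρ : List α.den) with
      | [] => u.den ρ
      | a :: l => v.den ρ a l
  | _, _, .letrec (α := α) (β := β) _ e, ρ =>
      Classical.epsilon fun F : α.den → β.den => ∀ v, F v = e.den ((ρ.cons v).cons F)

/-- The predicate `Def(f, x, e)`: all recursive calls are performed on strictly smaller
arguments, i.e. the value of `e` at `x ↦ v` depends only on the values of `f` at arguments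
smaller than `v`. -/
def WDef {Γ : Ctx} {α β : Ty} (e : Tm (.arr α β :: α :: Γ) β) : Prop :=
  ∀ (ρ : Env Γ) (v : α.den) (F G : α.den → β.den),
    (∀ m, α.size m < α.size v → F m = G m) →
      e.den ((ρ.cons v).cons (α := .arr α β) F) = e.den ((ρ.cons v).cons (α := .arr α β) G)

/-- The part of the typing judgment `Γ ⊢ t : α` that is not in the indices of `t`: every recursive
definition in `t` is well-defined. -/
def Tm.Ok : {Γ : Ctx} → {α : Ty} → Tm Γ α → Prop
  | _, _, .var _ => True
  | _, _, .pair t u => t.Ok ∧ u.Ok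
  | _, _, .fst t => t.Ok
  | _, _, .snd t => t.Ok
  | _, _, .app t u => t.Ok ∧ u.Ok
  | _, _, .lam t => t.Ok
  | _, _, .tt => True
  | _, _, .ff => True
  | _, _, .zero => True
  | _, _, .succ t => t.Ok
  | _, _, .nil => True
  | _, _, .cons h t => h.Ok ∧ t.Ok
  | _, _, .caseNat t u v => t.Ok ∧ u.Ok ∧ v.Ok
  | _, _, .caseBool t u v => t.Ok ∧ u.Ok ∧ v.Ok
  | _, _, .caseList t u v => t.Ok ∧ u.Ok ∧ v.Ok
  | _, _, .letrec _ e => WDef e ∧ e.Ok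

/-! ### Renaming and substitution -/

abbrev Ren (Γ Δ : Ctx) : Type := ∀ ⦃α : Ty⦄, Var Γ α → Var Δ α

def Ren.lift {Γ Δ : Ctx} {β : Ty} (ξ : Ren Γ Δ) : Ren (β :: Γ) (β :: Δ)
  | _, .zero => .zero
  | _, .succ x => .succ (ξ x)

def Ren.nil {Δ : Ctx} : Ren [] Δ := fun _ x => nomatch x

/-- `wkₙ` skips the `n` most recent variables. -/
def wk0 {Γ : Ctx} : Ren Γ Γ := fun _ x => x
def wk1 {Γ : Ctx} {α : Ty} : Ren Γ (α :: Γ) := fun _ x => x.succ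
def wk2 {Γ : Ctx} {α β : Ty} : Ren Γ (β :: α :: Γ) := fun _ x => x.succ.succ
def wk3 {Γ : Ctx} {α β γ : Ty} : Ren Γ (γ :: β :: α :: Γ) := fun _ x => x.succ.succ.succ
def wk4 {Γ : Ctx} {α β γ δ : Ty} : Ren Γ (δ :: γ :: β :: α :: Γ) :=
  fun _ x => x.succ.succ.succ.succ
def wk6 {Γ : Ctx} {α β γ δ ε ζ : Ty} : Ren Γ (ζ :: ε :: δ :: γ :: β :: α :: Γ) :=
  fun _ x => x.succ.succ.succ.succ.succ.succ

/-- `Γ, x₁, f₁` into `Γ, x₁, x₂, f₁, f₂`. -/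
def recL {Γ : Ctx} {α₁ α₂ β₁ β₂ : Ty} : Ren (β₁ :: α₁ :: Γ) (β₂ :: β₁ :: α₂ :: α₁ :: Γ) :=
  fun _ x => (wk1.lift x).succ

/-- `Γ, x₂, f₂` into `Γ, x₁, x₂, f₁, f₂`. -/
def recR {Γ : Ctx} {α₁ α₂ β₁ β₂ : Ty} : Ren (β₂ :: α₂ :: Γ) (β₂ :: β₁ :: α₂ :: α₁ :: Γ)
  | _, .zero => .zero
  | _, .succ x => .succ (.succ (wk1.lift x))

def Tm.rename : {Γ : Ctx} → {α : Ty} → Tm Γ α → {Δ : Ctx} → Ren Γ Δ → Tm Δ α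
  | _, _, .var x, _, ξ => .var (ξ x)
  | _, _, .pair t u, _, ξ => .pair (t.rename ξ) (u.rename ξ)
  | _, _, .fst t, _, ξ => .fst (t.rename ξ)
  | _, _, .snd t, _, ξ => .snd (t.rename ξ)
  | _, _, .app t u, _, ξ => .app (t.rename ξ) (u.rename ξ)
  | _, _, .lam t, _, ξ => .lam (t.rename ξ.lift)
  | _, _, .tt, _, _ => .tt
  | _, _, .ff, _, _ => .ff
  | _, _, .zero, _, _ => .zero
  | _, _, .succ t, _, ξ => .succ (t.rename ξ)
  | _, _, .nil, _, _ => .nil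
  | _, _, .cons h t, _, ξ => .cons (h.rename ξ) (t.rename ξ)
  | _, _, .caseNat t u v, _, ξ => .caseNat (t.rename ξ) (u.rename ξ) (v.rename ξ)
  | _, _, .caseBool t u v, _, ξ => .caseBool (t.rename ξ) (u.rename ξ) (v.rename ξ)
  | _, _, .caseList t u v, _, ξ => .caseList (t.rename ξ) (u.rename ξ) (v.rename ξ)
  | _, _, .letrec h e, _, ξ => .letrec h (e.rename ξ.lift.lift)

abbrev Subst (Γ Δ : Ctx) : Type := ∀ ⦃α : Ty⦄, Var Γ α → Tm Δ α

def Ren.toSubst {Γ Δ : Ctx} (ξ : Ren Γ Δ) : Subst Γ Δ := fun _ x => .var (ξ x)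

def Subst.cons {Γ Δ : Ctx} {β : Ty} (t : Tm Δ β) (σ : Subst Γ Δ) : Subst (β :: Γ) Δ
  | _, .zero => t
  | _, .succ x => σ x

def Subst.lift {Γ Δ : Ctx} {β : Ty} (σ : Subst Γ Δ) : Subst (β :: Γ) (β :: Δ)
  | _, .zero => .var .zero
  | _, .succ x => (σ x).rename wk1

/-- Capture-avoiding parallel substitution. -/
def Tm.subst : {Γ : Ctx} → {α : Ty} → Tm Γ α → {Δ : Ctx} → Subst Γ Δ → Tm Δ α
  | _, _, .var x, _, σ => σ x
  | _, _, .pair t u, _, σ => .pair (t.subst σ) (u.subst σ)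
  | _, _, .fst t, _, σ => .fst (t.subst σ)
  | _, _, .snd t, _, σ => .snd (t.subst σ)
  | _, _, .app t u, _, σ => .app (t.subst σ) (u.subst σ)
  | _, _, .lam t, _, σ => .lam (t.subst σ.lift)
  | _, _, .tt, _, _ => .tt
  | _, _, .ff, _, _ => .ff
  | _, _, .zero, _, _ => .zero
  | _, _, .succ t, _, σ => .succ (t.subst σ)
  | _, _, .nil, _, _ => .nil
  | _, _, .cons h t, _, σ => .cons (h.subst σ) (t.subst σ)
  | _, _, .caseNat t u v, _, σ => .caseNat (t.subst σ) (u.subst σ) (v.subst σ)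
  | _, _, .caseBool t u v, _, σ => .caseBool (t.subst σ) (u.subst σ) (v.subst σ)
  | _, _, .caseList t u v, _, σ => .caseList (t.subst σ) (u.subst σ) (v.subst σ)
  | _, _, .letrec h e, _, σ => .letrec h (e.subst σ.lift.lift)

/-- `[t/x]` for the most recent variable `x`. -/
def Subst.one {Γ : Ctx} {α : Ty} (t : Tm Γ α) : Subst (α :: Γ) Γ := Subst.cons t wk0.toSubst

/-- `[t/x][u/y]` for the two most recent variables `x, y`. -/
def Subst.two {Γ : Ctx} {α β : Ty} (t : Tm Γ α) (u : Tm Γ β) : Subst (β :: α :: Γ) Γ :=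
  Subst.cons u (Subst.cons t wk0.toSubst)

/-- `vₙ` is the `n`-th most recent variable. -/
abbrev v0 {Γ : Ctx} {α : Ty} : Tm (α :: Γ) α := .var .zero
abbrev v1 {Γ : Ctx} {α β : Ty} : Tm (β :: α :: Γ) α := .var (.succ .zero)
abbrev v2 {Γ : Ctx} {α β γ : Ty} : Tm (γ :: β :: α :: Γ) α := .var (.succ (.succ .zero))
abbrev v3 {Γ : Ctx} {α β γ δ : Ty} : Tm (δ :: γ :: β :: α :: Γ) α :=
  .var (.succ (.succ (.succ .zero)))
abbrev v4 {Γ : Ctx} {α β γ δ ε : Ty} : Tm (ε :: δ :: γ :: β :: α :: Γ) α :=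
  .var (.succ (.succ (.succ (.succ .zero))))
abbrev v5 {Γ : Ctx} {α β γ δ ε ζ : Ty} : Tm (ζ :: ε :: δ :: γ :: β :: α :: Γ) α :=
  .var (.succ (.succ (.succ (.succ (.succ .zero)))))

/-! ### Conversion -/

/-- Terms with a constructor of an inductive type in head position. -/
inductive Tm.IsCtor : {Γ : Ctx} → {α : Ty} → Tm Γ α → Prop where
  | tt {Γ : Ctx} : Tm.IsCtor (.tt : Tm Γ .bool)
  | ff {Γ : Ctx} : Tm.IsCtor (.ff : Tm Γ .bool)
  | zero {Γ : Ctx} : Tm.IsCtor (.zero : Tm Γ .nat)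
  | succ {Γ : Ctx} (t : Tm Γ .nat) : Tm.IsCtor (.succ t)
  | nil {Γ : Ctx} {α : Ty} : Tm.IsCtor (.nil : Tm Γ (.list α))
  | cons {Γ : Ctx} {α : Ty} (h : Tm Γ α) (t : Tm Γ (.list α)) : Tm.IsCtor (.cons h t)

/-- One step of βιμ-reduction. Only well-defined recursive definitions are unfolded. -/
inductive Step : {Γ : Ctx} → {α : Ty} → Tm Γ α → Tm Γ α → Prop where
  | beta {Γ : Ctx} {α β : Ty} (t : Tm (α :: Γ) β) (u : Tm Γ α) :
      Step (.app (.lam t) u) (t.subst (Subst.one u))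
  | fstPair {Γ : Ctx} {α β : Ty} (t : Tm Γ α) (u : Tm Γ β) : Step (.fst (.pair t u)) t
  | sndPair {Γ : Ctx} {α β : Ty} (t : Tm Γ α) (u : Tm Γ β) : Step (.snd (.pair t u)) u
  | caseZero {Γ : Ctx} {σ : Ty} (u : Tm Γ σ) (v : Tm Γ (.arr .nat σ)) :
      Step (.caseNat .zero u v) u
  | caseSucc {Γ : Ctx} {σ : Ty} (t : Tm Γ .nat) (u : Tm Γ σ) (v : Tm Γ (.arr .nat σ)) :
      Step (.caseNat (.succ t) u v) (.app v t)
  | caseTrue {Γ : Ctx} {σ : Ty} (u v : Tm Γ σ) : Step (.caseBool .tt u v) u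
  | caseFalse {Γ : Ctx} {σ : Ty} (u v : Tm Γ σ) : Step (.caseBool .ff u v) v
  | caseNil {Γ : Ctx} {α σ : Ty} (u : Tm Γ σ) (v : Tm Γ (.arr α (.arr (.list α) σ))) :
      Step (.caseList .nil u v) u
  | caseCons {Γ : Ctx} {α σ : Ty} (h : Tm Γ α) (t : Tm Γ (.list α)) (u : Tm Γ σ)
      (v : Tm Γ (.arr α (.arr (.list α) σ))) :
      Step (.caseList (.cons h t) u v) (.app (.app v h) t)
  | mu {Γ : Ctx} {α β : Ty} (h : Ind α) (e : Tm (.arr α β :: α :: Γ) β) (u : Tm Γ α)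
      (hd : WDef e) (hu : u.IsCtor) :
      Step (.app (.letrec h e) u) (e.subst (Subst.two u (.letrec h e)))
  | pairL {Γ : Ctx} {α β : Ty} {t t' : Tm Γ α} (u : Tm Γ β) :
      Step t t' → Step (.pair t u) (.pair t' u)
  | pairR {Γ : Ctx} {α β : Ty} (t : Tm Γ α) {u u' : Tm Γ β} :
      Step u u' → Step (.pair t u) (.pair t u')
  | fst {Γ : Ctx} {α β : Ty} {t t' : Tm Γ (.prod α β)} : Step t t' → Step (.fst t) (.fst t')
  | snd {Γ : Ctx} {α β : Ty} {t t' : Tm Γ (.prod α β)} : Step t t' → Step (.snd t) (.snd t')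
  | appL {Γ : Ctx} {α β : Ty} {t t' : Tm Γ (.arr α β)} (u : Tm Γ α) :
      Step t t' → Step (.app t u) (.app t' u)
  | appR {Γ : Ctx} {α β : Ty} (t : Tm Γ (.arr α β)) {u u' : Tm Γ α} :
      Step u u' → Step (.app t u) (.app t u')
  | lam {Γ : Ctx} {α β : Ty} {t t' : Tm (α :: Γ) β} : Step t t' → Step (.lam t) (.lam t')
  | succ {Γ : Ctx} {t t' : Tm Γ .nat} : Step t t' → Step (.succ t) (.succ t')
  | consL {Γ : Ctx} {α : Ty} {h h' : Tm Γ α} (t : Tm Γ (.list α)) :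
      Step h h' → Step (.cons h t) (.cons h' t)
  | consR {Γ : Ctx} {α : Ty} (h : Tm Γ α) {t t' : Tm Γ (.list α)} :
      Step t t' → Step (.cons h t) (.cons h t')
  | caseNat1 {Γ : Ctx} {σ : Ty} {t t' : Tm Γ .nat} (u : Tm Γ σ) (v : Tm Γ (.arr .nat σ)) :
      Step t t' → Step (.caseNat t u v) (.caseNat t' u v)
  | caseNat2 {Γ : Ctx} {σ : Ty} (t : Tm Γ .nat) {u u' : Tm Γ σ} (v : Tm Γ (.arr .nat σ)) :
      Step u u' → Step (.caseNat t u v) (.caseNat t u' v)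
  | caseNat3 {Γ : Ctx} {σ : Ty} (t : Tm Γ .nat) (u : Tm Γ σ) {v v' : Tm Γ (.arr .nat σ)} :
      Step v v' → Step (.caseNat t u v) (.caseNat t u v')
  | caseBool1 {Γ : Ctx} {σ : Ty} {t t' : Tm Γ .bool} (u v : Tm Γ σ) :
      Step t t' → Step (.caseBool t u v) (.caseBool t' u v)
  | caseBool2 {Γ : Ctx} {σ : Ty} (t : Tm Γ .bool) {u u' : Tm Γ σ} (v : Tm Γ σ) :
      Step u u' → Step (.caseBool t u v) (.caseBool t u' v)
  | caseBool3 {Γ : Ctx} {σ : Ty} (t : Tm Γ .bool) (u : Tm Γ σ) {v v' : Tm Γ σ} :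
      Step v v' → Step (.caseBool t u v) (.caseBool t u v')
  | caseList1 {Γ : Ctx} {α σ : Ty} {t t' : Tm Γ (.list α)} (u : Tm Γ σ)
      (v : Tm Γ (.arr α (.arr (.list α) σ))) :
      Step t t' → Step (.caseList t u v) (.caseList t' u v)
  | caseList2 {Γ : Ctx} {α σ : Ty} (t : Tm Γ (.list α)) {u u' : Tm Γ σ}
      (v : Tm Γ (.arr α (.arr (.list α) σ))) :
      Step u u' → Step (.caseList t u v) (.caseList t u' v)
  | caseList3 {Γ : Ctx} {α σ : Ty} (t : Tm Γ (.list α)) (u : Tm Γ σ)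
      {v v' : Tm Γ (.arr α (.arr (.list α) σ))} :
      Step v v' → Step (.caseList t u v) (.caseList t u v')
  | letrec {Γ : Ctx} {α β : Ty} (h : Ind α) {e e' : Tm (.arr α β :: α :: Γ) β} :
      Step e e' → Step (.letrec h e) (.letrec h e')

/-- βιμ-conversion. -/
def Conv {Γ : Ctx} {α : Ty} (t t' : Tm Γ α) : Prop := Relation.EqvGen Step t t'

/-! ## Higher-order logic -/

/-- Basic predicate symbols, with the types of their arguments, besides the built-in ones. -/
structure Signature where
  Pred : Type u
  arity : Pred → List Ty

/-- Assertions. Equality, the comparison of sizes, `All` and `All2` are built-in predicates: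
`listAll l φ` is `All(l, λx.φ)`, `listAll2 l₁ l₂ φ` is `All2(l₁, l₂, λx₁.λx₂.φ)`, and `sizeLe`,
`sizeLt` are `|t| ≤ |u|`, `|t| < |u|`. -/
inductive Form (S : Signature.{u}) : Ctx → Type u where
  | pred {Γ : Ctx} (P : S.Pred)
      (ts : ∀ i : Fin (S.arity P).length, Tm Γ ((S.arity P).get i)) : Form S Γ
  | eq {Γ : Ctx} {α : Ty} (t u : Tm Γ α) : Form S Γ
  | sizeLe {Γ : Ctx} {α : Ty} (h : Ind α) (t u : Tm Γ α) : Form S Γ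
  | sizeLt {Γ : Ctx} {α : Ty} (h : Ind α) (t u : Tm Γ α) : Form S Γ
  | listAll {Γ : Ctx} {α : Ty} (l : Tm Γ (.list α)) (φ : Form S (α :: Γ)) : Form S Γ
  | listAll2 {Γ : Ctx} {α β : Ty} (l₁ : Tm Γ (.list α)) (l₂ : Tm Γ (.list β))
      (φ : Form S (β :: α :: Γ)) : Form S Γ
  | top {Γ : Ctx} : Form S Γ
  | bot {Γ : Ctx} : Form S Γ
  | and {Γ : Ctx} (φ ψ : Form S Γ) : Form S Γ
  | or {Γ : Ctx} (φ ψ : Form S Γ) : Form S Γ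
  | imp {Γ : Ctx} (φ ψ : Form S Γ) : Form S Γ
  | all {Γ : Ctx} (α : Ty) (φ : Form S (α :: Γ)) : Form S Γ
  | ex {Γ : Ctx} (α : Ty) (φ : Form S (α :: Γ)) : Form S Γ

/-- `Γ ⊢ φ`: every recursive definition in `φ` is well-defined (the rest of the typing is in the
indices). -/
def Form.Ok {S : Signature.{u}} : {Γ : Ctx} → Form S Γ → Prop
  | _, .pred _ ts => ∀ i, (ts i).Ok
  | _, .eq t u => t.Ok ∧ u.Ok
  | _, .sizeLe _ t u => t.Ok ∧ u.Ok
  | _, .sizeLt _ t u => t.Ok ∧ u.Ok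
  | _, .listAll l φ => l.Ok ∧ φ.Ok
  | _, .listAll2 l₁ l₂ φ => l₁.Ok ∧ l₂.Ok ∧ φ.Ok
  | _, .top => True
  | _, .bot => True
  | _, .and φ ψ => φ.Ok ∧ ψ.Ok
  | _, .or φ ψ => φ.Ok ∧ ψ.Ok
  | _, .imp φ ψ => φ.Ok ∧ ψ.Ok
  | _, .all _ φ => φ.Ok
  | _, .ex _ φ => φ.Ok

def Form.rename {S : Signature.{u}} : {Γ : Ctx} → Form S Γ → {Δ : Ctx} → Ren Γ Δ → Form S Δ
  | _, .pred P ts, _, ξ => .pred P fun i => (ts i).rename ξ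
  | _, .eq t u, _, ξ => .eq (t.rename ξ) (u.rename ξ)
  | _, .sizeLe h t u, _, ξ => .sizeLe h (t.rename ξ) (u.rename ξ)
  | _, .sizeLt h t u, _, ξ => .sizeLt h (t.rename ξ) (u.rename ξ)
  | _, .listAll l φ, _, ξ => .listAll (l.rename ξ) (φ.rename ξ.lift)
  | _, .listAll2 l₁ l₂ φ, _, ξ =>
      .listAll2 (l₁.rename ξ) (l₂.rename ξ) (φ.rename ξ.lift.lift)
  | _, .top, _, _ => .top
  | _, .bot, _, _ => .bot
  | _, .and φ ψ, _, ξ => .and (φ.rename ξ) (ψ.rename ξ)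
  | _, .or φ ψ, _, ξ => .or (φ.rename ξ) (ψ.rename ξ)
  | _, .imp φ ψ, _, ξ => .imp (φ.rename ξ) (ψ.rename ξ)
  | _, .all α φ, _, ξ => .all α (φ.rename ξ.lift)
  | _, .ex α φ, _, ξ => .ex α (φ.rename ξ.lift)

def Form.subst {S : Signature.{u}} : {Γ : Ctx} → Form S Γ → {Δ : Ctx} → Subst Γ Δ → Form S Δ
  | _, .pred P ts, _, σ => .pred P fun i => (ts i).subst σ
  | _, .eq t u, _, σ => .eq (t.subst σ) (u.subst σ)
  | _, .sizeLe h t u, _, σ => .sizeLe h (t.subst σ) (u.subst σ)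
  | _, .sizeLt h t u, _, σ => .sizeLt h (t.subst σ) (u.subst σ)
  | _, .listAll l φ, _, σ => .listAll (l.subst σ) (φ.subst σ.lift)
  | _, .listAll2 l₁ l₂ φ, _, σ =>
      .listAll2 (l₁.subst σ) (l₂.subst σ) (φ.subst σ.lift.lift)
  | _, .top, _, _ => .top
  | _, .bot, _, _ => .bot
  | _, .and φ ψ, _, σ => .and (φ.subst σ) (ψ.subst σ)
  | _, .or φ ψ, _, σ => .or (φ.subst σ) (ψ.subst σ)
  | _, .imp φ ψ, _, σ => .imp (φ.subst σ) (ψ.subst σ)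
  | _, .all α φ, _, σ => .all α (φ.subst σ.lift)
  | _, .ex α φ, _, σ => .ex α (φ.subst σ.lift)

/-- `φ[t/x]` for the most recent variable `x` of `φ`; the others are moved along `ξ`. -/
def Form.at1 {S : Signature.{u}} {Γ Δ : Ctx} {α : Ty} (φ : Form S (α :: Γ)) (ξ : Ren Γ Δ)
    (t : Tm Δ α) : Form S Δ :=
  φ.subst (Subst.cons t ξ.toSubst)

/-- `φ[t/x][u/y]` for the two most recent variables `x, y` of `φ`; the others are moved
along `ξ`. -/
def Form.at2 {S : Signature.{u}} {Γ Δ : Ctx} {α β : Ty} (φ : Form S (β :: α :: Γ)) (ξ : Ren Γ Δ)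
    (t : Tm Δ α) (u : Tm Δ β) : Form S Δ :=
  φ.subst (Subst.cons u (Subst.cons t ξ.toSubst))

def Form.iff {S : Signature.{u}} {Γ : Ctx} (φ ψ : Form S Γ) : Form S Γ :=
  .and (.imp φ ψ) (.imp ψ φ)

/-- `(|t₁|, |t₂|) < (|u₁|, |u₂|)`: both components are at most, and one is strictly less. -/
def Form.sizeLt2 {S : Signature.{u}} {Γ : Ctx} {α β : Ty} (h₁ : Ind α) (h₂ : Ind β)
    (t₁ : Tm Γ α) (t₂ : Tm Γ β) (u₁ : Tm Γ α) (u₂ : Tm Γ β) : Form S Γ :=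
  .and (.sizeLe h₁ t₁ u₁) (.and (.sizeLe h₂ t₂ u₂) (.or (.sizeLt h₁ t₁ u₁) (.sizeLt h₂ t₂ u₂)))

/-- A set of assertions moved along a renaming. -/
def hyps {S : Signature.{u}} {Γ Δ : Ctx} (ξ : Ren Γ Δ) (Ψ : List (Form S Γ)) : List (Form S Δ) :=
  Ψ.map fun ψ => ψ.rename ξ

/-- An axiomatization of the basic predicates by closed well-formed assertions. -/
structure Theory (S : Signature.{u}) where
  ax : Set (Form S [])
  ok : ∀ φ ∈ ax, φ.Ok

/-- Axioms of the built-in predicates, and non-overlap of constructors. -/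
inductive BasicAx {S : Signature.{u}} : {Γ : Ctx} → Form S Γ → Prop where
  | nilCons {Γ : Ctx} {α : Ty} (h : Tm Γ α) (t : Tm Γ (.list α)) :
      BasicAx (.imp (.eq .nil (.cons h t)) .bot)
  | zeroSucc {Γ : Ctx} (t : Tm Γ .nat) : BasicAx (.imp (.eq .zero (.succ t)) .bot)
  | trueFalse {Γ : Ctx} : BasicAx (.imp (.eq (.tt : Tm Γ .bool) .ff) .bot)
  | allNil {Γ : Ctx} {α : Ty} (φ : Form S (α :: Γ)) : BasicAx (.listAll .nil φ)
  | allCons {Γ : Ctx} {α : Ty} (h : Tm Γ α) (t : Tm Γ (.list α)) (φ : Form S (α :: Γ)) :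
      BasicAx (.iff (.listAll (.cons h t) φ) (.and (φ.at1 wk0 h) (.listAll t φ)))
  | all2Nil {Γ : Ctx} {α β : Ty} (φ : Form S (β :: α :: Γ)) : BasicAx (.listAll2 .nil .nil φ)
  | all2Cons {Γ : Ctx} {α β : Ty} (h₁ : Tm Γ α) (h₂ : Tm Γ β) (t₁ : Tm Γ (.list α))
      (t₂ : Tm Γ (.list β)) (φ : Form S (β :: α :: Γ)) :
      BasicAx (.iff (.listAll2 (.cons h₁ t₁) (.cons h₂ t₂) φ)
        (.and (φ.at2 wk0 h₁ h₂) (.listAll2 t₁ t₂ φ)))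
  | all2NilCons {Γ : Ctx} {α β : Ty} (h₂ : Tm Γ β) (t₂ : Tm Γ (.list β))
      (φ : Form S (β :: α :: Γ)) : BasicAx (.imp (.listAll2 .nil (.cons h₂ t₂) φ) .bot)
  | all2ConsNil {Γ : Ctx} {α β : Ty} (h₁ : Tm Γ α) (t₁ : Tm Γ (.list α))
      (φ : Form S (β :: α :: Γ)) : BasicAx (.imp (.listAll2 (.cons h₁ t₁) .nil φ) .bot)
  | leZero {Γ : Ctx} (t : Tm Γ .nat) : BasicAx (.sizeLe .nat .zero t)
  | leSuccZero {Γ : Ctx} (t : Tm Γ .nat) : BasicAx (.imp (.sizeLe .nat (.succ t) .zero) .bot)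
  | leSucc {Γ : Ctx} (t u : Tm Γ .nat) :
      BasicAx (.iff (.sizeLe .nat (.succ t) (.succ u)) (.sizeLe .nat t u))
  | ltZero {Γ : Ctx} (t : Tm Γ .nat) : BasicAx (.imp (.sizeLt .nat t .zero) .bot)
  | ltSucc {Γ : Ctx} (t u : Tm Γ .nat) :
      BasicAx (.iff (.sizeLt .nat t (.succ u)) (.sizeLe .nat t u))
  | leNil {Γ : Ctx} {α : Ty} (t : Tm Γ (.list α)) : BasicAx (.sizeLe (.list α) .nil t)
  | leConsNil {Γ : Ctx} {α : Ty} (h : Tm Γ α) (t : Tm Γ (.list α)) :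
      BasicAx (.imp (.sizeLe (.list α) (.cons h t) .nil) .bot)
  | leCons {Γ : Ctx} {α : Ty} (h h' : Tm Γ α) (t t' : Tm Γ (.list α)) :
      BasicAx (.iff (.sizeLe (.list α) (.cons h t) (.cons h' t')) (.sizeLe (.list α) t t'))
  | ltNil {Γ : Ctx} {α : Ty} (t : Tm Γ (.list α)) :
      BasicAx (.imp (.sizeLt (.list α) t .nil) .bot)
  | ltCons {Γ : Ctx} {α : Ty} (h' : Tm Γ α) (t t' : Tm Γ (.list α)) :
      BasicAx (.iff (.sizeLt (.list α) t (.cons h' t')) (.sizeLe (.list α) t t'))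

/-- Well-formedness of a judgment `Γ ∣ Ψ ⊢ φ`. -/
def WfHOL {S : Signature.{u}} {Γ : Ctx} (Ψ : List (Form S Γ)) (φ : Form S Γ) : Prop :=
  (∀ ψ ∈ Ψ, ψ.Ok) ∧ φ.Ok

/-- Derivability of `Γ ∣ Ψ ⊢ φ`. All judgments in a derivation are well-formed. -/
inductive HOL {S : Signature.{u}} (𝒯 : Theory S) :
    {Γ : Ctx} → List (Form S Γ) → Form S Γ → Prop where
  | ax {Γ : Ctx} {Ψ : List (Form S Γ)} {φ : Form S Γ} (wf : WfHOL Ψ φ) : φ ∈ Ψ → HOL 𝒯 Ψ φ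
  | theory {Γ : Ctx} {Ψ : List (Form S Γ)} {φ : Form S []}
      (wf : WfHOL Ψ (φ.rename Ren.nil)) :
      φ ∈ 𝒯.ax → HOL 𝒯 Ψ (φ.rename Ren.nil)
  | basic {Γ : Ctx} {Ψ : List (Form S Γ)} {φ : Form S Γ} (wf : WfHOL Ψ φ) :
      BasicAx φ → HOL 𝒯 Ψ φ
  | conv {Γ : Ctx} {Ψ : List (Form S Γ)} {α : Ty} {t t' : Tm Γ α} (wf : WfHOL Ψ (.eq t t')) :
      Conv t t' → HOL 𝒯 Ψ (.eq t t')
  | subst {Γ : Ctx} {Ψ : List (Form S Γ)} {α : Ty} {t u : Tm Γ α} (φ : Form S (α :: Γ))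
      (hφ : φ.Ok) (wf : WfHOL Ψ (φ.at1 wk0 u)) :
      HOL 𝒯 Ψ (φ.at1 wk0 t) → HOL 𝒯 Ψ (.eq t u) → HOL 𝒯 Ψ (φ.at1 wk0 u)
  | impI {Γ : Ctx} {Ψ : List (Form S Γ)} {φ ψ : Form S Γ} (wf : WfHOL Ψ (.imp ψ φ)) :
      HOL 𝒯 (ψ :: Ψ) φ → HOL 𝒯 Ψ (.imp ψ φ)
  | impE {Γ : Ctx} {Ψ : List (Form S Γ)} {φ ψ : Form S Γ} (wf : WfHOL Ψ φ) :
      HOL 𝒯 Ψ (.imp ψ φ) → HOL 𝒯 Ψ ψ → HOL 𝒯 Ψ φ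
  | allI {Γ : Ctx} {Ψ : List (Form S Γ)} {α : Ty} {φ : Form S (α :: Γ)}
      (wf : WfHOL Ψ (.all α φ)) : HOL 𝒯 (hyps wk1 Ψ) φ → HOL 𝒯 Ψ (.all α φ)
  | allE {Γ : Ctx} {Ψ : List (Form S Γ)} {α : Ty} {φ : Form S (α :: Γ)} (t : Tm Γ α)
      (ht : t.Ok) (wf : WfHOL Ψ (φ.at1 wk0 t)) :
      HOL 𝒯 Ψ (.all α φ) → HOL 𝒯 Ψ (φ.at1 wk0 t)
  | exI {Γ : Ctx} {Ψ : List (Form S Γ)} {α : Ty} {φ : Form S (α :: Γ)} (t : Tm Γ α)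
      (ht : t.Ok) (wf : WfHOL Ψ (.ex α φ)) : HOL 𝒯 Ψ (φ.at1 wk0 t) → HOL 𝒯 Ψ (.ex α φ)
  | exE {Γ : Ctx} {Ψ : List (Form S Γ)} {α : Ty} {φ : Form S (α :: Γ)} {χ : Form S Γ}
      (wf : WfHOL Ψ χ) :
      HOL 𝒯 Ψ (.ex α φ) → HOL 𝒯 (φ :: hyps wk1 Ψ) (χ.rename wk1) → HOL 𝒯 Ψ χ
  | topI {Γ : Ctx} {Ψ : List (Form S Γ)} (wf : WfHOL Ψ .top) : HOL 𝒯 Ψ .top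
  | botE {Γ : Ctx} {Ψ : List (Form S Γ)} {φ : Form S Γ} (wf : WfHOL Ψ φ) :
      HOL 𝒯 Ψ .bot → HOL 𝒯 Ψ φ
  | andI {Γ : Ctx} {Ψ : List (Form S Γ)} {φ ψ : Form S Γ} (wf : WfHOL Ψ (.and φ ψ)) :
      HOL 𝒯 Ψ φ → HOL 𝒯 Ψ ψ → HOL 𝒯 Ψ (.and φ ψ)
  | andE1 {Γ : Ctx} {Ψ : List (Form S Γ)} {φ ψ : Form S Γ} (wf : WfHOL Ψ φ) :
      HOL 𝒯 Ψ (.and φ ψ) → HOL 𝒯 Ψ φ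
  | andE2 {Γ : Ctx} {Ψ : List (Form S Γ)} {φ ψ : Form S Γ} (wf : WfHOL Ψ ψ) :
      HOL 𝒯 Ψ (.and φ ψ) → HOL 𝒯 Ψ ψ
  | orI1 {Γ : Ctx} {Ψ : List (Form S Γ)} {φ ψ : Form S Γ} (wf : WfHOL Ψ (.or φ ψ)) :
      HOL 𝒯 Ψ φ → HOL 𝒯 Ψ (.or φ ψ)
  | orI2 {Γ : Ctx} {Ψ : List (Form S Γ)} {φ ψ : Form S Γ} (wf : WfHOL Ψ (.or φ ψ)) :
      HOL 𝒯 Ψ ψ → HOL 𝒯 Ψ (.or φ ψ)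
  | orE {Γ : Ctx} {Ψ : List (Form S Γ)} {φ ψ χ : Form S Γ} (wf : WfHOL Ψ χ) :
      HOL 𝒯 Ψ (.or φ ψ) → HOL 𝒯 (φ :: Ψ) χ → HOL 𝒯 (ψ :: Ψ) χ → HOL 𝒯 Ψ χ
  | listInd {Γ : Ctx} {Ψ : List (Form S Γ)} {α : Ty} {φ : Form S (.list α :: Γ)}
      (wf : WfHOL Ψ (.all (.list α) φ)) :
      HOL 𝒯 Ψ (φ.at1 wk0 .nil) →
      HOL 𝒯 (φ.at1 (wk2 (α := α)) v0 :: hyps wk2 Ψ) (φ.at1 wk2 (.cons v1 v0)) →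
      HOL 𝒯 Ψ (.all (.list α) φ)
  | natInd {Γ : Ctx} {Ψ : List (Form S Γ)} {φ : Form S (.nat :: Γ)}
      (wf : WfHOL Ψ (.all .nat φ)) :
      HOL 𝒯 Ψ (φ.at1 wk0 .zero) → HOL 𝒯 (φ :: hyps wk1 Ψ) (φ.at1 wk1 (.succ v0)) →
      HOL 𝒯 Ψ (.all .nat φ)
  | boolInd {Γ : Ctx} {Ψ : List (Form S Γ)} {φ : Form S (.bool :: Γ)}
      (wf : WfHOL Ψ (.all .bool φ)) :
      HOL 𝒯 Ψ (φ.at1 wk0 .tt) → HOL 𝒯 Ψ (φ.at1 wk0 .ff) → HOL 𝒯 Ψ (.all .bool φ)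
  | cons1 {Γ : Ctx} {Ψ : List (Form S Γ)} {α : Ty} {h h' : Tm Γ α} {t t' : Tm Γ (.list α)}
      (wf : WfHOL Ψ (.eq h h')) : HOL 𝒯 Ψ (.eq (.cons h t) (.cons h' t')) → HOL 𝒯 Ψ (.eq h h')
  | cons2 {Γ : Ctx} {Ψ : List (Form S Γ)} {α : Ty} {h h' : Tm Γ α} {t t' : Tm Γ (.list α)}
      (wf : WfHOL Ψ (.eq t t')) : HOL 𝒯 Ψ (.eq (.cons h t) (.cons h' t')) → HOL 𝒯 Ψ (.eq t t')
  | succ1 {Γ : Ctx} {Ψ : List (Form S Γ)} {t t' : Tm Γ .nat} (wf : WfHOL Ψ (.eq t t')) :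
      HOL 𝒯 Ψ (.eq (.succ t) (.succ t')) → HOL 𝒯 Ψ (.eq t t')
  | strongInd {Γ : Ctx} {Ψ : List (Form S Γ)} {α : Ty} (h : Ind α) {φ : Form S (α :: Γ)}
      (wf : WfHOL Ψ (.all α φ)) :
      HOL 𝒯 (.all α (.imp (.sizeLt h v0 v1) (φ.at1 wk2 v0)) :: hyps wk1 Ψ) φ →
      HOL 𝒯 Ψ (.all α φ)

/-- Interpretation of the basic predicates. -/
def Interp (S : Signature.{u}) : Type u :=
  ∀ P : S.Pred, (∀ i : Fin (S.arity P).length, ((S.arity P).get i).den) → Prop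

/-- Set-theoretic interpretation of assertions. -/
def Form.den {S : Signature.{u}} (M : Interp S) : {Γ : Ctx} → Form S Γ → Env Γ → Prop
  | _, .pred P ts, ρ => M P fun i => (ts i).den ρ
  | _, .eq t u, ρ => t.den ρ = u.den ρ
  | _, .sizeLe (α := α) _ t u, ρ => α.size (t.den ρ) ≤ α.size (u.den ρ)
  | _, .sizeLt (α := α) _ t u, ρ => α.size (t.den ρ) < α.size (u.den ρ)
  | _, .listAll (α := α) l φ, ρ => ∀ v : α.den, v ∈ (l.den ρ : List α.den) → φ.den M (ρ.cons v)
  | _, .listAll2 (α := α) (β := β) l₁ l₂ φ, ρ =>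
      List.Forall₂ (fun (v : α.den) (w : β.den) => φ.den M ((ρ.cons v).cons w))
        (l₁.den ρ) (l₂.den ρ)
  | _, .top, _ => True
  | _, .bot, _ => False
  | _, .and φ ψ, ρ => φ.den M ρ ∧ ψ.den M ρ
  | _, .or φ ψ, ρ => φ.den M ρ ∨ ψ.den M ρ
  | _, .imp φ ψ, ρ => φ.den M ρ → ψ.den M ρ
  | _, .all α φ, ρ => ∀ v : α.den, φ.den M (ρ.cons v)
  | _, .ex α φ, ρ => ∃ v : α.den, φ.den M (ρ.cons v)

/-! ## Unary higher-order logic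

The assertion of a judgment `Γ ∣ Ψ ⊢ t : σ ∣ φ` lives in `Γ, r : σ`. -/

/-- `∀x. φ' ⇒ φ[r x/r]`. -/
def Form.arrow {S : Signature.{u}} {Γ : Ctx} {τ σ : Ty} (φ' : Form S (τ :: Γ))
    (φ : Form S (σ :: τ :: Γ)) : Form S (.arr τ σ :: Γ) :=
  .all τ (.imp (φ'.rename wk1.lift) (φ.at1 wk1.lift (.app v1 v0)))

/-- Well-formedness of a judgment `Γ ∣ Ψ ⊢ t : σ ∣ φ`. -/
def WfUHOL {S : Signature.{u}} {Γ : Ctx} {σ : Ty} (Ψ : List (Form S Γ)) (t : Tm Γ σ)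
    (φ : Form S (σ :: Γ)) : Prop :=
  (∀ ψ ∈ Ψ, ψ.Ok) ∧ t.Ok ∧ φ.Ok

/-- Derivability of `Γ ∣ Ψ ⊢ t : σ ∣ φ`. -/
inductive UHOL {S : Signature.{u}} (𝒯 : Theory S) :
    {Γ : Ctx} → List (Form S Γ) → {σ : Ty} → Tm Γ σ → Form S (σ :: Γ) → Prop where
  | var {Γ : Ctx} {Ψ : List (Form S Γ)} {σ : Ty} {x : Var Γ σ} {φ : Form S (σ :: Γ)}
      (wf : WfUHOL Ψ (.var x) φ) : HOL 𝒯 Ψ (φ.at1 wk0 (.var x)) → UHOL 𝒯 Ψ (.var x) φ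
  | abs {Γ : Ctx} {Ψ : List (Form S Γ)} {τ σ : Ty} {t : Tm (τ :: Γ) σ} {φ' : Form S (τ :: Γ)}
      {φ : Form S (σ :: τ :: Γ)} (wf : WfUHOL Ψ (.lam t) (φ'.arrow φ)) :
      UHOL 𝒯 (φ' :: hyps wk1 Ψ) t φ → UHOL 𝒯 Ψ (.lam t) (φ'.arrow φ)
  | app {Γ : Ctx} {Ψ : List (Form S Γ)} {τ σ : Ty} {t : Tm Γ (.arr τ σ)} {u : Tm Γ τ}
      {φ' : Form S (τ :: Γ)} {φ : Form S (σ :: τ :: Γ)}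
      (wf : WfUHOL Ψ (.app t u) (φ.subst (Subst.one u).lift)) :
      UHOL 𝒯 Ψ t (φ'.arrow φ) → UHOL 𝒯 Ψ u φ' →
      UHOL 𝒯 Ψ (.app t u) (φ.subst (Subst.one u).lift)
  | tt {Γ : Ctx} {Ψ : List (Form S Γ)} {φ : Form S (.bool :: Γ)} (wf : WfUHOL Ψ .tt φ) :
      HOL 𝒯 Ψ (φ.at1 wk0 .tt) → UHOL 𝒯 Ψ .tt φ
  | ff {Γ : Ctx} {Ψ : List (Form S Γ)} {φ : Form S (.bool :: Γ)} (wf : WfUHOL Ψ .ff φ) :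
      HOL 𝒯 Ψ (φ.at1 wk0 .ff) → UHOL 𝒯 Ψ .ff φ
  | zero {Γ : Ctx} {Ψ : List (Form S Γ)} {φ : Form S (.nat :: Γ)} (wf : WfUHOL Ψ .zero φ) :
      HOL 𝒯 Ψ (φ.at1 wk0 .zero) → UHOL 𝒯 Ψ .zero φ
  | succ {Γ : Ctx} {Ψ : List (Form S Γ)} {t : Tm Γ .nat} {φ' φ : Form S (.nat :: Γ)}
      (wf : WfUHOL Ψ (.succ t) φ) :
      UHOL 𝒯 Ψ t φ' →
      HOL 𝒯 Ψ (.all .nat (.imp φ' (φ.at1 wk1 (.succ v0)))) →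
      UHOL 𝒯 Ψ (.succ t) φ
  | nil {Γ : Ctx} {Ψ : List (Form S Γ)} {σ : Ty} {φ : Form S (.list σ :: Γ)}
      (wf : WfUHOL Ψ .nil φ) : HOL 𝒯 Ψ (φ.at1 wk0 .nil) → UHOL 𝒯 Ψ .nil φ
  | cons {Γ : Ctx} {Ψ : List (Form S Γ)} {σ : Ty} {h : Tm Γ σ} {t : Tm Γ (.list σ)}
      {φ' : Form S (σ :: Γ)} {φ'' φ : Form S (.list σ :: Γ)} (wf : WfUHOL Ψ (.cons h t) φ) :
      UHOL 𝒯 Ψ h φ' → UHOL 𝒯 Ψ t φ'' →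
      HOL 𝒯 Ψ (.all σ (.all (.list σ)
        (.imp (φ'.at1 wk2 v1) (.imp (φ''.at1 wk2 v0) (φ.at1 wk2 (.cons v1 v0)))))) →
      UHOL 𝒯 Ψ (.cons h t) φ
  | pair {Γ : Ctx} {Ψ : List (Form S Γ)} {σ τ : Ty} {t : Tm Γ σ} {u : Tm Γ τ}
      {φ' : Form S (σ :: Γ)} {φ'' : Form S (τ :: Γ)} {φ : Form S (.prod σ τ :: Γ)}
      (wf : WfUHOL Ψ (.pair t u) φ) :
      UHOL 𝒯 Ψ t φ' → UHOL 𝒯 Ψ u φ'' →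
      HOL 𝒯 Ψ (.all σ (.all τ
        (.imp (φ'.at1 wk2 v1) (.imp (φ''.at1 wk2 v0) (φ.at1 wk2 (.pair v1 v0)))))) →
      UHOL 𝒯 Ψ (.pair t u) φ
  | fst {Γ : Ctx} {Ψ : List (Form S Γ)} {σ τ : Ty} {t : Tm Γ (.prod σ τ)} {φ : Form S (σ :: Γ)}
      (wf : WfUHOL Ψ (.fst t) φ) : UHOL 𝒯 Ψ t (φ.at1 wk1 (.fst v0)) → UHOL 𝒯 Ψ (.fst t) φ
  | snd {Γ : Ctx} {Ψ : List (Form S Γ)} {σ τ : Ty} {t : Tm Γ (.prod σ τ)} {φ : Form S (τ :: Γ)}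
      (wf : WfUHOL Ψ (.snd t) φ) : UHOL 𝒯 Ψ t (φ.at1 wk1 (.snd v0)) → UHOL 𝒯 Ψ (.snd t) φ
  | sub {Γ : Ctx} {Ψ : List (Form S Γ)} {σ : Ty} {t : Tm Γ σ} {φ' φ : Form S (σ :: Γ)}
      (wf : WfUHOL Ψ t φ) :
      UHOL 𝒯 Ψ t φ' → HOL 𝒯 Ψ (.imp (φ'.at1 wk0 t) (φ.at1 wk0 t)) → UHOL 𝒯 Ψ t φ
  | boolCase {Γ : Ctx} {Ψ : List (Form S Γ)} {σ : Ty} {t : Tm Γ .bool} {u v : Tm Γ σ}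
      {φ : Form S (σ :: Γ)} (wf : WfUHOL Ψ (.caseBool t u v) φ) :
      UHOL 𝒯 (.eq t .tt :: Ψ) u φ → UHOL 𝒯 (.eq t .ff :: Ψ) v φ →
      UHOL 𝒯 Ψ (.caseBool t u v) φ
  | natCase {Γ : Ctx} {Ψ : List (Form S Γ)} {σ : Ty} {t : Tm Γ .nat} {u : Tm Γ σ}
      {v : Tm Γ (.arr .nat σ)} {φ : Form S (σ :: Γ)} (wf : WfUHOL Ψ (.caseNat t u v) φ) :
      UHOL 𝒯 (.eq t .zero :: Ψ) u φ →
      UHOL 𝒯 Ψ v (.all .nat (.imp (.eq (t.rename wk2) (.succ v0)) (φ.at1 wk2 (.app v1 v0)))) →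
      UHOL 𝒯 Ψ (.caseNat t u v) φ
  | listCase {Γ : Ctx} {Ψ : List (Form S Γ)} {τ σ : Ty} {t : Tm Γ (.list τ)} {u : Tm Γ σ}
      {v : Tm Γ (.arr τ (.arr (.list τ) σ))} {φ : Form S (σ :: Γ)}
      (wf : WfUHOL Ψ (.caseList t u v) φ) :
      UHOL 𝒯 (.eq t .nil :: Ψ) u φ →
      UHOL 𝒯 Ψ v (.all τ (.all (.list τ)
        (.imp (.eq (t.rename wk3) (.cons v1 v0)) (φ.at1 wk3 (.app (.app v2 v1) v0))))) →
      UHOL 𝒯 Ψ (.caseList t u v) φ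
  | letrec {Γ : Ctx} {Ψ : List (Form S Γ)} {α σ : Ty} {h : Ind α}
      {e : Tm (.arr α σ :: α :: Γ) σ} {φ' : Form S (α :: Γ)} {φ : Form S (σ :: α :: Γ)}
      (wf : WfUHOL Ψ (.letrec h e) (φ'.arrow φ)) (hd : WDef e) :
      UHOL 𝒯
        (.all α (.imp (.sizeLt h v0 v2)
            (.imp (φ'.rename wk2.lift) (φ.at1 wk2.lift (.app v1 v0)))) ::
          φ'.rename wk1 :: hyps wk2 Ψ) e (φ.rename wk1.lift) →
      UHOL 𝒯 Ψ (.letrec h e) (φ'.arrow φ)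

/-! ## Relational higher-order logic

The assertion of a judgment `Γ ∣ Ψ ⊢ t₁ : σ₁ ∼ t₂ : σ₂ ∣ φ` lives in `Γ, r₁ : σ₁, r₂ : σ₂`. -/

/-- `∀x₁ x₂. φ' ⇒ φ[r₁ x₁/r₁][r₂ x₂/r₂]`. -/
def Form.arrow2 {S : Signature.{u}} {Γ : Ctx} {τ₁ τ₂ σ₁ σ₂ : Ty} (φ' : Form S (τ₂ :: τ₁ :: Γ))
    (φ : Form S (σ₂ :: σ₁ :: τ₂ :: τ₁ :: Γ)) : Form S (.arr τ₂ σ₂ :: .arr τ₁ σ₁ :: Γ) :=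
  .all τ₁ (.all τ₂ (.imp (φ'.rename wk2.lift.lift)
    (φ.at2 wk2.lift.lift (.app v3 v1) (.app v2 v0))))

/-- `∀x₁. φ' ⇒ φ[r₁ x₁/r₁]`. -/
def Form.arrowL {S : Signature.{u}} {Γ : Ctx} {τ₁ σ₁ σ₂ : Ty} (φ' : Form S (τ₁ :: Γ))
    (φ : Form S (σ₂ :: σ₁ :: τ₁ :: Γ)) : Form S (σ₂ :: .arr τ₁ σ₁ :: Γ) :=
  .all τ₁ (.imp (φ'.rename wk2.lift) (φ.at2 wk2.lift (.app v2 v0) v1))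

/-- `∀x₂. φ' ⇒ φ[r₂ x₂/r₂]`. -/
def Form.arrowR {S : Signature.{u}} {Γ : Ctx} {τ₂ σ₁ σ₂ : Ty} (φ' : Form S (τ₂ :: Γ))
    (φ : Form S (σ₂ :: σ₁ :: τ₂ :: Γ)) : Form S (.arr τ₂ σ₂ :: σ₁ :: Γ) :=
  .all τ₂ (.imp (φ'.rename wk2.lift) (φ.at2 wk2.lift v2 (.app v1 v0)))

/-- Well-formedness of a judgment `Γ ∣ Ψ ⊢ t₁ : σ₁ ∼ t₂ : σ₂ ∣ φ`. -/
def WfRHOL {S : Signature.{u}} {Γ : Ctx} {σ₁ σ₂ : Ty} (Ψ : List (Form S Γ)) (t₁ : Tm Γ σ₁)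
    (t₂ : Tm Γ σ₂) (φ : Form S (σ₂ :: σ₁ :: Γ)) : Prop :=
  (∀ ψ ∈ Ψ, ψ.Ok) ∧ t₁.Ok ∧ t₂.Ok ∧ φ.Ok

/-- Derivability of `Γ ∣ Ψ ⊢ t₁ : σ₁ ∼ t₂ : σ₂ ∣ φ`. -/
inductive RHOL {S : Signature.{u}} (𝒯 : Theory S) :
    {Γ : Ctx} → List (Form S Γ) → {σ₁ σ₂ : Ty} → Tm Γ σ₁ → Tm Γ σ₂ →
      Form S (σ₂ :: σ₁ :: Γ) → Prop where
  /- two-sided rules -/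
  | abs {Γ : Ctx} {Ψ : List (Form S Γ)}
      {τ₁ τ₂ σ₁ σ₂ : Ty} {t₁ : Tm (τ₁ :: Γ) σ₁} {t₂ : Tm (τ₂ :: Γ) σ₂}
      {φ' : Form S (τ₂ :: τ₁ :: Γ)} {φ : Form S (σ₂ :: σ₁ :: τ₂ :: τ₁ :: Γ)}
      (wf : WfRHOL Ψ (.lam t₁) (.lam t₂) (φ'.arrow2 φ)) :
      RHOL 𝒯 (φ' :: hyps wk2 Ψ) (t₁.rename wk1) (t₂.rename wk1.lift) φ →
      RHOL 𝒯 Ψ (.lam t₁) (.lam t₂) (φ'.arrow2 φ)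
  | app {Γ : Ctx} {Ψ : List (Form S Γ)}
      {τ₁ τ₂ σ₁ σ₂ : Ty} {t₁ : Tm Γ (.arr τ₁ σ₁)} {t₂ : Tm Γ (.arr τ₂ σ₂)} {u₁ : Tm Γ τ₁}
      {u₂ : Tm Γ τ₂} {φ' : Form S (τ₂ :: τ₁ :: Γ)} {φ : Form S (σ₂ :: σ₁ :: τ₂ :: τ₁ :: Γ)}
      (wf : WfRHOL Ψ (.app t₁ u₁) (.app t₂ u₂) (φ.subst (Subst.two u₁ u₂).lift.lift)) :
      RHOL 𝒯 Ψ t₁ t₂ (φ'.arrow2 φ) →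
      RHOL 𝒯 Ψ u₁ u₂ φ' →
      RHOL 𝒯 Ψ (.app t₁ u₁) (.app t₂ u₂) (φ.subst (Subst.two u₁ u₂).lift.lift)
  | var {Γ : Ctx} {Ψ : List (Form S Γ)}
      {σ₁ σ₂ : Ty} {x₁ : Var Γ σ₁} {x₂ : Var Γ σ₂} {φ : Form S (σ₂ :: σ₁ :: Γ)}
      (wf : WfRHOL Ψ (.var x₁) (.var x₂) φ) :
      HOL 𝒯 Ψ (φ.at2 wk0 (.var x₁) (.var x₂)) →
      RHOL 𝒯 Ψ (.var x₁) (.var x₂) φ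
  | tt {Γ : Ctx} {Ψ : List (Form S Γ)}
      {φ : Form S (.bool :: .bool :: Γ)}
      (wf : WfRHOL Ψ .tt .tt φ) :
      HOL 𝒯 Ψ (φ.at2 wk0 .tt .tt) →
      RHOL 𝒯 Ψ .tt .tt φ
  | ff {Γ : Ctx} {Ψ : List (Form S Γ)}
      {φ : Form S (.bool :: .bool :: Γ)}
      (wf : WfRHOL Ψ .ff .ff φ) :
      HOL 𝒯 Ψ (φ.at2 wk0 .ff .ff) →
      RHOL 𝒯 Ψ .ff .ff φ
  | zero {Γ : Ctx} {Ψ : List (Form S Γ)}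
      {φ : Form S (.nat :: .nat :: Γ)}
      (wf : WfRHOL Ψ .zero .zero φ) :
      HOL 𝒯 Ψ (φ.at2 wk0 .zero .zero) →
      RHOL 𝒯 Ψ .zero .zero φ
  | succ {Γ : Ctx} {Ψ : List (Form S Γ)}
      {t₁ t₂ : Tm Γ .nat} {φ' φ : Form S (.nat :: .nat :: Γ)}
      (wf : WfRHOL Ψ (.succ t₁) (.succ t₂) φ) :
      RHOL 𝒯 Ψ t₁ t₂ φ' →
      HOL 𝒯 Ψ (.all .nat (.all .nat (.imp φ' (φ.at2 wk2 (.succ v1) (.succ v0))))) →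
      RHOL 𝒯 Ψ (.succ t₁) (.succ t₂) φ
  | nil {Γ : Ctx} {Ψ : List (Form S Γ)}
      {σ₁ σ₂ : Ty} {φ : Form S (.list σ₂ :: .list σ₁ :: Γ)}
      (wf : WfRHOL Ψ .nil .nil φ) :
      HOL 𝒯 Ψ (φ.at2 wk0 .nil .nil) →
      RHOL 𝒯 Ψ .nil .nil φ
  | cons {Γ : Ctx} {Ψ : List (Form S Γ)}
      {σ₁ σ₂ : Ty} {h₁ : Tm Γ σ₁} {h₂ : Tm Γ σ₂} {t₁ : Tm Γ (.list σ₁)} {t₂ : Tm Γ (.list σ₂)}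
      {φ' : Form S (σ₂ :: σ₁ :: Γ)} {φ'' φ : Form S (.list σ₂ :: .list σ₁ :: Γ)}
      (wf : WfRHOL Ψ (.cons h₁ t₁) (.cons h₂ t₂) φ) :
      RHOL 𝒯 Ψ h₁ h₂ φ' →
      RHOL 𝒯 Ψ t₁ t₂ φ'' →
      HOL 𝒯 Ψ (.all σ₁ (.all σ₂ (.all (.list σ₁) (.all (.list σ₂)
        (.imp (φ'.at2 wk4 v3 v2) (.imp (φ''.at2 wk4 v1 v0)
          (φ.at2 wk4 (.cons v3 v1) (.cons v2 v0)))))))) →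
      RHOL 𝒯 Ψ (.cons h₁ t₁) (.cons h₂ t₂) φ
  | pair {Γ : Ctx} {Ψ : List (Form S Γ)}
      {σ₁ σ₂ τ₁ τ₂ : Ty} {t₁ : Tm Γ σ₁} {t₂ : Tm Γ σ₂} {u₁ : Tm Γ τ₁} {u₂ : Tm Γ τ₂}
      {φ' : Form S (σ₂ :: σ₁ :: Γ)} {φ'' : Form S (τ₂ :: τ₁ :: Γ)}
      {φ : Form S (.prod σ₂ τ₂ :: .prod σ₁ τ₁ :: Γ)}
      (wf : WfRHOL Ψ (.pair t₁ u₁) (.pair t₂ u₂) φ) :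
      RHOL 𝒯 Ψ t₁ t₂ φ' →
      RHOL 𝒯 Ψ u₁ u₂ φ'' →
      HOL 𝒯 Ψ (.all σ₁ (.all σ₂ (.all τ₁ (.all τ₂
        (.imp (φ'.at2 wk4 v3 v2) (.imp (φ''.at2 wk4 v1 v0)
          (φ.at2 wk4 (.pair v3 v1) (.pair v2 v0)))))))) →
      RHOL 𝒯 Ψ (.pair t₁ u₁) (.pair t₂ u₂) φ
  | fst {Γ : Ctx} {Ψ : List (Form S Γ)}
      {σ₁ σ₂ τ₁ τ₂ : Ty} {t₁ : Tm Γ (.prod σ₁ τ₁)} {t₂ : Tm Γ (.prod σ₂ τ₂)} 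
      {φ : Form S (σ₂ :: σ₁ :: Γ)}
      (wf : WfRHOL Ψ (.fst t₁) (.fst t₂) φ) :
      RHOL 𝒯 Ψ t₁ t₂ (φ.at2 wk2 (.fst v1) (.fst v0)) →
      RHOL 𝒯 Ψ (.fst t₁) (.fst t₂) φ
  | snd {Γ : Ctx} {Ψ : List (Form S Γ)}
      {σ₁ σ₂ τ₁ τ₂ : Ty} {t₁ : Tm Γ (.prod τ₁ σ₁)} {t₂ : Tm Γ (.prod τ₂ σ₂)} 
      {φ : Form S (σ₂ :: σ₁ :: Γ)}
      (wf : WfRHOL Ψ (.snd t₁) (.snd t₂) φ) :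
      RHOL 𝒯 Ψ t₁ t₂ (φ.at2 wk2 (.snd v1) (.snd v0)) →
      RHOL 𝒯 Ψ (.snd t₁) (.snd t₂) φ
  | boolCase {Γ : Ctx} {Ψ : List (Form S Γ)}
      {σ₁ σ₂ : Ty} {t₁ t₂ : Tm Γ .bool} {u₁ v₁ : Tm Γ σ₁} {u₂ v₂ : Tm Γ σ₂}
      {φ : Form S (σ₂ :: σ₁ :: Γ)}
      (wf : WfRHOL Ψ (.caseBool t₁ u₁ v₁) (.caseBool t₂ u₂ v₂) φ) :
      RHOL 𝒯 Ψ t₁ t₂ (.or (.and (.eq v1 .tt) (.eq v0 .tt)) (.and (.eq v1 .ff) (.eq v0 .ff))) →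
      RHOL 𝒯 (.eq t₂ .tt :: .eq t₁ .tt :: Ψ) u₁ u₂ φ →
      RHOL 𝒯 (.eq t₂ .ff :: .eq t₁ .ff :: Ψ) v₁ v₂ φ →
      RHOL 𝒯 Ψ (.caseBool t₁ u₁ v₁) (.caseBool t₂ u₂ v₂) φ
  | natCase {Γ : Ctx} {Ψ : List (Form S Γ)}
      {σ₁ σ₂ : Ty} {t₁ t₂ : Tm Γ .nat} {u₁ : Tm Γ σ₁} {u₂ : Tm Γ σ₂}
      {v₁ : Tm Γ (.arr .nat σ₁)} {v₂ : Tm Γ (.arr .nat σ₂)} {φ : Form S (σ₂ :: σ₁ :: Γ)}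
      (wf : WfRHOL Ψ (.caseNat t₁ u₁ v₁) (.caseNat t₂ u₂ v₂) φ) :
      RHOL 𝒯 Ψ t₁ t₂ (.iff (.eq v1 .zero) (.eq v0 .zero)) →
      RHOL 𝒯 (.eq t₂ .zero :: .eq t₁ .zero :: Ψ) u₁ u₂ φ →
      RHOL 𝒯 Ψ v₁ v₂ (.all .nat (.all .nat
        (.imp (.eq (t₁.rename wk4) (.succ v1)) (.imp (.eq (t₂.rename wk4) (.succ v0))
          (φ.at2 wk4 (.app v3 v1) (.app v2 v0)))))) →
      RHOL 𝒯 Ψ (.caseNat t₁ u₁ v₁) (.caseNat t₂ u₂ v₂) φ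
  | listCase {Γ : Ctx} {Ψ : List (Form S Γ)}
      {τ₁ τ₂ σ₁ σ₂ : Ty} {t₁ : Tm Γ (.list τ₁)} {t₂ : Tm Γ (.list τ₂)} {u₁ : Tm Γ σ₁} {u₂ : Tm Γ σ₂}
      {v₁ : Tm Γ (.arr τ₁ (.arr (.list τ₁) σ₁))} {v₂ : Tm Γ (.arr τ₂ (.arr (.list τ₂) σ₂))}
      {φ : Form S (σ₂ :: σ₁ :: Γ)}
      (wf : WfRHOL Ψ (.caseList t₁ u₁ v₁) (.caseList t₂ u₂ v₂) φ) :
      RHOL 𝒯 Ψ t₁ t₂ (.iff (.eq v1 .nil) (.eq v0 .nil)) →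
      RHOL 𝒯 (.eq t₂ .nil :: .eq t₁ .nil :: Ψ) u₁ u₂ φ →
      RHOL 𝒯 Ψ v₁ v₂ (.all τ₁ (.all τ₂ (.all (.list τ₁) (.all (.list τ₂)
        (.imp (.eq (t₁.rename wk6) (.cons v3 v1)) (.imp (.eq (t₂.rename wk6) (.cons v2 v0))
          (φ.at2 wk6 (.app (.app v5 v3) v1) (.app (.app v4 v2) v0)))))))) →
      RHOL 𝒯 Ψ (.caseList t₁ u₁ v₁) (.caseList t₂ u₂ v₂) φ
  | natCaseStar {Γ : Ctx} {Ψ : List (Form S Γ)}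
      {σ₁ σ₂ : Ty} {t₁ t₂ : Tm Γ .nat} {u₁ : Tm Γ σ₁} {u₂ : Tm Γ σ₂}
      {v₁ : Tm Γ (.arr .nat σ₁)} {v₂ : Tm Γ (.arr .nat σ₂)} {φ' : Form S (.nat :: .nat :: Γ)}
      {φ : Form S (σ₂ :: σ₁ :: Γ)}
      (wf : WfRHOL Ψ (.caseNat t₁ u₁ v₁) (.caseNat t₂ u₂ v₂) φ) :
      RHOL 𝒯 Ψ t₁ t₂ (.and φ' (.iff (.eq v1 .zero) (.eq v0 .zero))) →
      RHOL 𝒯 (φ'.at2 wk0 .zero .zero :: Ψ) u₁ u₂ φ →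
      RHOL 𝒯 Ψ v₁ v₂ (.all .nat (.all .nat
        (.imp (φ'.at2 wk4 (.succ v1) (.succ v0)) (φ.at2 wk4 (.app v3 v1) (.app v2 v0))))) →
      RHOL 𝒯 Ψ (.caseNat t₁ u₁ v₁) (.caseNat t₂ u₂ v₂) φ
  | listCaseStar {Γ : Ctx} {Ψ : List (Form S Γ)}
      {τ₁ τ₂ σ₁ σ₂ : Ty} {t₁ : Tm Γ (.list τ₁)} {t₂ : Tm Γ (.list τ₂)} {u₁ : Tm Γ σ₁} {u₂ : Tm Γ σ₂}
      {v₁ : Tm Γ (.arr τ₁ (.arr (.list τ₁) σ₁))} {v₂ : Tm Γ (.arr τ₂ (.arr (.list τ₂) σ₂))}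
      {φ' : Form S (.list τ₂ :: .list τ₁ :: Γ)} {φ : Form S (σ₂ :: σ₁ :: Γ)}
      (wf : WfRHOL Ψ (.caseList t₁ u₁ v₁) (.caseList t₂ u₂ v₂) φ) :
      RHOL 𝒯 Ψ t₁ t₂ (.and φ' (.iff (.eq v1 .nil) (.eq v0 .nil))) →
      RHOL 𝒯 (φ'.at2 wk0 .nil .nil :: Ψ) u₁ u₂ φ →
      RHOL 𝒯 Ψ v₁ v₂ (.all τ₁ (.all τ₂ (.all (.list τ₁) (.all (.list τ₂)
        (.imp (φ'.at2 wk6 (.cons v3 v1) (.cons v2 v0))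
          (φ.at2 wk6 (.app (.app v5 v3) v1) (.app (.app v4 v2) v0))))))) →
      RHOL 𝒯 Ψ (.caseList t₁ u₁ v₁) (.caseList t₂ u₂ v₂) φ
  | letrec {Γ : Ctx} {Ψ : List (Form S Γ)}
      {α₁ α₂ σ₁ σ₂ : Ty} {h₁ : Ind α₁} {h₂ : Ind α₂}
      {e₁ : Tm (.arr α₁ σ₁ :: α₁ :: Γ) σ₁} {e₂ : Tm (.arr α₂ σ₂ :: α₂ :: Γ) σ₂}
      {φ' : Form S (α₂ :: α₁ :: Γ)} {φ : Form S (σ₂ :: σ₁ :: α₂ :: α₁ :: Γ)}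
      (wf : WfRHOL Ψ (.letrec h₁ e₁) (.letrec h₂ e₂) (φ'.arrow2 φ)) (hd₁ : WDef e₁) (hd₂ : WDef e₂) :
      /- in the context `Γ, x₁, x₂, f₁, f₂` -/
      RHOL 𝒯 (.all α₁ (.all α₂ (.imp (.sizeLt2 h₁ h₂ v1 v0 v5 v4)
            (.imp (φ'.rename wk4.lift.lift) (φ.at2 wk4.lift.lift (.app v3 v1) (.app v2 v0))))) ::
          φ'.rename wk2 :: hyps wk4 Ψ)
        (e₁.rename recL)
        (e₂.rename recR) (φ.rename wk2.lift.lift) →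
      RHOL 𝒯 Ψ (.letrec h₁ e₁) (.letrec h₂ e₂) (φ'.arrow2 φ)
  /- structural rules -/
  | sub {Γ : Ctx} {Ψ : List (Form S Γ)}
      {σ₁ σ₂ : Ty} {t₁ : Tm Γ σ₁} {t₂ : Tm Γ σ₂} {φ' φ : Form S (σ₂ :: σ₁ :: Γ)}
      (wf : WfRHOL Ψ t₁ t₂ φ) :
      RHOL 𝒯 Ψ t₁ t₂ φ' →
      HOL 𝒯 Ψ (.imp (φ'.at2 wk0 t₁ t₂) (φ.at2 wk0 t₁ t₂)) →
      RHOL 𝒯 Ψ t₁ t₂ φ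
  | andI {Γ : Ctx} {Ψ : List (Form S Γ)}
      {σ₁ σ₂ : Ty} {t₁ : Tm Γ σ₁} {t₂ : Tm Γ σ₂} {φ φ' : Form S (σ₂ :: σ₁ :: Γ)}
      (wf : WfRHOL Ψ t₁ t₂ (.and φ φ')) :
      RHOL 𝒯 Ψ t₁ t₂ φ →
      RHOL 𝒯 Ψ t₁ t₂ φ' →
      RHOL 𝒯 Ψ t₁ t₂ (.and φ φ')
  | impI {Γ : Ctx} {Ψ : List (Form S Γ)}
      {σ₁ σ₂ : Ty} {t₁ : Tm Γ σ₁} {t₂ : Tm Γ σ₂} {φ' φ : Form S (σ₂ :: σ₁ :: Γ)}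
      (wf : WfRHOL Ψ t₁ t₂ (.imp φ' φ)) :
      RHOL 𝒯 (φ'.at2 wk0 t₁ t₂ :: Ψ) t₁ t₂ φ →
      RHOL 𝒯 Ψ t₁ t₂ (.imp φ' φ)
  | uholL {Γ : Ctx} {Ψ : List (Form S Γ)}
      {σ₁ σ₂ : Ty} {t₁ : Tm Γ σ₁} {t₂ : Tm Γ σ₂} {φ : Form S (σ₂ :: σ₁ :: Γ)}
      (wf : WfRHOL Ψ t₁ t₂ φ) :
      UHOL 𝒯 Ψ t₁ (φ.at2 wk1 v0 (t₂.rename wk1)) →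
      RHOL 𝒯 Ψ t₁ t₂ φ
  | uholR {Γ : Ctx} {Ψ : List (Form S Γ)}
      {σ₁ σ₂ : Ty} {t₁ : Tm Γ σ₁} {t₂ : Tm Γ σ₂} {φ : Form S (σ₂ :: σ₁ :: Γ)}
      (wf : WfRHOL Ψ t₁ t₂ φ) :
      UHOL 𝒯 Ψ t₂ (φ.at2 wk1 (t₁.rename wk1) v0) →
      RHOL 𝒯 Ψ t₁ t₂ φ
  /- one-sided rules, left -/
  | absL {Γ : Ctx} {Ψ : List (Form S Γ)}
      {τ σ₁ σ₂ : Ty} {t₁ : Tm (τ :: Γ) σ₁} {t₂ : Tm Γ σ₂} {φ' : Form S (τ :: Γ)}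
      {φ : Form S (σ₂ :: σ₁ :: τ :: Γ)}
      (wf : WfRHOL Ψ (.lam t₁) t₂ (φ'.arrowL φ)) :
      RHOL 𝒯 (φ' :: hyps wk1 Ψ) t₁ (t₂.rename wk1) φ →
      RHOL 𝒯 Ψ (.lam t₁) t₂ (φ'.arrowL φ)
  | appL {Γ : Ctx} {Ψ : List (Form S Γ)}
      {τ σ₁ σ₂ : Ty} {t₁ : Tm Γ (.arr τ σ₁)} {u₁ : Tm Γ τ} {t₂ : Tm Γ σ₂}
      {φ' : Form S (τ :: Γ)} {φ : Form S (σ₂ :: σ₁ :: τ :: Γ)}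
      (wf : WfRHOL Ψ (.app t₁ u₁) t₂ (φ.subst (Subst.one u₁).lift.lift)) :
      RHOL 𝒯 Ψ t₁ t₂ (φ'.arrowL φ) →
      UHOL 𝒯 Ψ u₁ φ' →
      RHOL 𝒯 Ψ (.app t₁ u₁) t₂ (φ.subst (Subst.one u₁).lift.lift)
  | varL {Γ : Ctx} {Ψ : List (Form S Γ)}
      {σ₁ σ₂ : Ty} {x₁ : Var Γ σ₁} {t₂ : Tm Γ σ₂} {φ : Form S (σ₁ :: Γ)}
      (wf : WfRHOL Ψ (.var x₁) t₂ (φ.rename wk1)) :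
      φ.at1 wk0 (.var x₁) ∈ Ψ →
      RHOL 𝒯 Ψ (.var x₁) t₂ (φ.rename wk1)
  | ttL {Γ : Ctx} {Ψ : List (Form S Γ)}
      {σ₂ : Ty} {t₂ : Tm Γ σ₂} {φ : Form S (σ₂ :: .bool :: Γ)}
      (wf : WfRHOL Ψ .tt t₂ φ) :
      HOL 𝒯 Ψ (φ.at2 wk0 .tt t₂) →
      RHOL 𝒯 Ψ .tt t₂ φ
  | ffL {Γ : Ctx} {Ψ : List (Form S Γ)}
      {σ₂ : Ty} {t₂ : Tm Γ σ₂} {φ : Form S (σ₂ :: .bool :: Γ)}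
      (wf : WfRHOL Ψ .ff t₂ φ) :
      HOL 𝒯 Ψ (φ.at2 wk0 .ff t₂) →
      RHOL 𝒯 Ψ .ff t₂ φ
  | zeroL {Γ : Ctx} {Ψ : List (Form S Γ)}
      {σ₂ : Ty} {t₂ : Tm Γ σ₂} {φ : Form S (σ₂ :: .nat :: Γ)}
      (wf : WfRHOL Ψ .zero t₂ φ) :
      HOL 𝒯 Ψ (φ.at2 wk0 .zero t₂) →
      RHOL 𝒯 Ψ .zero t₂ φ
  | succL {Γ : Ctx} {Ψ : List (Form S Γ)}
      {σ₂ : Ty} {t₁ : Tm Γ .nat} {t₂ : Tm Γ σ₂} {φ' φ : Form S (σ₂ :: .nat :: Γ)}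
      (wf : WfRHOL Ψ (.succ t₁) t₂ φ) :
      RHOL 𝒯 Ψ t₁ t₂ φ' →
      HOL 𝒯 Ψ (.all .nat (.all σ₂ (.imp φ' (φ.at2 wk2 (.succ v1) v0)))) →
      RHOL 𝒯 Ψ (.succ t₁) t₂ φ
  | nilL {Γ : Ctx} {Ψ : List (Form S Γ)}
      {σ₁ σ₂ : Ty} {t₂ : Tm Γ σ₂} {φ : Form S (σ₂ :: .list σ₁ :: Γ)}
      (wf : WfRHOL Ψ .nil t₂ φ) :
      HOL 𝒯 Ψ (φ.at2 wk0 .nil t₂) →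
      RHOL 𝒯 Ψ .nil t₂ φ
  | consL {Γ : Ctx} {Ψ : List (Form S Γ)}
      {σ₁ σ₂ : Ty} {h₁ : Tm Γ σ₁} {t₁ : Tm Γ (.list σ₁)} {t₂ : Tm Γ σ₂}
      {φ' : Form S (σ₂ :: σ₁ :: Γ)} {φ'' φ : Form S (σ₂ :: .list σ₁ :: Γ)}
      (wf : WfRHOL Ψ (.cons h₁ t₁) t₂ φ) :
      RHOL 𝒯 Ψ h₁ t₂ φ' →
      RHOL 𝒯 Ψ t₁ t₂ φ'' →
      HOL 𝒯 Ψ (.all σ₁ (.all σ₂ (.all (.list σ₁)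
        (.imp (φ'.at2 wk3 v2 v1) (.imp (φ''.at2 wk3 v0 v1) (φ.at2 wk3 (.cons v2 v0) v1)))))) →
      RHOL 𝒯 Ψ (.cons h₁ t₁) t₂ φ
  | pairL {Γ : Ctx} {Ψ : List (Form S Γ)}
      {σ₁ σ₂ τ : Ty} {t₁ : Tm Γ σ₁} {u₁ : Tm Γ τ} {t₂ : Tm Γ σ₂} {φ' : Form S (σ₂ :: σ₁ :: Γ)}
      {φ'' : Form S (σ₂ :: τ :: Γ)} {φ : Form S (σ₂ :: .prod σ₁ τ :: Γ)}
      (wf : WfRHOL Ψ (.pair t₁ u₁) t₂ φ) :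
      RHOL 𝒯 Ψ t₁ t₂ φ' →
      RHOL 𝒯 Ψ u₁ t₂ φ'' →
      HOL 𝒯 Ψ (.all σ₁ (.all σ₂ (.all τ
        (.imp (φ'.at2 wk3 v2 v1) (.imp (φ''.at2 wk3 v0 v1) (φ.at2 wk3 (.pair v2 v0) v1)))))) →
      RHOL 𝒯 Ψ (.pair t₁ u₁) t₂ φ
  | fstL {Γ : Ctx} {Ψ : List (Form S Γ)}
      {σ₁ σ₂ τ : Ty} {t₁ : Tm Γ (.prod σ₁ τ)} {t₂ : Tm Γ σ₂} {φ : Form S (σ₂ :: σ₁ :: Γ)}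
      (wf : WfRHOL Ψ (.fst t₁) t₂ φ) :
      RHOL 𝒯 Ψ t₁ t₂ (φ.at2 wk2 (.fst v1) v0) →
      RHOL 𝒯 Ψ (.fst t₁) t₂ φ
  | sndL {Γ : Ctx} {Ψ : List (Form S Γ)}
      {σ₁ σ₂ τ : Ty} {t₁ : Tm Γ (.prod τ σ₁)} {t₂ : Tm Γ σ₂} {φ : Form S (σ₂ :: σ₁ :: Γ)}
      (wf : WfRHOL Ψ (.snd t₁) t₂ φ) :
      RHOL 𝒯 Ψ t₁ t₂ (φ.at2 wk2 (.snd v1) v0) →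
      RHOL 𝒯 Ψ (.snd t₁) t₂ φ
  | boolCaseL {Γ : Ctx} {Ψ : List (Form S Γ)}
      {σ₁ σ₂ : Ty} {t₁ : Tm Γ .bool} {u₁ v₁ : Tm Γ σ₁} {t₂ : Tm Γ σ₂} {φ : Form S (σ₂ :: σ₁ :: Γ)}
      (wf : WfRHOL Ψ (.caseBool t₁ u₁ v₁) t₂ φ) :
      RHOL 𝒯 (.eq t₁ .tt :: Ψ) u₁ t₂ φ →
      RHOL 𝒯 (.eq t₁ .ff :: Ψ) v₁ t₂ φ →
      RHOL 𝒯 Ψ (.caseBool t₁ u₁ v₁) t₂ φ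
  | natCaseL {Γ : Ctx} {Ψ : List (Form S Γ)}
      {σ₁ σ₂ : Ty} {t₁ : Tm Γ .nat} {u₁ : Tm Γ σ₁} {v₁ : Tm Γ (.arr .nat σ₁)}
      {t₂ : Tm Γ σ₂} {φ : Form S (σ₂ :: σ₁ :: Γ)}
      (wf : WfRHOL Ψ (.caseNat t₁ u₁ v₁) t₂ φ) :
      RHOL 𝒯 (.eq t₁ .zero :: Ψ) u₁ t₂ φ →
      RHOL 𝒯 Ψ v₁ t₂ (.all .nat
        (.imp (.eq (t₁.rename wk3) (.succ v0)) (φ.at2 wk3 (.app v2 v0) v1))) →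
      RHOL 𝒯 Ψ (.caseNat t₁ u₁ v₁) t₂ φ
  | listCaseL {Γ : Ctx} {Ψ : List (Form S Γ)}
      {τ σ₁ σ₂ : Ty} {t₁ : Tm Γ (.list τ)} {u₁ : Tm Γ σ₁}
      {v₁ : Tm Γ (.arr τ (.arr (.list τ) σ₁))} {t₂ : Tm Γ σ₂} {φ : Form S (σ₂ :: σ₁ :: Γ)}
      (wf : WfRHOL Ψ (.caseList t₁ u₁ v₁) t₂ φ) :
      RHOL 𝒯 (.eq t₁ .nil :: Ψ) u₁ t₂ φ →
      RHOL 𝒯 Ψ v₁ t₂ (.all τ (.all (.list τ)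
        (.imp (.eq (t₁.rename wk4) (.cons v1 v0)) (φ.at2 wk4 (.app (.app v3 v1) v0) v2)))) →
      RHOL 𝒯 Ψ (.caseList t₁ u₁ v₁) t₂ φ
  | letrecL {Γ : Ctx} {Ψ : List (Form S Γ)}
      {α σ₁ σ₂ : Ty} {h : Ind α} {e₁ : Tm (.arr α σ₁ :: α :: Γ) σ₁} {t₂ : Tm Γ σ₂}
      {φ' : Form S (α :: Γ)} {φ : Form S (σ₂ :: σ₁ :: α :: Γ)}
      (wf : WfRHOL Ψ (.letrec h e₁) t₂ (φ'.arrowL φ)) (hd : WDef e₁) :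
      /- in the context `Γ, x, f` -/
      RHOL 𝒯 (.all α (.imp (.sizeLt h v0 v2)
            (.imp (φ'.rename wk2.lift) (φ.at2 wk2.lift (.app v1 v0) (t₂.rename wk3)))) ::
          φ'.rename wk1 :: hyps wk2 Ψ)
        e₁ (t₂.rename wk2) (φ.rename wk1.lift.lift) →
      RHOL 𝒯 Ψ (.letrec h e₁) t₂ (φ'.arrowL φ)
  /- one-sided rules, right -/
  | absR {Γ : Ctx} {Ψ : List (Form S Γ)}
      {τ σ₁ σ₂ : Ty} {t₂ : Tm (τ :: Γ) σ₂} {t₁ : Tm Γ σ₁} {φ' : Form S (τ :: Γ)}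
      {φ : Form S (σ₂ :: σ₁ :: τ :: Γ)}
      (wf : WfRHOL Ψ t₁ (.lam t₂) (φ'.arrowR φ)) :
      RHOL 𝒯 (φ' :: hyps wk1 Ψ) (t₁.rename wk1) t₂ φ →
      RHOL 𝒯 Ψ t₁ (.lam t₂) (φ'.arrowR φ)
  | appR {Γ : Ctx} {Ψ : List (Form S Γ)}
      {τ σ₁ σ₂ : Ty} {t₂ : Tm Γ (.arr τ σ₂)} {u₂ : Tm Γ τ} {t₁ : Tm Γ σ₁}
      {φ' : Form S (τ :: Γ)} {φ : Form S (σ₂ :: σ₁ :: τ :: Γ)}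
      (wf : WfRHOL Ψ t₁ (.app t₂ u₂) (φ.subst (Subst.one u₂).lift.lift)) :
      RHOL 𝒯 Ψ t₁ t₂ (φ'.arrowR φ) →
      UHOL 𝒯 Ψ u₂ φ' →
      RHOL 𝒯 Ψ t₁ (.app t₂ u₂) (φ.subst (Subst.one u₂).lift.lift)
  | varR {Γ : Ctx} {Ψ : List (Form S Γ)}
      {σ₁ σ₂ : Ty} {x₂ : Var Γ σ₂} {t₁ : Tm Γ σ₁} {φ : Form S (σ₂ :: Γ)}
      (wf : WfRHOL Ψ t₁ (.var x₂) (φ.rename wk1.lift)) :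
      φ.at1 wk0 (.var x₂) ∈ Ψ →
      RHOL 𝒯 Ψ t₁ (.var x₂) (φ.rename wk1.lift)
  | ttR {Γ : Ctx} {Ψ : List (Form S Γ)}
      {σ₁ : Ty} {t₁ : Tm Γ σ₁} {φ : Form S (.bool :: σ₁ :: Γ)}
      (wf : WfRHOL Ψ t₁ .tt φ) :
      HOL 𝒯 Ψ (φ.at2 wk0 t₁ .tt) →
      RHOL 𝒯 Ψ t₁ .tt φ
  | ffR {Γ : Ctx} {Ψ : List (Form S Γ)}
      {σ₁ : Ty} {t₁ : Tm Γ σ₁} {φ : Form S (.bool :: σ₁ :: Γ)}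
      (wf : WfRHOL Ψ t₁ .ff φ) :
      HOL 𝒯 Ψ (φ.at2 wk0 t₁ .ff) →
      RHOL 𝒯 Ψ t₁ .ff φ
  | zeroR {Γ : Ctx} {Ψ : List (Form S Γ)}
      {σ₁ : Ty} {t₁ : Tm Γ σ₁} {φ : Form S (.nat :: σ₁ :: Γ)}
      (wf : WfRHOL Ψ t₁ .zero φ) :
      HOL 𝒯 Ψ (φ.at2 wk0 t₁ .zero) →
      RHOL 𝒯 Ψ t₁ .zero φ
  | succR {Γ : Ctx} {Ψ : List (Form S Γ)}
      {σ₁ : Ty} {t₂ : Tm Γ .nat} {t₁ : Tm Γ σ₁} {φ' φ : Form S (.nat :: σ₁ :: Γ)}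
      (wf : WfRHOL Ψ t₁ (.succ t₂) φ) :
      RHOL 𝒯 Ψ t₁ t₂ φ' →
      HOL 𝒯 Ψ (.all σ₁ (.all .nat (.imp φ' (φ.at2 wk2 v1 (.succ v0))))) →
      RHOL 𝒯 Ψ t₁ (.succ t₂) φ
  | nilR {Γ : Ctx} {Ψ : List (Form S Γ)}
      {σ₁ σ₂ : Ty} {t₁ : Tm Γ σ₁} {φ : Form S (.list σ₂ :: σ₁ :: Γ)}
      (wf : WfRHOL Ψ t₁ .nil φ) :
      HOL 𝒯 Ψ (φ.at2 wk0 t₁ .nil) →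
      RHOL 𝒯 Ψ t₁ .nil φ
  | consR {Γ : Ctx} {Ψ : List (Form S Γ)}
      {σ₁ σ₂ : Ty} {h₂ : Tm Γ σ₂} {t₂ : Tm Γ (.list σ₂)} {t₁ : Tm Γ σ₁}
      {φ' : Form S (σ₂ :: σ₁ :: Γ)} {φ'' φ : Form S (.list σ₂ :: σ₁ :: Γ)}
      (wf : WfRHOL Ψ t₁ (.cons h₂ t₂) φ) :
      RHOL 𝒯 Ψ t₁ h₂ φ' →
      RHOL 𝒯 Ψ t₁ t₂ φ'' →
      HOL 𝒯 Ψ (.all σ₁ (.all σ₂ (.all (.list σ₂)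
        (.imp (φ'.at2 wk3 v2 v1) (.imp (φ''.at2 wk3 v2 v0) (φ.at2 wk3 v2 (.cons v1 v0))))))) →
      RHOL 𝒯 Ψ t₁ (.cons h₂ t₂) φ
  | pairR {Γ : Ctx} {Ψ : List (Form S Γ)}
      {σ₁ σ₂ τ : Ty} {t₂ : Tm Γ σ₂} {u₂ : Tm Γ τ} {t₁ : Tm Γ σ₁} {φ' : Form S (σ₂ :: σ₁ :: Γ)}
      {φ'' : Form S (τ :: σ₁ :: Γ)} {φ : Form S (.prod σ₂ τ :: σ₁ :: Γ)}
      (wf : WfRHOL Ψ t₁ (.pair t₂ u₂) φ) :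
      RHOL 𝒯 Ψ t₁ t₂ φ' →
      RHOL 𝒯 Ψ t₁ u₂ φ'' →
      HOL 𝒯 Ψ (.all σ₁ (.all σ₂ (.all τ
        (.imp (φ'.at2 wk3 v2 v1) (.imp (φ''.at2 wk3 v2 v0) (φ.at2 wk3 v2 (.pair v1 v0))))))) →
      RHOL 𝒯 Ψ t₁ (.pair t₂ u₂) φ
  | fstR {Γ : Ctx} {Ψ : List (Form S Γ)}
      {σ₁ σ₂ τ : Ty} {t₂ : Tm Γ (.prod σ₂ τ)} {t₁ : Tm Γ σ₁} {φ : Form S (σ₂ :: σ₁ :: Γ)}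
      (wf : WfRHOL Ψ t₁ (.fst t₂) φ) :
      RHOL 𝒯 Ψ t₁ t₂ (φ.at2 wk2 v1 (.fst v0)) →
      RHOL 𝒯 Ψ t₁ (.fst t₂) φ
  | sndR {Γ : Ctx} {Ψ : List (Form S Γ)}
      {σ₁ σ₂ τ : Ty} {t₂ : Tm Γ (.prod τ σ₂)} {t₁ : Tm Γ σ₁} {φ : Form S (σ₂ :: σ₁ :: Γ)}
      (wf : WfRHOL Ψ t₁ (.snd t₂) φ) :
      RHOL 𝒯 Ψ t₁ t₂ (φ.at2 wk2 v1 (.snd v0)) →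
      RHOL 𝒯 Ψ t₁ (.snd t₂) φ
  | boolCaseR {Γ : Ctx} {Ψ : List (Form S Γ)}
      {σ₁ σ₂ : Ty} {t₂ : Tm Γ .bool} {u₂ v₂ : Tm Γ σ₂} {t₁ : Tm Γ σ₁} {φ : Form S (σ₂ :: σ₁ :: Γ)}
      (wf : WfRHOL Ψ t₁ (.caseBool t₂ u₂ v₂) φ) :
      RHOL 𝒯 (.eq t₂ .tt :: Ψ) t₁ u₂ φ →
      RHOL 𝒯 (.eq t₂ .ff :: Ψ) t₁ v₂ φ →
      RHOL 𝒯 Ψ t₁ (.caseBool t₂ u₂ v₂) φ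
  | natCaseR {Γ : Ctx} {Ψ : List (Form S Γ)}
      {σ₁ σ₂ : Ty} {t₂ : Tm Γ .nat} {u₂ : Tm Γ σ₂} {v₂ : Tm Γ (.arr .nat σ₂)}
      {t₁ : Tm Γ σ₁} {φ : Form S (σ₂ :: σ₁ :: Γ)}
      (wf : WfRHOL Ψ t₁ (.caseNat t₂ u₂ v₂) φ) :
      RHOL 𝒯 (.eq t₂ .zero :: Ψ) t₁ u₂ φ →
      RHOL 𝒯 Ψ t₁ v₂ (.all .nat
        (.imp (.eq (t₂.rename wk3) (.succ v0)) (φ.at2 wk3 v2 (.app v1 v0)))) →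
      RHOL 𝒯 Ψ t₁ (.caseNat t₂ u₂ v₂) φ
  | listCaseR {Γ : Ctx} {Ψ : List (Form S Γ)}
      {τ σ₁ σ₂ : Ty} {t₂ : Tm Γ (.list τ)} {u₂ : Tm Γ σ₂}
      {v₂ : Tm Γ (.arr τ (.arr (.list τ) σ₂))} {t₁ : Tm Γ σ₁} {φ : Form S (σ₂ :: σ₁ :: Γ)}
      (wf : WfRHOL Ψ t₁ (.caseList t₂ u₂ v₂) φ) :
      RHOL 𝒯 (.eq t₂ .nil :: Ψ) t₁ u₂ φ →
      RHOL 𝒯 Ψ t₁ v₂ (.all τ (.all (.list τ)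
        (.imp (.eq (t₂.rename wk4) (.cons v1 v0)) (φ.at2 wk4 v3 (.app (.app v2 v1) v0))))) →
      RHOL 𝒯 Ψ t₁ (.caseList t₂ u₂ v₂) φ
  | letrecR {Γ : Ctx} {Ψ : List (Form S Γ)}
      {α σ₁ σ₂ : Ty} {h : Ind α} {e₂ : Tm (.arr α σ₂ :: α :: Γ) σ₂} {t₁ : Tm Γ σ₁}
      {φ' : Form S (α :: Γ)} {φ : Form S (σ₂ :: σ₁ :: α :: Γ)}
      (wf : WfRHOL Ψ t₁ (.letrec h e₂) (φ'.arrowR φ)) (hd : WDef e₂) :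
      /- in the context `Γ, x, f` -/
      RHOL 𝒯 (.all α (.imp (.sizeLt h v0 v2)
            (.imp (φ'.rename wk2.lift) (φ.at2 wk2.lift (t₁.rename wk3) (.app v1 v0)))) ::
          φ'.rename wk1 :: hyps wk2 Ψ)
        (t₁.rename wk2) e₂ (φ.rename wk1.lift.lift) →
      RHOL 𝒯 Ψ t₁ (.letrec h e₂) (φ'.arrowR φ)

/-! ## Relational refinement types -/

/-- Unary types: simple types over booleans and natural numbers. -/
inductive UTy : Ty → Type where
  | bool : UTy .bool
  | nat : UTy .nat
  | arr {α β : Ty} (τ : UTy α) (σ : UTy β) : UTy (.arr α β)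

/-- Relational refinement types whose assertions live in the context `Δ`, indexed by their
erasure to a simple type. In `pi T U` (`Π(x :: T). U`) the type `U` lives in `Δ, x₁, x₂`, and in
`ref T φ` (`{x :: T ∣ φ}`) the assertion `φ` lives in `Δ, x₁, x₂`. -/
inductive RTy (S : Signature.{u}) : Ctx → Ty → Type u where
  | unary {Δ : Ctx} {α : Ty} (τ : UTy α) : RTy S Δ α
  | list {Δ : Ctx} {α : Ty} (T : RTy S Δ α) : RTy S Δ (.list α)
  | pi {Δ : Ctx} {α β : Ty} (T : RTy S Δ α) (U : RTy S (α :: α :: Δ) β) : RTy S Δ (.arr α β)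
  | ref {Δ : Ctx} {α : Ty} (T : RTy S Δ α) (φ : Form S (α :: α :: Δ)) : RTy S Δ α

def RTy.IsUnary {S : Signature.{u}} {Δ : Ctx} {α : Ty} (T : RTy S Δ α) : Prop :=
  ∃ τ : UTy α, T = .unary τ

def RTy.Ok {S : Signature.{u}} : {Δ : Ctx} → {α : Ty} → RTy S Δ α → Prop
  | _, _, .unary _ => True
  | _, _, .list T => T.Ok
  | _, _, .pi T U => T.Ok ∧ U.Ok
  | _, _, .ref T φ => T.Ok ∧ φ.Ok

def RTy.rename {S : Signature.{u}} :
    {Γ : Ctx} → {α : Ty} → RTy S Γ α → {Δ : Ctx} → Ren Γ Δ → RTy S Δ α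
  | _, _, .unary τ, _, _ => .unary τ
  | _, _, .list T, _, ξ => .list (T.rename ξ)
  | _, _, .pi T U, _, ξ => .pi (T.rename ξ) (U.rename ξ.lift.lift)
  | _, _, .ref T φ, _, ξ => .ref (T.rename ξ) (φ.rename ξ.lift.lift)

def RTy.subst {S : Signature.{u}} :
    {Γ : Ctx} → {α : Ty} → RTy S Γ α → {Δ : Ctx} → Subst Γ Δ → RTy S Δ α
  | _, _, .unary τ, _, _ => .unary τ
  | _, _, .list T, _, σ => .list (T.subst σ)
  | _, _, .pi T U, _, σ => .pi (T.subst σ) (U.subst σ.lift.lift)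
  | _, _, .ref T φ, _, σ => .ref (T.subst σ) (φ.subst σ.lift.lift)

/-- The refinement `⌊τ⌋(x)` of a unary type, in `Γ, x`. -/
def UTy.form {S : Signature.{u}} : {α : Ty} → UTy α → {Γ : Ctx} → Form S (α :: Γ)
  | _, .bool, _ => .top
  | _, .nat, _ => .top
  | _, .arr τ σ, _ => Form.arrow τ.form σ.form

/-- The refinement `⌊T⌋(x₁, x₂)`, in `Δ, x₁, x₂`. -/
def RTy.form {S : Signature.{u}} : {Δ : Ctx} → {α : Ty} → RTy S Δ α → Form S (α :: α :: Δ)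
  | _, _, .unary τ => .and (τ.form.at1 wk2 v1) (τ.form.at1 wk2 v0)
  | _, _, .list (.unary τ) => .and (.listAll v1 τ.form) (.listAll v0 τ.form)
  | _, _, .list T => .listAll2 v1 v0 (T.form.rename wk2.lift.lift)
  | _, _, .pi T U => T.form.arrow2 U.form
  | _, _, .ref T φ => .and T.form φ

/-- The erasure of a relational context whose variables have the erased types `γ`: every variable
`x` is duplicated into `x₁, x₂`. -/
@[reducible] def dbl : Ctx → Ctx
  | [] => []
  | α :: γ => α :: α :: dbl γ

/-- The left copy of every variable. -/
def left : {γ : Ctx} → Ren γ (dbl γ)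
  | _, _, .zero => .succ .zero
  | _, _, .succ x => .succ (.succ (left x))

/-- The right copy of every variable. -/
def right : {γ : Ctx} → Ren γ (dbl γ)
  | _, _, .zero => .zero
  | _, _, .succ x => .succ (.succ (right x))

/-- Relational contexts `x :: T, …`, indexed by the erased types of their variables. -/
inductive RCtx (S : Signature.{u}) : Ctx → Type u where
  | nil : RCtx S []
  | cons {γ : Ctx} {α : Ty} (G : RCtx S γ) (T : RTy S (dbl γ) α) : RCtx S (α :: γ)

def RCtx.Ok {S : Signature.{u}} : {γ : Ctx} → RCtx S γ → Prop
  | _, .nil => True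
  | _, .cons G T => G.Ok ∧ T.Ok

/-- The type declared for a variable. -/
def RCtx.get {S : Signature.{u}} :
    {γ : Ctx} → RCtx S γ → {α : Ty} → Var γ α → RTy S (dbl γ) α
  | _, .cons _ T, _, .zero => T.rename wk2
  | _, .cons G _, _, .succ x => (G.get x).rename wk2

/-- The refinement `⌊G⌋` of a context, a set of assertions in its erasure. -/
def RCtx.form {S : Signature.{u}} : {γ : Ctx} → RCtx S γ → List (Form S (dbl γ))
  | _, .nil => []
  | _, .cons G T => T.form :: hyps wk2 G.form

/-- Subtyping `G ⊢ T ⪯ U`. A logical premise `G ⊢ φ` is derivability of `φ` from `⌊G⌋` in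
higher-order logic, and `G ⊢ T` is well-formedness. -/
inductive RSubtyping {S : Signature.{u}} (𝒯 : Theory S) :
    {γ : Ctx} → RCtx S γ → {α : Ty} → RTy S (dbl γ) α → RTy S (dbl γ) α → Prop where
  | refl {γ : Ctx} {G : RCtx S γ} {α : Ty} {T : RTy S (dbl γ) α} (hG : G.Ok) (hT : T.Ok) :
      RSubtyping 𝒯 G T T
  | trans {γ : Ctx} {G : RCtx S γ} {α : Ty} {T₁ T₂ T₃ : RTy S (dbl γ) α} :
      RSubtyping 𝒯 G T₁ T₂ → RSubtyping 𝒯 G T₂ T₃ → RSubtyping 𝒯 G T₁ T₃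
  | list {γ : Ctx} {G : RCtx S γ} {α : Ty} {T₁ T₂ : RTy S (dbl γ) α}
      (hu : T₁.IsUnary → T₂.IsUnary) :
      RSubtyping 𝒯 G T₁ T₂ → RSubtyping 𝒯 G (.list T₁) (.list T₂)
  | refElim {γ : Ctx} {G : RCtx S γ} {α : Ty} {T : RTy S (dbl γ) α}
      {φ : Form S (α :: α :: dbl γ)} (hG : G.Ok) (hT : (RTy.ref T φ).Ok) :
      RSubtyping 𝒯 G (.ref T φ) T
  | refIntro {γ : Ctx} {G : RCtx S γ} {α : Ty} {T U : RTy S (dbl γ) α}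
      {φ : Form S (α :: α :: dbl γ)} :
      RSubtyping 𝒯 G T U → HOL 𝒯 (G.cons T).form φ → RSubtyping 𝒯 G T (.ref U φ)
  | pi {γ : Ctx} {G : RCtx S γ} {α β : Ty} {T₁ T₂ : RTy S (dbl γ) α}
      {U₁ U₂ : RTy S (α :: α :: dbl γ) β} :
      RSubtyping 𝒯 G T₂ T₁ → RSubtyping 𝒯 (G.cons T₂) U₁ U₂ →
      RSubtyping 𝒯 G (.pi T₁ U₁) (.pi T₂ U₂)

/-- Relational typing `G ⊢ t₁ ∼ t₂ :: T`. The variable `x` of `G` stands for its left copy `x₁`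
in `t₁` and for its right copy `x₂` in `t₂`. -/
inductive RTyping {S : Signature.{u}} (𝒯 : Theory S) :
    {γ : Ctx} → RCtx S γ → {α : Ty} → Tm γ α → Tm γ α → RTy S (dbl γ) α → Prop where
  | var {γ : Ctx} {G : RCtx S γ} {α : Ty} (x : Var γ α) (hG : G.Ok) :
      RTyping 𝒯 G (.var x) (.var x) (G.get x)
  | abs {γ : Ctx} {G : RCtx S γ} {α β : Ty} {u₁ u₂ : Tm (α :: γ) β} {T : RTy S (dbl γ) α}
      {U : RTy S (α :: α :: dbl γ) β} :
      RTyping 𝒯 (G.cons T) u₁ u₂ U → RTyping 𝒯 G (.lam u₁) (.lam u₂) (.pi T U)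
  | app {γ : Ctx} {G : RCtx S γ} {α β : Ty} {t₁ t₂ : Tm γ (.arr α β)} {u₁ u₂ : Tm γ α}
      {T : RTy S (dbl γ) α} {U : RTy S (α :: α :: dbl γ) β} :
      RTyping 𝒯 G t₁ t₂ (.pi T U) → RTyping 𝒯 G u₁ u₂ T →
      RTyping 𝒯 G (.app t₁ u₁) (.app t₂ u₂)
        (U.subst (Subst.two (u₁.rename left) (u₂.rename right)))
  | tt {γ : Ctx} {G : RCtx S γ} (hG : G.Ok) : RTyping 𝒯 G .tt .tt (.unary .bool)
  | ff {γ : Ctx} {G : RCtx S γ} (hG : G.Ok) : RTyping 𝒯 G .ff .ff (.unary .bool)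
  | zero {γ : Ctx} {G : RCtx S γ} (hG : G.Ok) : RTyping 𝒯 G .zero .zero (.unary .nat)
  | succ {γ : Ctx} {G : RCtx S γ} {t₁ t₂ : Tm γ .nat} :
      RTyping 𝒯 G t₁ t₂ (.unary .nat) → RTyping 𝒯 G (.succ t₁) (.succ t₂) (.unary .nat)
  | nil {γ : Ctx} {G : RCtx S γ} {α : Ty} {T : RTy S (dbl γ) α} (hG : G.Ok) (hT : T.Ok) :
      RTyping 𝒯 G .nil .nil (.list T)
  | cons {γ : Ctx} {G : RCtx S γ} {α : Ty} {h₁ h₂ : Tm γ α} {t₁ t₂ : Tm γ (.list α)}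
      {T : RTy S (dbl γ) α} :
      RTyping 𝒯 G h₁ h₂ T → RTyping 𝒯 G t₁ t₂ (.list T) →
      RTyping 𝒯 G (.cons h₁ t₁) (.cons h₂ t₂) (.list T)
  | sub {γ : Ctx} {G : RCtx S γ} {α : Ty} {t₁ t₂ : Tm γ α} {T U : RTy S (dbl γ) α} :
      RTyping 𝒯 G t₁ t₂ T → RSubtyping 𝒯 G T U → RTyping 𝒯 G t₁ t₂ U
  | letrec {γ : Ctx} {G : RCtx S γ} {α β : Ty} (h : Ind α) {e₁ e₂ : Tm (.arr α β :: α :: γ) β}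
      {T : RTy S (dbl γ) α} {U : RTy S (α :: α :: dbl γ) β}
      (hG : G.Ok) (hT : (RTy.pi T U).Ok) (hd₁ : WDef e₁) (hd₂ : WDef e₂) :
      /- `G, x :: T, f :: Π(y :: {y :: T ∣ (y₁, y₂) < (x₁, x₂)}). U[y/x]` -/
      RTyping 𝒯 ((G.cons T).cons
          (.pi (.ref (T.rename wk2) (.sizeLt2 h h v1 v0 v3 v2)) (U.rename wk2.lift.lift)))
        e₁ e₂ (U.rename wk2) →
      RTyping 𝒯 G (.letrec h e₁) (.letrec h e₂) (.pi T U)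
  | caseBool {γ : Ctx} {G : RCtx S γ} {β : Ty} {t₁ t₂ : Tm γ .bool} {u₁ u₂ v₁ v₂ : Tm γ β}
      {U : RTy S (dbl γ) β} :
      RTyping 𝒯 G t₁ t₂ (.unary .bool) →
      HOL 𝒯 G.form (.iff (.eq (t₁.rename left) .tt) (.eq (t₂.rename right) .tt)) →
      RTyping 𝒯 G u₁ u₂ U → RTyping 𝒯 G v₁ v₂ U →
      RTyping 𝒯 G (.caseBool t₁ u₁ v₁) (.caseBool t₂ u₂ v₂) U
  | caseNat {γ : Ctx} {G : RCtx S γ} {β : Ty} {t₁ t₂ : Tm γ .nat} {u₁ u₂ : Tm γ β}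
      {v₁ v₂ : Tm γ (.arr .nat β)} {U : RTy S (dbl γ) β} :
      RTyping 𝒯 G t₁ t₂ (.unary .nat) →
      HOL 𝒯 G.form (.iff (.eq (t₁.rename left) .zero) (.eq (t₂.rename right) .zero)) →
      RTyping 𝒯 G u₁ u₂ U → RTyping 𝒯 G v₁ v₂ (.pi (.unary .nat) (U.rename wk2)) →
      RTyping 𝒯 G (.caseNat t₁ u₁ v₁) (.caseNat t₂ u₂ v₂) U
  | caseList {γ : Ctx} {G : RCtx S γ} {α β : Ty} {t₁ t₂ : Tm γ (.list α)} {u₁ u₂ : Tm γ β}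
      {v₁ v₂ : Tm γ (.arr α (.arr (.list α) β))} {T : RTy S (dbl γ) α} {U : RTy S (dbl γ) β} :
      RTyping 𝒯 G t₁ t₂ (.list T) →
      HOL 𝒯 G.form (.iff (.eq (t₁.rename left) .nil) (.eq (t₂.rename right) .nil)) →
      RTyping 𝒯 G u₁ u₂ U →
      RTyping 𝒯 G v₁ v₂ (.pi T (.pi (.list (T.rename wk2)) (U.rename wk4))) →
      RTyping 𝒯 G (.caseList t₁ u₁ v₁) (.caseList t₂ u₂ v₂) U

/-- The valuation without the two most recent variables. -/
def Env.tail2 {Γ : Ctx} {α β : Ty} (θ : Env (β :: α :: Γ)) : Env Γ := fun _ x => θ x.succ.succ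

/-- Set-theoretic interpretation of a relational refinement type, a relation on values. Unary
types, and lists over them, relate all pairs of values. -/
def RTy.den {S : Signature.{u}} (M : Interp S) :
    {Δ : Ctx} → {α : Ty} → RTy S Δ α → Env Δ → α.den → α.den → Prop
  | _, _, .unary _, _, _, _ => True
  | _, _, .list (.unary _), _, _, _ => True
  | _, _, .list T, θ, l₁, l₂ => List.Forall₂ (fun v₁ v₂ => T.den M θ v₁ v₂) l₁ l₂
  | _, _, .pi T U, θ, F₁, F₂ =>
      ∀ v₁ v₂, T.den M θ v₁ v₂ → U.den M ((θ.cons v₁).cons v₂) (F₁ v₁) (F₂ v₂)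
  | _, _, .ref T φ, θ, v₁, v₂ => T.den M θ v₁ v₂ ∧ φ.den M ((θ.cons v₁).cons v₂)

/-- `θ ⊨ G`: the two copies of every variable are related by its type. -/
def RCtx.Models {S : Signature.{u}} (M : Interp S) : {γ : Ctx} → RCtx S γ → Env (dbl γ) → Prop
  | _, .nil, _ => True
  | _, .cons G T, θ =>
      G.Models M (Env.tail2 θ) ∧ T.den M (Env.tail2 θ) (θ (.succ .zero)) (θ .zero)

end RelHOL

namespace RelHOL

/-! ## Fusion laws of renaming and substitution -/

/-! The refinement of a type is built from the connectives that the program logics attach to the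
matching term formers: a product type becomes the implication `Form.arrow2`, a list type becomes
elementwise truth, and a refined type becomes a conjunction. Each rule for refinement types is then
a rule of HOL or RHOL up to entailments derivable in HOL, so the two syntactic statements follow by
induction on derivations.

Subtyping (`RSubtyping.hol`): products are contravariant in the domain as implication is. For lists
there are two cases. The refinement of a unary type is always derivable (`HOL.unary`), because every
chain of arrows ends in truth; hence so is that of a list of unary type (`HOL.listAll_intro`). If
the target element type is not unary, the side condition of the list rule makes the source non-unary
too, and `All2` is monotone in its relation (`HOL.listAll2_mono`). Without the side condition a list
of unary type, which does not bound the two lengths by each other, could be a subtype of one that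
forces them to agree.

Typing (`RTyping.rhol`): the induction runs over all hypotheses that derive the refinement of the
context, and not just over that refinement. The generality is needed because RHOL rules extend the
hypotheses in their own shape: case rules add facts about the scrutinees, and the recursion rule
provides a curried induction hypothesis, where the type of the recursive variable has a conjunction
in its domain. A cut (`HOL.cut`) transports subtyping and logical premises to the larger hypotheses.

Set-theoretic soundness (`RTyping.sound`) is a direct induction on typing and does not pass through
a model of RHOL. Only the logical premises need the model of HOL (`HOL.sound`), and `RTy.den_form`
links the two: the meaning of the refinement of a type is the relation that interprets the type.
Subtyping is then sound because its HOL derivation is. For recursive definitions, `WDef.den_letrec`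
shows that the chosen denotation satisfies its equation, and related arguments are treated by strong
induction on the sum of their sizes.

Underneath lie the commutation of refinements with substitution (`RTy.form_subst`), which makes the
dependent application rule fit, and the stability of HOL under renaming (`HOL.rename`). -/

@[simp] theorem Ren.lift_zero {Γ Δ : Ctx} {α : Ty} (ξ : Ren Γ Δ) :
    ξ.lift (Var.zero : Var (α :: Γ) α) = Var.zero := rfl

@[simp] theorem Ren.lift_succ {Γ Δ : Ctx} {α β : Ty} (ξ : Ren Γ Δ) (x : Var Γ β) :
    ξ.lift (Var.succ (β := α) x) = Var.succ (ξ x) := rfl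

@[simp] theorem Subst.lift_zero {Γ Δ : Ctx} {α : Ty} (σ : Subst Γ Δ) :
    σ.lift (Var.zero : Var (α :: Γ) α) = Tm.var Var.zero := rfl

@[simp] theorem Subst.lift_succ {Γ Δ : Ctx} {α β : Ty} (σ : Subst Γ Δ) (x : Var Γ β) :
    σ.lift (Var.succ (β := α) x) = (σ x).rename wk1 := rfl

@[simp] theorem Subst.cons_zero {Γ Δ : Ctx} {α : Ty} (t : Tm Δ α) (σ : Subst Γ Δ) :
    Subst.cons t σ Var.zero = t := rfl

@[simp] theorem Subst.cons_succ {Γ Δ : Ctx} {α β : Ty} (t : Tm Δ α) (σ : Subst Γ Δ)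
    (x : Var Γ β) : Subst.cons t σ (Var.succ x) = σ x := rfl

@[simp] theorem Ren.toSubst_apply {Γ Δ : Ctx} {α : Ty} (ξ : Ren Γ Δ) (x : Var Γ α) :
    ξ.toSubst x = .var (ξ x) := rfl

/-- Composition of renamings, in diagrammatic order. -/
def Ren.comp {Γ Δ Θ : Ctx} (ξ : Ren Γ Δ) (ζ : Ren Δ Θ) : Ren Γ Θ := fun _ x => ζ (ξ x)

/-- Composition of substitutions, in diagrammatic order. -/
def Subst.comp {Γ Δ Θ : Ctx} (σ : Subst Γ Δ) (τ : Subst Δ Θ) : Subst Γ Θ :=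
  fun _ x => (σ x).subst τ

@[simp] theorem Ren.comp_apply {Γ Δ Θ : Ctx} {α : Ty} (ξ : Ren Γ Δ) (ζ : Ren Δ Θ)
    (x : Var Γ α) : ξ.comp ζ x = ζ (ξ x) := rfl

@[simp] theorem Subst.comp_apply {Γ Δ Θ : Ctx} {α : Ty} (σ : Subst Γ Δ) (τ : Subst Δ Θ)
    (x : Var Γ α) : σ.comp τ x = (σ x).subst τ := rfl

theorem Ren.lift_comp {Γ Δ Θ : Ctx} {β : Ty} (ξ : Ren Γ Δ) (ζ : Ren Δ Θ) :
    (ξ.lift (β := β)).comp ζ.lift = (ξ.comp ζ).lift := by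
  funext α x
  cases x <;> rfl

theorem Ren.lift_toSubst {Γ Δ : Ctx} {β : Ty} (ξ : Ren Γ Δ) :
    (ξ.lift (β := β)).toSubst = ξ.toSubst.lift := by
  funext α x
  cases x <;> rfl

/-- A renaming is a substitution by variables. Later equalities between mixed renamings and
substitutions are reduced to a single substitution this way and then compared variable by variable.
-/
theorem Tm.rename_eq_subst {Γ Δ : Ctx} {α : Ty} (t : Tm Γ α) (ξ : Ren Γ Δ) :
    t.rename ξ = t.subst ξ.toSubst := by
  induction t generalizing Δ <;> simp_all [Tm.rename, Tm.subst, Ren.lift_toSubst]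

/-- The four fusion laws come in a forced order: each is proved by induction on the term, and its
binder case needs an earlier law to commute the lifted maps with weakening. -/
theorem Tm.rename_rename {Γ Δ Θ : Ctx} {α : Ty} (t : Tm Γ α) (ξ : Ren Γ Δ) (ζ : Ren Δ Θ) :
    (t.rename ξ).rename ζ = t.rename (ξ.comp ζ) := by
  induction t generalizing Δ Θ <;> simp only [Tm.rename, Ren.comp_apply, Ren.lift_comp, *]

theorem Subst.lift_ren_comp {Γ Δ Θ : Ctx} {β : Ty} (ξ : Ren Γ Δ) (σ : Subst Δ Θ) :
    ((ξ.lift (β := β)).toSubst).comp σ.lift = (ξ.toSubst.comp σ).lift := by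
  funext α x
  cases x <;> rfl

theorem Tm.subst_rename {Γ Δ Θ : Ctx} {α : Ty} (t : Tm Γ α) (ξ : Ren Γ Δ) (σ : Subst Δ Θ) :
    (t.rename ξ).subst σ = t.subst (ξ.toSubst.comp σ) := by
  induction t generalizing Δ Θ <;>
    simp only [Tm.rename, Tm.subst, Subst.lift_ren_comp, Subst.comp_apply, Ren.toSubst_apply, *]

theorem Subst.lift_comp_ren {Γ Δ Θ : Ctx} {β : Ty} (σ : Subst Γ Δ) (ξ : Ren Δ Θ) :
    (σ.lift (β := β)).comp (ξ.lift).toSubst = (σ.comp ξ.toSubst).lift := by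
  funext α x
  cases x with
  | zero => rfl
  | succ x =>
    simp only [Subst.comp_apply, Subst.lift_succ, ← Tm.rename_eq_subst, Tm.rename_rename]
    rfl

theorem Tm.rename_subst {Γ Δ Θ : Ctx} {α : Ty} (t : Tm Γ α) (σ : Subst Γ Δ) (ξ : Ren Δ Θ) :
    (t.subst σ).rename ξ = t.subst (σ.comp ξ.toSubst) := by
  rw [Tm.rename_eq_subst]
  induction t generalizing Δ Θ <;>
    simp only [Tm.subst, ← Ren.lift_toSubst, Subst.lift_comp_ren, Subst.comp_apply, *]

theorem Subst.lift_comp {Γ Δ Θ : Ctx} {β : Ty} (σ : Subst Γ Δ) (τ : Subst Δ Θ) :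
    (σ.lift (β := β)).comp τ.lift = (σ.comp τ).lift := by
  funext α x
  cases x with
  | zero => rfl
  | succ x =>
    -- Both sides weaken the same term, once before and once after applying the second substitution;
    -- the two mixed fusion laws turn each into one substitution.
    simp only [Subst.comp_apply, Subst.lift_succ, Tm.subst_rename, Tm.rename_subst]
    congr 1
    funext β y
    simp [Tm.subst, wk1, Tm.rename_eq_subst]

theorem Tm.subst_subst {Γ Δ Θ : Ctx} {α : Ty} (t : Tm Γ α) (σ : Subst Γ Δ) (τ : Subst Δ Θ) :
    (t.subst σ).subst τ = t.subst (σ.comp τ) := by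
  induction t generalizing Δ Θ <;> simp only [Tm.subst, Subst.lift_comp, Subst.comp_apply, *]

theorem Subst.lift_id {Γ : Ctx} {β : Ty} :
    (wk0 (Γ := Γ)).toSubst.lift (β := β) = wk0.toSubst := by
  funext α x
  cases x <;> rfl

theorem Tm.subst_id {Γ : Ctx} {α : Ty} (t : Tm Γ α) : t.subst wk0.toSubst = t := by
  induction t <;> simp_all [Tm.subst, Subst.lift_id]
  rfl

theorem Form.rename_eq_subst {S : Signature.{u}} {Γ Δ : Ctx} (φ : Form S Γ) (ξ : Ren Γ Δ) :
    φ.rename ξ = φ.subst ξ.toSubst := by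
  induction φ generalizing Δ <;>
    simp_all [Form.rename, Form.subst, Ren.lift_toSubst, Tm.rename_eq_subst]

theorem Form.subst_subst {S : Signature.{u}} {Γ Δ Θ : Ctx} (φ : Form S Γ) (σ : Subst Γ Δ)
    (τ : Subst Δ Θ) : (φ.subst σ).subst τ = φ.subst (σ.comp τ) := by
  induction φ generalizing Δ Θ <;> simp_all [Form.subst, Subst.lift_comp, Tm.subst_subst]

theorem Form.subst_id {S : Signature.{u}} {Γ : Ctx} (φ : Form S Γ) :
    φ.subst wk0.toSubst = φ := by
  induction φ <;> simp_all [Form.subst, Subst.lift_id, Tm.subst_id]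

theorem Form.subst_congr {S : Signature.{u}} {Γ Δ : Ctx} (φ : Form S Γ) {σ τ : Subst Γ Δ}
    (h : ∀ α (x : Var Γ α), σ x = τ x) : φ.subst σ = φ.subst τ := by
  congr 1
  funext α x
  exact h α x

theorem Form.subst_eq_self {S : Signature.{u}} {Γ : Ctx} (φ : Form S Γ) {σ : Subst Γ Γ}
    (h : ∀ α (x : Var Γ α), σ x = .var x) : φ.subst σ = φ :=
  (φ.subst_congr (τ := wk0.toSubst) h).trans φ.subst_id

theorem Tm.subst_congr {Γ Δ : Ctx} {α : Ty} (t : Tm Γ α) {σ τ : Subst Γ Δ}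
    (h : ∀ α (x : Var Γ α), σ x = τ x) : t.subst σ = t.subst τ := by
  congr 1
  funext α x
  exact h α x

theorem Tm.subst_eq_self {Γ : Ctx} {α : Ty} (t : Tm Γ α) {σ : Subst Γ Γ}
    (h : ∀ α (x : Var Γ α), σ x = .var x) : t.subst σ = t :=
  (t.subst_congr (τ := wk0.toSubst) h).trans t.subst_id

theorem Form.rename_rename {S : Signature.{u}} {Γ Δ Θ : Ctx} (φ : Form S Γ) (ξ : Ren Γ Δ)
    (ζ : Ren Δ Θ) : (φ.rename ξ).rename ζ = φ.rename (ξ.comp ζ) := by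
  simp only [Form.rename_eq_subst, Form.subst_subst]
  rfl

theorem RTy.rename_eq_subst {S : Signature.{u}} {Γ Δ : Ctx} {α : Ty} (T : RTy S Γ α)
    (ξ : Ren Γ Δ) : T.rename ξ = T.subst ξ.toSubst := by
  induction T generalizing Δ <;>
    simp_all [RTy.rename, RTy.subst, Ren.lift_toSubst, Form.rename_eq_subst]

/-- The refinement of a unary type has no free variable besides its subject, and a lifted
substitution fixes the subject. -/
theorem UTy.form_subst {S : Signature.{u}} {α : Ty} (τ : UTy α) {Γ Δ : Ctx} (σ : Subst Γ Δ) :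
    (τ.form (S := S)).subst σ.lift = τ.form := by
  induction τ generalizing Γ Δ with
  | bool => rfl
  | nat => rfl
  | arr τ σ' ih₁ ih₂ =>
    simp only [UTy.form, Form.arrow, Form.subst, Form.at1, Form.rename_eq_subst]
    congr 2
    · rw [Ren.lift_toSubst, Ren.lift_toSubst, ih₁, ih₁, ih₁]
    · rw [← ih₂ (Subst.lift σ), Form.subst_subst, Form.subst_subst]
      apply Form.subst_congr
      intro γ x
      rcases x with _ | _ | x
      · rfl
      · rfl
      · simp [wk1, Ren.toSubst, Ren.lift, Tm.subst, Tm.rename_eq_subst, Tm.subst_subst]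
        apply Tm.subst_congr
        intro γ x
        rfl

/-- The clauses for lists overlap and are tried in order, so the general one unfolds only once the
element type is known not to be unary. Arguments about lists therefore split on `IsUnary`. -/
theorem RTy.form_list {S : Signature.{u}} {Γ : Ctx} {α : Ty} {T : RTy S Γ α}
    (hT : ¬ T.IsUnary) :
    (RTy.list T).form = .listAll2 v1 v0 (T.form.rename wk2.lift.lift) := by
  cases T with
  | unary τ => exact (hT ⟨τ, rfl⟩).elim
  | _ => rfl

theorem RTy.isUnary_subst {S : Signature.{u}} {Γ Δ : Ctx} {α : Ty} {T : RTy S Γ α}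
    {σ : Subst Γ Δ} : (T.subst σ).IsUnary ↔ T.IsUnary := by
  cases T <;> simp [RTy.IsUnary, RTy.subst]

theorem UTy.form_at1 {S : Signature.{u}} {α : Ty} (τ : UTy α) {Γ Δ : Ctx} (σ : Subst (α :: Γ) Δ) :
    (τ.form (S := S)).subst σ = τ.form.at1 wk0 (σ .zero) := by
  rw [← τ.form_subst (fun _ x => σ (.succ x)), Form.at1, Form.subst_subst]
  apply Form.subst_congr
  intro γ x
  cases x with
  | zero => rfl
  | succ x => 
    simp [Tm.subst_rename]
    exact (Tm.subst_eq_self _ fun _ _ => rfl).symm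

/-- This is what makes the dependent application rule an instance of the RHOL one: the refinement of
the substituted type is the substituted refinement. In the list case, substitution neither creates
nor destroys unary types, so the same clause applies on both sides. -/
theorem RTy.form_subst {S : Signature.{u}} {Γ Δ : Ctx} {α : Ty} (T : RTy S Γ α)
    (σ : Subst Γ Δ) : (T.subst σ).form = T.form.subst σ.lift.lift := by
  induction T generalizing Δ with
  | unary τ =>
    simp only [RTy.subst, RTy.form, Form.subst, Form.at1, Form.subst_subst]
    congr 1 <;> (rw [τ.form_at1, τ.form_at1]; rfl)
  | list T ih =>
    by_cases hT : T.IsUnary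
    · obtain ⟨τ, rfl⟩ := hT
      simp [RTy.subst, RTy.form, Form.subst, UTy.form_subst, Tm.subst]
      rfl
    · rw [RTy.subst, RTy.form_list (mt RTy.isUnary_subst.1 hT), RTy.form_list hT, ih]
      simp only [Form.subst, Form.rename_eq_subst, Form.subst_subst]
      congr 1
      apply Form.subst_congr
      intro γ x
      rcases x with _ | _ | x
      · rfl
      · rfl
      · simp [wk2, Ren.toSubst, Ren.lift, Tm.subst, Tm.rename_eq_subst, Tm.subst_subst]
        apply Tm.subst_congr
        intro γ x
        rfl
  | pi T U ih₁ ih₂ =>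
    simp only [RTy.subst, RTy.form, Form.arrow2, Form.subst, Form.at2, ih₁, ih₂,
      Form.rename_eq_subst, Form.subst_subst]
    congr 3
    · apply Form.subst_congr
      intro γ x
      rcases x with _ | _ | x
      · rfl
      · rfl
      · simp [wk2, Ren.toSubst, Ren.lift, Tm.subst, Tm.rename_eq_subst, Tm.subst_subst]
        apply Tm.subst_congr
        intro γ x
        rfl
    · apply Form.subst_congr
      intro γ x
      rcases x with _ | _ | _ | _ | x
      · rfl
      · rfl
      · rfl
      · rfl
      · simp [wk2, Ren.toSubst, Ren.lift, Tm.subst, Tm.rename_eq_subst, Tm.subst_subst]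
        apply Tm.subst_congr
        intro γ x
        rfl
  | ref T φ ih => simp [RTy.subst, RTy.form, Form.subst, ih]

theorem RTy.form_rename {S : Signature.{u}} {Γ Δ : Ctx} {α : Ty} (T : RTy S Γ α)
    (ξ : Ren Γ Δ) : (T.rename ξ).form = T.form.rename ξ.lift.lift := by
  rw [RTy.rename_eq_subst, RTy.form_subst, Form.rename_eq_subst, Ren.lift_toSubst,
    Ren.lift_toSubst]

/-! ## Denotation of renamed and substituted terms and assertions -/

/-- Restriction of a valuation along a renaming. -/
def Env.pull {Γ Δ : Ctx} (ξ : Ren Γ Δ) (ρ : Env Δ) : Env Γ := fun _ x => ρ (ξ x)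

/-- The valuation that interprets every variable by its image under a substitution. -/
noncomputable def Env.eval {Γ Δ : Ctx} (σ : Subst Γ Δ) (ρ : Env Δ) : Env Γ :=
  fun _ x => (σ x).den ρ

@[simp] theorem Env.pull_apply {Γ Δ : Ctx} {α : Ty} (ξ : Ren Γ Δ) (ρ : Env Δ) (x : Var Γ α) :
    ρ.pull ξ x = ρ (ξ x) := rfl

@[simp] theorem Env.eval_apply {Γ Δ : Ctx} {α : Ty} (σ : Subst Γ Δ) (ρ : Env Δ) (x : Var Γ α) :
    ρ.eval σ x = (σ x).den ρ := rfl

theorem Env.pull_lift {Γ Δ : Ctx} {α : Ty} (ξ : Ren Γ Δ) (ρ : Env Δ) (v : α.den) :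
    (ρ.cons v).pull ξ.lift = (ρ.pull ξ).cons v := by
  funext β x
  cases x <;> rfl

theorem Tm.den_rename {Γ Δ : Ctx} {α : Ty} (t : Tm Γ α) (ξ : Ren Γ Δ) (ρ : Env Δ) :
    (t.rename ξ).den ρ = t.den (ρ.pull ξ) := by
  induction t generalizing Δ <;>
    simp only [Tm.rename, Tm.den, Env.pull_apply, Env.pull_lift, *]

theorem Env.eval_lift {Γ Δ : Ctx} {α : Ty} (σ : Subst Γ Δ) (ρ : Env Δ) (v : α.den) :
    (ρ.cons v).eval σ.lift = (ρ.eval σ).cons v := by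
  funext β x
  cases x with
  | zero => rfl
  | succ x =>
    simp only [Env.eval_apply, Subst.lift_succ, Tm.den_rename]
    rfl

/-- The semantic substitution lemma. Going under a binder is `Env.eval_lift`, which rests on the
version for renamings. -/
theorem Tm.den_subst {Γ Δ : Ctx} {α : Ty} (t : Tm Γ α) (σ : Subst Γ Δ) (ρ : Env Δ) :
    (t.subst σ).den ρ = t.den (ρ.eval σ) := by
  induction t generalizing Δ <;>
    simp only [Tm.subst, Tm.den, Env.eval_apply, Env.eval_lift, *]

theorem Form.den_subst {S : Signature.{u}} (M : Interp S) {Γ Δ : Ctx} (φ : Form S Γ)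
    (σ : Subst Γ Δ) (ρ : Env Δ) : (φ.subst σ).den M ρ ↔ φ.den M (ρ.eval σ) := by
  induction φ generalizing Δ <;>
    simp only [Form.subst, Form.den, Env.eval_lift, Tm.den_subst, *]

theorem Env.eval_toSubst {Γ Δ : Ctx} (ξ : Ren Γ Δ) (ρ : Env Δ) :
    ρ.eval ξ.toSubst = ρ.pull ξ := rfl

theorem Form.den_rename {S : Signature.{u}} (M : Interp S) {Γ Δ : Ctx} (φ : Form S Γ)
    (ξ : Ren Γ Δ) (ρ : Env Δ) : (φ.rename ξ).den M ρ ↔ φ.den M (ρ.pull ξ) := by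
  rw [Form.rename_eq_subst, Form.den_subst, Env.eval_toSubst]

theorem Env.eval_cons {Γ Δ : Ctx} {α : Ty} (t : Tm Δ α) (σ : Subst Γ Δ) (ρ : Env Δ) :
    ρ.eval (Subst.cons t σ) = (ρ.eval σ).cons (t.den ρ) := by
  funext β x
  cases x <;> rfl

theorem Form.den_at1 {S : Signature.{u}} (M : Interp S) {Γ Δ : Ctx} {α : Ty}
    (φ : Form S (α :: Γ)) (ξ : Ren Γ Δ) (t : Tm Δ α) (ρ : Env Δ) :
    (φ.at1 ξ t).den M ρ ↔ φ.den M ((ρ.pull ξ).cons (t.den ρ)) := by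
  rw [Form.at1, Form.den_subst, Env.eval_cons, Env.eval_toSubst]

theorem Form.den_at2 {S : Signature.{u}} (M : Interp S) {Γ Δ : Ctx} {α β : Ty}
    (φ : Form S (β :: α :: Γ)) (ξ : Ren Γ Δ) (t : Tm Δ α) (u : Tm Δ β) (ρ : Env Δ) :
    (φ.at2 ξ t u).den M ρ ↔ φ.den M (((ρ.pull ξ).cons (t.den ρ)).cons (u.den ρ)) := by
  rw [Form.at2, Form.den_subst, Env.eval_cons, Env.eval_cons, Env.eval_toSubst]

/-! ## Well-definedness of substituted terms and assertions -/

/-- Well-definedness quantifies over all valuations, and a substituted body under one valuation is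
the original body under another with the same argument and the same function. -/
theorem WDef.subst {Γ Δ : Ctx} {α β : Ty} {e : Tm (.arr α β :: α :: Γ) β} (he : WDef e)
    (σ : Subst Γ Δ) : WDef (e.subst σ.lift.lift) := by
  intro ρ v F G h
  rw [Tm.den_subst, Tm.den_subst, Env.eval_lift, Env.eval_lift, Env.eval_lift, Env.eval_lift]
  exact he _ v F G h

def Subst.Ok {Γ Δ : Ctx} (σ : Subst Γ Δ) : Prop := ∀ α (x : Var Γ α), (σ x).Ok

theorem Ren.toSubst_ok {Γ Δ : Ctx} (ξ : Ren Γ Δ) : ξ.toSubst.Ok := fun _ _ => trivial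

theorem WDef.rename {Γ Δ : Ctx} {α β : Ty} {e : Tm (.arr α β :: α :: Γ) β} (he : WDef e)
    (ξ : Ren Γ Δ) : WDef (e.rename ξ.lift.lift) := by
  rw [Tm.rename_eq_subst, Ren.lift_toSubst, Ren.lift_toSubst]
  exact he.subst _

theorem Tm.Ok.rename {Γ Δ : Ctx} {α : Ty} {t : Tm Γ α} (ht : t.Ok) (ξ : Ren Γ Δ) :
    (t.rename ξ).Ok := by
  induction t generalizing Δ with
  | letrec h e ih => exact ⟨ht.1.rename ξ, ih ht.2 _⟩
  | pair _ _ ih₁ ih₂ => exact ⟨ih₁ ht.1 ξ, ih₂ ht.2 ξ⟩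
  | app _ _ ih₁ ih₂ => exact ⟨ih₁ ht.1 ξ, ih₂ ht.2 ξ⟩
  | cons _ _ ih₁ ih₂ => exact ⟨ih₁ ht.1 ξ, ih₂ ht.2 ξ⟩
  | caseNat _ _ _ ih₁ ih₂ ih₃ => exact ⟨ih₁ ht.1 ξ, ih₂ ht.2.1 ξ, ih₃ ht.2.2 ξ⟩
  | caseBool _ _ _ ih₁ ih₂ ih₃ => exact ⟨ih₁ ht.1 ξ, ih₂ ht.2.1 ξ, ih₃ ht.2.2 ξ⟩
  | caseList _ _ _ ih₁ ih₂ ih₃ => exact ⟨ih₁ ht.1 ξ, ih₂ ht.2.1 ξ, ih₃ ht.2.2 ξ⟩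
  | fst _ ih => exact ih ht ξ
  | snd _ ih => exact ih ht ξ
  | lam _ ih => exact ih ht _
  | succ _ ih => exact ih ht ξ
  | _ => trivial

theorem Subst.Ok.lift {Γ Δ : Ctx} {β : Ty} {σ : Subst Γ Δ} (hσ : σ.Ok) :
    (σ.lift (β := β)).Ok := by
  intro α x
  cases x with
  | zero => trivial
  | succ x => exact (hσ _ x).rename _

theorem Subst.Ok.cons {Γ Δ : Ctx} {β : Ty} {t : Tm Δ β} {σ : Subst Γ Δ} (ht : t.Ok)
    (hσ : σ.Ok) : (Subst.cons t σ).Ok := by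
  intro α x
  cases x with
  | zero => exact ht
  | succ x => exact hσ _ x

theorem Tm.Ok.subst {Γ Δ : Ctx} {α : Ty} {t : Tm Γ α} (ht : t.Ok) {σ : Subst Γ Δ}
    (hσ : σ.Ok) : (t.subst σ).Ok := by
  induction t generalizing Δ with
  | var x => exact hσ _ x
  | letrec h e ih => exact ⟨ht.1.subst σ, ih ht.2 hσ.lift.lift⟩
  | pair _ _ ih₁ ih₂ => exact ⟨ih₁ ht.1 hσ, ih₂ ht.2 hσ⟩
  | app _ _ ih₁ ih₂ => exact ⟨ih₁ ht.1 hσ, ih₂ ht.2 hσ⟩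
  | cons _ _ ih₁ ih₂ => exact ⟨ih₁ ht.1 hσ, ih₂ ht.2 hσ⟩
  | caseNat _ _ _ ih₁ ih₂ ih₃ => exact ⟨ih₁ ht.1 hσ, ih₂ ht.2.1 hσ, ih₃ ht.2.2 hσ⟩
  | caseBool _ _ _ ih₁ ih₂ ih₃ => exact ⟨ih₁ ht.1 hσ, ih₂ ht.2.1 hσ, ih₃ ht.2.2 hσ⟩
  | caseList _ _ _ ih₁ ih₂ ih₃ => exact ⟨ih₁ ht.1 hσ, ih₂ ht.2.1 hσ, ih₃ ht.2.2 hσ⟩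
  | fst _ ih => exact ih ht hσ
  | snd _ ih => exact ih ht hσ
  | lam _ ih => exact ih ht hσ.lift
  | succ _ ih => exact ih ht hσ
  | _ => trivial

theorem Form.Ok.subst {S : Signature.{u}} {Γ Δ : Ctx} {φ : Form S Γ} (hφ : φ.Ok)
    {σ : Subst Γ Δ} (hσ : σ.Ok) : (φ.subst σ).Ok := by
  induction φ generalizing Δ with
  | pred P ts => exact fun i => (hφ i).subst hσ
  | eq t u => exact ⟨hφ.1.subst hσ, hφ.2.subst hσ⟩
  | sizeLe h t u => exact ⟨hφ.1.subst hσ, hφ.2.subst hσ⟩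
  | sizeLt h t u => exact ⟨hφ.1.subst hσ, hφ.2.subst hσ⟩
  | listAll l φ ih => exact ⟨hφ.1.subst hσ, ih hφ.2 hσ.lift⟩
  | listAll2 l₁ l₂ φ ih =>
    exact ⟨hφ.1.subst hσ, hφ.2.1.subst hσ, ih hφ.2.2 hσ.lift.lift⟩
  | top => trivial
  | bot => trivial
  | and φ ψ ih₁ ih₂ => exact ⟨ih₁ hφ.1 hσ, ih₂ hφ.2 hσ⟩
  | or φ ψ ih₁ ih₂ => exact ⟨ih₁ hφ.1 hσ, ih₂ hφ.2 hσ⟩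
  | imp φ ψ ih₁ ih₂ => exact ⟨ih₁ hφ.1 hσ, ih₂ hφ.2 hσ⟩
  | all α φ ih => exact ih hφ hσ.lift
  | ex α φ ih => exact ih hφ hσ.lift

theorem Form.Ok.rename {S : Signature.{u}} {Γ Δ : Ctx} {φ : Form S Γ} (hφ : φ.Ok)
    (ξ : Ren Γ Δ) : (φ.rename ξ).Ok := by
  rw [Form.rename_eq_subst]
  exact hφ.subst ξ.toSubst_ok

theorem Form.Ok.at1 {S : Signature.{u}} {Γ Δ : Ctx} {α : Ty} {φ : Form S (α :: Γ)}
    (hφ : φ.Ok) (ξ : Ren Γ Δ) {t : Tm Δ α} (ht : t.Ok) : (φ.at1 ξ t).Ok :=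
  hφ.subst (.cons ht ξ.toSubst_ok)

theorem Form.Ok.at2 {S : Signature.{u}} {Γ Δ : Ctx} {α β : Ty} {φ : Form S (β :: α :: Γ)}
    (hφ : φ.Ok) (ξ : Ren Γ Δ) {t : Tm Δ α} {u : Tm Δ β} (ht : t.Ok) (hu : u.Ok) :
    (φ.at2 ξ t u).Ok :=
  hφ.subst (.cons hu (.cons ht ξ.toSubst_ok))

theorem Form.Ok.arrow2 {S : Signature.{u}} {Γ : Ctx} {τ₁ τ₂ σ₁ σ₂ : Ty}
    {φ' : Form S (τ₂ :: τ₁ :: Γ)} {φ : Form S (σ₂ :: σ₁ :: τ₂ :: τ₁ :: Γ)} (hφ' : φ'.Ok)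
    (hφ : φ.Ok) : (φ'.arrow2 φ).Ok :=
  ⟨hφ'.rename _, hφ.at2 _ ⟨trivial, trivial⟩ ⟨trivial, trivial⟩⟩

theorem RTy.Ok.subst {S : Signature.{u}} {Γ Δ : Ctx} {α : Ty} {T : RTy S Γ α} (hT : T.Ok)
    {σ : Subst Γ Δ} (hσ : σ.Ok) : (T.subst σ).Ok := by
  induction T generalizing Δ with
  | unary τ => trivial
  | list T ih => exact ih hT hσ
  | pi T U ih₁ ih₂ => exact ⟨ih₁ hT.1 hσ, ih₂ hT.2 hσ.lift.lift⟩
  | ref T φ ih => exact ⟨ih hT.1 hσ, hT.2.subst hσ.lift.lift⟩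

theorem RTy.Ok.rename {S : Signature.{u}} {Γ Δ : Ctx} {α : Ty} {T : RTy S Γ α} (hT : T.Ok)
    (ξ : Ren Γ Δ) : (T.rename ξ).Ok := by
  rw [RTy.rename_eq_subst]
  exact hT.subst ξ.toSubst_ok

theorem UTy.form_ok {S : Signature.{u}} {α : Ty} (τ : UTy α) {Γ : Ctx} :
    (τ.form (S := S) (Γ := Γ)).Ok := by
  induction τ generalizing Γ with
  | bool => trivial
  | nat => trivial
  | arr τ σ ih₁ ih₂ => exact ⟨ih₁.rename _, ih₂.at1 _ ⟨trivial, trivial⟩⟩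

theorem RTy.Ok.form {S : Signature.{u}} {Γ : Ctx} {α : Ty} {T : RTy S Γ α} (hT : T.Ok) :
    T.form.Ok := by
  induction T with
  | unary τ => exact ⟨τ.form_ok.at1 _ trivial, τ.form_ok.at1 _ trivial⟩
  | list T ih =>
    by_cases hu : T.IsUnary
    · obtain ⟨τ, rfl⟩ := hu
      exact ⟨⟨trivial, τ.form_ok⟩, trivial, τ.form_ok⟩
    · rw [RTy.form_list hu]
      exact ⟨trivial, trivial, (ih hT).rename _⟩
  | pi T U ih₁ ih₂ => exact (ih₁ hT.1).arrow2 (ih₂ hT.2)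
  | ref T φ ih => exact ⟨ih hT.1, hT.2⟩

theorem RCtx.Ok.form {S : Signature.{u}} {γ : Ctx} {G : RCtx S γ} (hG : G.Ok) :
    ∀ ψ ∈ G.form, ψ.Ok := by
  induction G with
  | nil => exact fun _ h => nomatch h
  | cons G T ih =>
    intro ψ hψ
    rcases List.mem_cons.1 hψ with rfl | hψ
    · exact hG.2.form
    · obtain ⟨χ, hχ, rfl⟩ := List.mem_map.1 hψ
      exact (ih hG.1 χ hχ).rename _

theorem RCtx.Ok.get {S : Signature.{u}} {γ : Ctx} {G : RCtx S γ} (hG : G.Ok) {α : Ty}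
    (x : Var γ α) : (G.get x).Ok := by
  induction G with
  | nil => nomatch x
  | cons G T ih =>
    cases x with
    | zero => exact hG.2.rename _
    | succ x => exact (ih hG.1 x).rename _

theorem hyps_ok {S : Signature.{u}} {Γ Δ : Ctx} {Ψ : List (Form S Γ)} (hΨ : ∀ ψ ∈ Ψ, ψ.Ok)
    (ξ : Ren Γ Δ) : ∀ ψ ∈ hyps ξ Ψ, ψ.Ok := by
  intro ψ hψ
  obtain ⟨χ, hχ, rfl⟩ := List.mem_map.1 hψ
  exact (hΨ χ hχ).rename _

/-! ## Structural properties of derivability in higher-order logic -/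

/-- Only the commuting square of renamings matters for the parameters. The special cases for `wk0`,
`wk1` and `wk2` below have squares that commute definitionally, and they are the ones that occur in
the rules of HOL. -/
theorem Form.at1_rename {S : Signature.{u}} {Γ Δ Θ Λ : Ctx} {α : Ty} (φ : Form S (α :: Γ))
    {ζ : Ren Γ Δ} {ξ' : Ren Δ Θ} {ξ : Ren Γ Λ} {ζ' : Ren Λ Θ} (h : ζ.comp ξ' = ξ.comp ζ')
    (t : Tm Δ α) : (φ.at1 ζ t).rename ξ' = (φ.rename ξ.lift).at1 ζ' (t.rename ξ') := by
  simp only [Form.at1, Form.rename_eq_subst, Form.subst_subst, Tm.rename_eq_subst]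
  apply Form.subst_congr
  intro γ x
  cases x with
  | zero => rfl
  | succ x => exact congrArg Tm.var (congrFun (congrFun h γ) x)

theorem Form.at2_rename {S : Signature.{u}} {Γ Δ Θ Λ : Ctx} {α β : Ty}
    (φ : Form S (β :: α :: Γ)) {ζ : Ren Γ Δ} {ξ' : Ren Δ Θ} {ξ : Ren Γ Λ} {ζ' : Ren Λ Θ}
    (h : ζ.comp ξ' = ξ.comp ζ') (t : Tm Δ α) (u : Tm Δ β) :
    (φ.at2 ζ t u).rename ξ' =
      (φ.rename ξ.lift.lift).at2 ζ' (t.rename ξ') (u.rename ξ') := by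
  simp only [Form.at2, Form.rename_eq_subst, Form.subst_subst, Tm.rename_eq_subst]
  apply Form.subst_congr
  intro γ x
  rcases x with _ | _ | x
  · rfl
  · rfl
  · exact congrArg Tm.var (congrFun (congrFun h γ) x)

theorem Form.at1_wk0_rename {S : Signature.{u}} {Γ Δ : Ctx} {α : Ty} (φ : Form S (α :: Γ))
    (t : Tm Γ α) (ξ : Ren Γ Δ) :
    (φ.at1 wk0 t).rename ξ = (φ.rename ξ.lift).at1 wk0 (t.rename ξ) :=
  φ.at1_rename (ζ := wk0) (ξ := ξ) (ξ' := ξ) (ζ' := wk0) rfl t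

theorem Form.at1_wk1_rename {S : Signature.{u}} {Γ Δ : Ctx} {α β : Ty} (φ : Form S (α :: Γ))
    (t : Tm (β :: Γ) α) (ξ : Ren Γ Δ) :
    (φ.at1 wk1 t).rename ξ.lift = (φ.rename ξ.lift).at1 wk1 (t.rename ξ.lift) :=
  φ.at1_rename (ζ := wk1) (ξ := ξ) (ξ' := ξ.lift) (ζ' := wk1) rfl t

theorem Form.at1_wk2_rename {S : Signature.{u}} {Γ Δ : Ctx} {α β γ : Ty}
    (φ : Form S (α :: Γ)) (t : Tm (γ :: β :: Γ) α) (ξ : Ren Γ Δ) :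
    (φ.at1 wk2 t).rename ξ.lift.lift = (φ.rename ξ.lift).at1 wk2 (t.rename ξ.lift.lift) :=
  φ.at1_rename (ζ := wk2) (ξ := ξ) (ξ' := ξ.lift.lift) (ζ' := wk2) rfl t

theorem Form.at2_wk0_rename {S : Signature.{u}} {Γ Δ : Ctx} {α β : Ty}
    (φ : Form S (β :: α :: Γ)) (t : Tm Γ α) (u : Tm Γ β) (ξ : Ren Γ Δ) :
    (φ.at2 wk0 t u).rename ξ = (φ.rename ξ.lift.lift).at2 wk0 (t.rename ξ) (u.rename ξ) :=
  φ.at2_rename (ζ := wk0) (ξ := ξ) (ξ' := ξ) (ζ' := wk0) rfl t u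

theorem Tm.subst_one_rename {Γ Δ : Ctx} {α β : Ty} (t : Tm (α :: Γ) β) (u : Tm Γ α)
    (ξ : Ren Γ Δ) :
    (t.subst (Subst.one u)).rename ξ = (t.rename ξ.lift).subst (Subst.one (u.rename ξ)) := by
  simp only [Tm.rename_eq_subst, Tm.subst_subst]
  apply Tm.subst_congr
  intro γ x
  cases x <;> rfl

theorem Tm.subst_two_rename {Γ Δ : Ctx} {α β γ : Ty} (t : Tm (β :: α :: Γ) γ) (u : Tm Γ α)
    (v : Tm Γ β) (ξ : Ren Γ Δ) :
    (t.subst (Subst.two u v)).rename ξ =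
      (t.rename ξ.lift.lift).subst (Subst.two (u.rename ξ) (v.rename ξ)) := by
  simp only [Tm.rename_eq_subst, Tm.subst_subst]
  apply Tm.subst_congr
  intro γ x
  rcases x with _ | _ | x <;> rfl

theorem Tm.IsCtor.rename {Γ Δ : Ctx} {α : Ty} {t : Tm Γ α} (ht : t.IsCtor) (ξ : Ren Γ Δ) :
    (t.rename ξ).IsCtor := by
  cases ht <;> constructor

theorem Step.rename {Γ Δ : Ctx} {α : Ty} {t t' : Tm Γ α} (h : Step t t') (ξ : Ren Γ Δ) :
    Step (t.rename ξ) (t'.rename ξ) := by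
  induction h generalizing Δ with
  | beta t u =>
    -- The contractum contains a substitution, which has to be commuted with the renaming before the
    -- rule applies again; likewise for the unfolding of recursion.
    rw [Tm.subst_one_rename]
    exact .beta _ _
  | mu h e u hd hu =>
    rw [Tm.subst_two_rename]
    exact .mu h _ _ (hd.rename ξ) (hu.rename ξ)
  | lam _ ih => exact .lam (ih _)
  | letrec h _ ih => exact .letrec h (ih _)
  | _ =>
    simp only [Tm.rename]
    constructor <;> solve_by_elim

theorem Conv.rename {Γ Δ : Ctx} {α : Ty} {t t' : Tm Γ α} (h : Conv t t') (ξ : Ren Γ Δ) :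
    Conv (t.rename ξ) (t'.rename ξ) := by
  induction h with
  | rel t t' h => exact .rel _ _ (h.rename ξ)
  | refl t => exact .refl _
  | symm t t' _ ih => exact .symm _ _ ih
  | trans t t' t'' _ _ ih₁ ih₂ => exact .trans _ _ _ ih₁ ih₂

theorem BasicAx.rename {S : Signature.{u}} {Γ Δ : Ctx} {φ : Form S Γ} (h : BasicAx φ)
    (ξ : Ren Γ Δ) : BasicAx (φ.rename ξ) := by
  cases h with
  | allCons h t φ =>
    simp only [Form.iff, Form.rename]
    rw [Form.at1_wk0_rename]
    exact .allCons _ _ _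
  | all2Cons h₁ h₂ t₁ t₂ φ =>
    simp only [Form.iff, Form.rename]
    rw [Form.at2_wk0_rename]
    exact .all2Cons _ _ _ _ _
  | _ => constructor

theorem HOL.wf {S : Signature.{u}} {𝒯 : Theory S} {Γ : Ctx} {Ψ : List (Form S Γ)}
    {φ : Form S Γ} (h : HOL 𝒯 Ψ φ) : WfHOL Ψ φ := by
  cases h <;> assumption

theorem WfHOL.rename {S : Signature.{u}} {Γ Δ : Ctx} {Ψ : List (Form S Γ)} {φ : Form S Γ}
    (h : WfHOL Ψ φ) (ξ : Ren Γ Δ) {Ψ' : List (Form S Δ)} (hΨ' : ∀ ψ ∈ Ψ', ψ.Ok) :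
    WfHOL Ψ' (φ.rename ξ) :=
  ⟨hΨ', h.2.rename ξ⟩

/-- Rules that bind variables weaken their hypotheses. The commuting square says that renaming after
weakening is weakening after renaming, so inclusion of hypotheses survives passage under binders. -/
theorem hyps_subset {S : Signature.{u}} {Γ Δ Γ' Δ' : Ctx} {Ψ : List (Form S Γ)}
    {Ψ' : List (Form S Δ)} {ξ : Ren Γ Δ} (h : ∀ ψ ∈ Ψ, ψ.rename ξ ∈ Ψ') {ζ : Ren Γ Γ'}
    {ζ' : Ren Δ Δ'} {ξ' : Ren Γ' Δ'} (hc : ζ.comp ξ' = ξ.comp ζ') :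
    ∀ ψ ∈ hyps ζ Ψ, ψ.rename ξ' ∈ hyps ζ' Ψ' := by
  intro ψ hψ
  obtain ⟨χ, hχ, rfl⟩ := List.mem_map.1 hψ
  rw [Form.rename_rename, hc, ← Form.rename_rename]
  exact List.mem_map_of_mem (h χ hχ)

theorem hyps_wk1_subset {S : Signature.{u}} {Γ Δ : Ctx} {α : Ty} {Ψ : List (Form S Γ)}
    {Ψ' : List (Form S Δ)} {ξ : Ren Γ Δ} (h : ∀ ψ ∈ Ψ, ψ.rename ξ ∈ Ψ') :
    ∀ ψ ∈ hyps (wk1 (α := α)) Ψ, ψ.rename ξ.lift ∈ hyps wk1 Ψ' :=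
  hyps_subset h (ζ' := wk1) (ξ' := ξ.lift) rfl

theorem hyps_wk2_subset {S : Signature.{u}} {Γ Δ : Ctx} {α β : Ty} {Ψ : List (Form S Γ)}
    {Ψ' : List (Form S Δ)} {ξ : Ren Γ Δ} (h : ∀ ψ ∈ Ψ, ψ.rename ξ ∈ Ψ') :
    ∀ ψ ∈ hyps (wk2 (α := α) (β := β)) Ψ, ψ.rename ξ.lift.lift ∈ hyps wk2 Ψ' :=
  hyps_subset h (ζ' := wk2) (ξ' := ξ.lift.lift) rfl

theorem cons_subset {S : Signature.{u}} {Γ Δ : Ctx} {Ψ : List (Form S Γ)}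
    {Ψ' : List (Form S Δ)} {ξ : Ren Γ Δ} (h : ∀ ψ ∈ Ψ, ψ.rename ξ ∈ Ψ') {φ : Form S Γ}
    {φ' : Form S Δ} (hφ : φ.rename ξ = φ') : ∀ ψ ∈ φ :: Ψ, ψ.rename ξ ∈ φ' :: Ψ' := by
  intro ψ hψ
  rcases List.mem_cons.1 hψ with rfl | hψ
  · exact hφ ▸ List.mem_cons_self
  · exact List.mem_cons_of_mem _ (h ψ hψ)

theorem cons_ok {S : Signature.{u}} {Γ : Ctx} {Ψ : List (Form S Γ)} {φ : Form S Γ}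
    (hφ : φ.Ok) (hΨ : ∀ ψ ∈ Ψ, ψ.Ok) : ∀ ψ ∈ φ :: Ψ, ψ.Ok :=
  List.forall_mem_cons.2 ⟨hφ, hΨ⟩

/-- Derivability is stable under renaming and weakening. -/
theorem HOL.rename {S : Signature.{u}} {𝒯 : Theory S} {Γ : Ctx} {Ψ : List (Form S Γ)}
    {φ : Form S Γ} (h : HOL 𝒯 Ψ φ) {Δ : Ctx} (ξ : Ren Γ Δ) {Ψ' : List (Form S Δ)}
    (hΨ' : ∀ ψ ∈ Ψ', ψ.Ok) (hs : ∀ ψ ∈ Ψ, ψ.rename ξ ∈ Ψ') : HOL 𝒯 Ψ' (φ.rename ξ) := by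
  induction h generalizing Δ with
  | ax wf h => exact .ax (wf.rename ξ hΨ') (hs _ h)
  | @theory Γ Ψ φ wf h =>
    -- Axioms are closed: there is only one renaming out of the empty context, so the axiom is moved
    -- to itself.
    have e : (φ.rename Ren.nil).rename ξ = φ.rename Ren.nil := by
      rw [Form.rename_rename]
      congr 1
      funext α x
      nomatch x
    have wf' := wf.rename ξ hΨ'
    rw [e] at wf' ⊢
    exact .theory wf' h
  | basic wf h => exact .basic (wf.rename ξ hΨ') (h.rename ξ)
  | conv wf h => exact .conv (wf.rename ξ hΨ') (h.rename ξ)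
  | subst φ hφ wf _ _ ih₁ ih₂ =>
    have wf' := wf.rename ξ hΨ'
    have h₁ := ih₁ ξ hΨ' hs
    rw [Form.at1_wk0_rename] at wf' h₁ ⊢
    exact .subst _ (hφ.rename _) wf' h₁ (ih₂ ξ hΨ' hs)
  | impI wf _ ih =>
    exact .impI (wf.rename ξ hΨ')
      (ih ξ (cons_ok (wf.2.1.rename ξ) hΨ') (cons_subset hs rfl))
  | impE wf _ _ ih₁ ih₂ => exact .impE (wf.rename ξ hΨ') (ih₁ ξ hΨ' hs) (ih₂ ξ hΨ' hs)
  | allI wf _ ih =>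
    exact .allI (wf.rename ξ hΨ') (ih ξ.lift (hyps_ok hΨ' _) (hyps_subset hs rfl))
  | @allE Γ Ψ α φ t ht wf _ ih =>
    have wf' := wf.rename ξ hΨ'
    rw [Form.at1_wk0_rename] at wf' ⊢
    exact .allE _ (ht.rename ξ) wf' (ih ξ hΨ' hs)
  | @exI Γ Ψ α φ t ht wf _ ih =>
    have h := ih ξ hΨ' hs
    rw [Form.at1_wk0_rename] at h
    exact .exI _ (ht.rename ξ) (wf.rename ξ hΨ') h
  | @exE Γ Ψ α φ χ wf h₁ _ ih₁ ih₂ =>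
    have h := ih₂ ξ.lift (cons_ok ((show φ.Ok from h₁.wf.2).rename ξ.lift) (hyps_ok hΨ' wk1))
      (cons_subset (hyps_wk1_subset hs) rfl)
    have e : (χ.rename wk1).rename ξ.lift = (χ.rename ξ).rename (wk1 (α := α)) := by
      rw [Form.rename_rename, Form.rename_rename]
      rfl
    rw [e] at h
    exact .exE (wf.rename ξ hΨ') (ih₁ ξ hΨ' hs) h
  | topI wf => exact .topI (wf.rename ξ hΨ')
  | botE wf _ ih => exact .botE (wf.rename ξ hΨ') (ih ξ hΨ' hs)
  | andI wf _ _ ih₁ ih₂ => exact .andI (wf.rename ξ hΨ') (ih₁ ξ hΨ' hs) (ih₂ ξ hΨ' hs)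
  | andE1 wf _ ih => exact .andE1 (wf.rename ξ hΨ') (ih ξ hΨ' hs)
  | andE2 wf _ ih => exact .andE2 (wf.rename ξ hΨ') (ih ξ hΨ' hs)
  | orI1 wf _ ih => exact .orI1 (wf.rename ξ hΨ') (ih ξ hΨ' hs)
  | orI2 wf _ ih => exact .orI2 (wf.rename ξ hΨ') (ih ξ hΨ' hs)
  | orE wf h _ _ ih ih₁ ih₂ =>
    exact .orE (wf.rename ξ hΨ') (ih ξ hΨ' hs)
      (ih₁ ξ (cons_ok (h.wf.2.1.rename ξ) hΨ') (cons_subset hs rfl))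
      (ih₂ ξ (cons_ok (h.wf.2.2.rename ξ) hΨ') (cons_subset hs rfl))
  | @listInd Γ Ψ α φ wf _ h₂ ih₁ ih₂ =>
    have hφ : φ.Ok := wf.2
    have h₁ := ih₁ ξ hΨ' hs
    have h₂ := ih₂ ξ.lift.lift
      (cons_ok ((hφ.rename ξ.lift).at1 wk2 (t := v0) trivial) (hyps_ok hΨ' wk2))
      (cons_subset (hyps_wk2_subset hs) (Form.at1_wk2_rename φ _ ξ))
    rw [Form.at1_wk0_rename] at h₁
    rw [Form.at1_wk2_rename] at h₂
    exact .listInd (wf.rename ξ hΨ') h₁ h₂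
  | @natInd Γ Ψ φ wf _ h₂ ih₁ ih₂ =>
    have hφ : φ.Ok := wf.2
    have h₁ := ih₁ ξ hΨ' hs
    have h₂ := ih₂ ξ.lift (cons_ok (hφ.rename ξ.lift) (hyps_ok hΨ' wk1))
      (cons_subset (hyps_wk1_subset hs) rfl)
    rw [Form.at1_wk0_rename] at h₁
    rw [Form.at1_wk1_rename] at h₂
    exact .natInd (wf.rename ξ hΨ') h₁ h₂
  | @boolInd Γ Ψ φ wf _ _ ih₁ ih₂ =>
    have h₁ := ih₁ ξ hΨ' hs
    have h₂ := ih₂ ξ hΨ' hs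
    rw [Form.at1_wk0_rename] at h₁ h₂
    exact .boolInd (wf.rename ξ hΨ') h₁ h₂
  | cons1 wf _ ih => exact .cons1 (wf.rename ξ hΨ') (ih ξ hΨ' hs)
  | cons2 wf _ ih => exact .cons2 (wf.rename ξ hΨ') (ih ξ hΨ' hs)
  | succ1 wf _ ih => exact .succ1 (wf.rename ξ hΨ') (ih ξ hΨ' hs)
  | @strongInd Γ Ψ α h φ wf _ ih =>
    have hφ : φ.Ok := wf.2
    have e : (Form.all α (.imp (.sizeLt h v0 v1) (φ.at1 wk2 v0))).rename ξ.lift =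
        .all α (.imp (.sizeLt h v0 v1) ((φ.rename ξ.lift).at1 wk2 v0)) := by
      simp only [Form.rename]
      rw [Form.at1_wk2_rename]
      rfl
    exact .strongInd h (wf.rename ξ hΨ')
      (ih ξ.lift (cons_ok ⟨⟨trivial, trivial⟩, (hφ.rename ξ.lift).at1 wk2 (t := v0) trivial⟩
        (hyps_ok hΨ' wk1)) (cons_subset (hyps_wk1_subset hs) e))

/-! ### Derived rules -/

section
variable {S : Signature.{u}} {𝒯 : Theory S} {Γ : Ctx} {Ψ : List (Form S Γ)}

theorem HOL.hyp {φ : Form S Γ} (hΨ : ∀ ψ ∈ Ψ, ψ.Ok) (h : φ ∈ Ψ) : HOL 𝒯 Ψ φ :=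
  .ax ⟨hΨ, hΨ φ h⟩ h

theorem HOL.intro {φ ψ : Form S Γ} (h : HOL 𝒯 (ψ :: Ψ) φ) : HOL 𝒯 Ψ (.imp ψ φ) :=
  .impI ⟨fun χ hχ => h.wf.1 χ (List.mem_cons_of_mem _ hχ),
    h.wf.1 ψ List.mem_cons_self, h.wf.2⟩ h

theorem HOL.mp {φ ψ : Form S Γ} (h : HOL 𝒯 Ψ (.imp ψ φ)) (h' : HOL 𝒯 Ψ ψ) : HOL 𝒯 Ψ φ :=
  .impE ⟨h.wf.1, h.wf.2.2⟩ h h'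

theorem HOL.gen {α : Ty} {φ : Form S (α :: Γ)} (hΨ : ∀ ψ ∈ Ψ, ψ.Ok)
    (h : HOL 𝒯 (hyps wk1 Ψ) φ) : HOL 𝒯 Ψ (.all α φ) :=
  .allI ⟨hΨ, h.wf.2⟩ h

theorem HOL.inst {α : Ty} {φ : Form S (α :: Γ)} (h : HOL 𝒯 Ψ (.all α φ)) {t : Tm Γ α}
    (ht : t.Ok) {χ : Form S Γ} (e : χ = φ.at1 wk0 t) : HOL 𝒯 Ψ χ := by
  subst e
  exact .allE t ht ⟨h.wf.1, Form.Ok.at1 h.wf.2 wk0 ht⟩ h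

theorem HOL.and_intro {φ ψ : Form S Γ} (h : HOL 𝒯 Ψ φ) (h' : HOL 𝒯 Ψ ψ) :
    HOL 𝒯 Ψ (.and φ ψ) :=
  .andI ⟨h.wf.1, h.wf.2, h'.wf.2⟩ h h'

theorem HOL.left {φ ψ : Form S Γ} (h : HOL 𝒯 Ψ (.and φ ψ)) : HOL 𝒯 Ψ φ :=
  .andE1 ⟨h.wf.1, h.wf.2.1⟩ h

theorem HOL.right {φ ψ : Form S Γ} (h : HOL 𝒯 Ψ (.and φ ψ)) : HOL 𝒯 Ψ ψ :=
  .andE2 ⟨h.wf.1, h.wf.2.2⟩ h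

theorem Form.rename_id (φ : Form S Γ) : φ.rename wk0 = φ := by
  rw [Form.rename_eq_subst, Form.subst_id]

theorem HOL.weaken {φ : Form S Γ} (h : HOL 𝒯 Ψ φ) {Ψ' : List (Form S Γ)}
    (hΨ' : ∀ ψ ∈ Ψ', ψ.Ok) (hs : ∀ ψ ∈ Ψ, ψ ∈ Ψ') : HOL 𝒯 Ψ' φ := by
  have := h.rename wk0 hΨ' fun ψ hψ => by
    rw [Form.rename_id]
    exact hs ψ hψ
  rwa [Form.rename_id] at this

theorem HOL.weaken_cons {φ χ : Form S Γ} (h : HOL 𝒯 Ψ φ) (hχ : χ.Ok) : HOL 𝒯 (χ :: Ψ) φ :=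
  h.weaken (cons_ok hχ h.wf.1) fun _ hψ => List.mem_cons_of_mem _ hψ

theorem HOL.rename_hyps {φ : Form S Γ} (h : HOL 𝒯 Ψ φ) {Δ : Ctx} (ξ : Ren Γ Δ) :
    HOL 𝒯 (hyps ξ Ψ) (φ.rename ξ) :=
  h.rename ξ (hyps_ok h.wf.1 ξ) fun _ hψ => List.mem_map_of_mem hψ

/-- Cut for a list of assertions. -/
theorem HOL.cut {φ : Form S Γ} {Φ : List (Form S Γ)} (h : HOL 𝒯 Φ φ) (hΨ : ∀ ψ ∈ Ψ, ψ.Ok)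
    (hs : ∀ ψ ∈ Φ, HOL 𝒯 Ψ ψ) : HOL 𝒯 Ψ φ := by
  induction Φ generalizing φ with
  | nil => exact h.weaken hΨ fun _ h => nomatch h
  | cons χ Φ ih =>
    exact (ih h.intro fun ψ hψ => hs ψ (List.mem_cons_of_mem _ hψ)).mp
      (hs χ List.mem_cons_self)

theorem hyps_hyps {Δ Θ : Ctx} (ξ : Ren Γ Δ) (ζ : Ren Δ Θ) :
    hyps ζ (hyps ξ Ψ) = hyps (ξ.comp ζ) Ψ := by
  simp only [hyps, List.map_map]
  congr 1
  funext ψ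
  exact ψ.rename_rename ξ ζ

/-- Instantiation of a substitution instance of a derivable sequent in which the two most recent
variables do not occur in the side hypotheses. -/
theorem HOL.inst2 {α β : Ty} {φ χ : Form S (β :: α :: Γ)}
    (h : HOL 𝒯 (φ :: hyps wk2 Ψ) χ) (hΨ : ∀ ψ ∈ Ψ, ψ.Ok) {t : Tm Γ α} {u : Tm Γ β} (ht : t.Ok)
    (hu : u.Ok) : HOL 𝒯 Ψ (.imp (φ.at2 wk0 t u) (χ.at2 wk0 t u)) := by
  -- Discharge the hypothesis, generalize over the two fresh variables, and instantiate them one at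
  -- a time; the two successive substitutions fuse into the simultaneous one.
  have h' : HOL 𝒯 (hyps wk1 (hyps wk1 Ψ)) (.imp φ χ) := by
    rw [hyps_hyps]
    exact h.intro
  have h₁ : HOL 𝒯 Ψ (.all α (.all β (.imp φ χ))) := .gen hΨ (.gen (hyps_ok hΨ _) h')
  refine HOL.inst (h₁.inst ht rfl) hu ?_
  simp only [Form.at1, Form.at2, Form.subst, Form.subst_subst]
  congr 1 <;> apply Form.subst_congr <;> intro γ x <;> rcases x with _ | _ | x <;>
    simp [Tm.subst, Tm.subst_rename] <;> try rfl
  all_goals exact (Tm.subst_eq_self _ fun _ _ => rfl).symm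

end

/-! ## Derivations about refinements -/

@[simp] theorem wk1_apply {Γ : Ctx} {α β : Ty} (x : Var Γ β) : wk1 (α := α) x = x.succ := rfl

@[simp] theorem wk2_apply {Γ : Ctx} {α β γ : Ty} (x : Var Γ γ) :
    wk2 (α := α) (β := β) x = x.succ.succ := rfl

@[simp] theorem Tm.rename_wk1_subst_cons {Γ Δ : Ctx} {α β : Ty} (t : Tm Γ α) (u : Tm Δ β)
    (σ : Subst Γ Δ) : (t.rename wk1).subst (Subst.cons u σ) = t.subst σ := by
  rw [Tm.subst_rename]
  rfl

@[simp] theorem Tm.rename_wk1_subst_lift {Γ Δ : Ctx} {α β : Ty} (t : Tm Γ α) (σ : Subst Γ Δ) :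
    (t.rename (wk1 (α := β))).subst σ.lift = (t.subst σ).rename wk1 := by
  rw [Tm.subst_rename, Tm.rename_subst]
  apply Tm.subst_congr
  intro γ x
  exact Tm.rename_eq_subst _ _

theorem Tm.var_ok {Γ : Ctx} {α : Ty} (x : Var Γ α) : (Tm.var x).Ok := trivial

theorem Tm.app_ok {Γ : Ctx} {α β : Ty} {t : Tm Γ (.arr α β)} {u : Tm Γ α} (ht : t.Ok)
    (hu : u.Ok) : (Tm.app t u).Ok := ⟨ht, hu⟩

theorem Tm.cons_ok {Γ : Ctx} {α : Ty} {h : Tm Γ α} {t : Tm Γ (.list α)} (hh : h.Ok)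
    (ht : t.Ok) : (Tm.cons h t).Ok := ⟨hh, ht⟩

theorem Form.imp_ok {S : Signature.{u}} {Γ : Ctx} {φ ψ : Form S Γ} (hφ : φ.Ok) (hψ : ψ.Ok) :
    (Form.imp φ ψ).Ok := ⟨hφ, hψ⟩

theorem Form.and_ok {S : Signature.{u}} {Γ : Ctx} {φ ψ : Form S Γ} (hφ : φ.Ok) (hψ : ψ.Ok) :
    (Form.and φ ψ).Ok := ⟨hφ, hψ⟩

theorem Form.iff_ok {S : Signature.{u}} {Γ : Ctx} {φ ψ : Form S Γ} (hφ : φ.Ok) (hψ : ψ.Ok) :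
    (Form.iff φ ψ).Ok := ⟨⟨hφ, hψ⟩, hψ, hφ⟩

theorem Form.listAll_ok {S : Signature.{u}} {Γ : Ctx} {α : Ty} {l : Tm Γ (.list α)}
    {φ : Form S (α :: Γ)} (hl : l.Ok) (hφ : φ.Ok) : (Form.listAll l φ).Ok := ⟨hl, hφ⟩

theorem Form.listAll2_ok {S : Signature.{u}} {Γ : Ctx} {α β : Ty} {l₁ : Tm Γ (.list α)}
    {l₂ : Tm Γ (.list β)} {φ : Form S (β :: α :: Γ)} (h₁ : l₁.Ok) (h₂ : l₂.Ok) (hφ : φ.Ok) :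
    (Form.listAll2 l₁ l₂ φ).Ok := ⟨h₁, h₂, hφ⟩

@[simp] theorem Tm.rename_var {Γ Δ : Ctx} {α : Ty} (x : Var Γ α) (ξ : Ren Γ Δ) :
    (Tm.var x).rename ξ = .var (ξ x) := rfl

@[simp] theorem Tm.subst_wk0 {Γ : Ctx} {α : Ty} (t : Tm Γ α) : t.subst wk0.toSubst = t :=
  t.subst_id

/-! ### Unary refinements, the list predicates and relational arrows in HOL -/

section
variable {S : Signature.{u}} {𝒯 : Theory S} {Γ : Ctx} {Ψ : List (Form S Γ)}

/-- The refinement of a unary type is derivable. -/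
theorem HOL.unary {α : Ty} (τ : UTy α) {Δ : Ctx} {σ : Subst (α :: Δ) Γ} (hΨ : ∀ ψ ∈ Ψ, ψ.Ok)
    (hσ : σ.Ok) : HOL 𝒯 Ψ (τ.form.subst σ) := by
  induction τ generalizing Γ Δ with
  | bool => exact .topI ⟨hΨ, trivial⟩
  | nat => exact .topI ⟨hΨ, trivial⟩
  | arr τ τ' _ ih =>
    simp only [UTy.form, Form.arrow, Form.subst, Form.at1, Form.subst_subst]
    exact .gen hΨ (.intro (ih
      (cons_ok ((τ.form_ok.rename wk1.lift).subst hσ.lift) (hyps_ok hΨ _)) fun β x =>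
        Tm.Ok.subst (Subst.Ok.cons (Tm.app_ok (Tm.var_ok _) (Tm.var_ok _))
          (Ren.toSubst_ok _) β x) hσ.lift))

/-- List induction on a generic list: the empty list is an axiom, and for a nonempty list the head
is an instance of the generalized assertion while the tail is the induction hypothesis. -/
theorem HOL.listAll_intro {α : Ty} {φ : Form S (α :: Γ)} (h : HOL 𝒯 (hyps wk1 Ψ) φ)
    (hΨ : ∀ ψ ∈ Ψ, ψ.Ok) {l : Tm Γ (.list α)} (hl : l.Ok) : HOL 𝒯 Ψ (.listAll l φ) := by
  have hφ := h.wf.2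
  -- All instances of the induction predicate, in every context, computed once. The predicate is
  -- weakened past the list variable, and instantiation undoes that.
  have e {Δ : Ctx} (ξ : Ren Γ Δ) (t : Tm Δ (.list α)) :
      (Form.listAll v0 (φ.rename wk1.lift)).at1 ξ t = .listAll t (φ.rename ξ.lift) := by
    simp only [Form.at1, Form.subst, Form.rename_eq_subst, Form.subst_subst]
    congr 1
    apply Form.subst_congr
    intro γ x
    cases x <;> rfl
  have h' : HOL 𝒯 Ψ (.all (.list α) (.listAll v0 (φ.rename wk1.lift))) := by
    refine .listInd ⟨hΨ, trivial, hφ.rename _⟩ ?_ ?_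
    · rw [e]
      exact .basic ⟨hΨ, trivial, hφ.rename _⟩ (.allNil _)
    · rw [e, e]
      have hΨ' := cons_ok (φ := .listAll v0 (φ.rename (wk2 (α := α) (β := .list α)).lift))
        ⟨trivial, hφ.rename _⟩ (hyps_ok hΨ wk2)
      -- The assertion at the head, which is the second most recent variable of the induction step.
      have h₁ : HOL 𝒯 (.listAll v0 (φ.rename wk2.lift) :: hyps wk2 Ψ)
          ((φ.rename wk2.lift).at1 wk0 v1) :=
        ((HOL.gen hΨ h).rename_hyps (wk2 (α := α) (β := .list α))).weaken_cons
          (hΨ' _ List.mem_cons_self) |>.inst (t := v1) trivial rfl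
      exact (HOL.basic (φ := .iff (.listAll (.cons v1 v0) _) _)
        ⟨hΨ', Form.iff_ok
          (Form.listAll_ok (Tm.cons_ok (Tm.var_ok _) (Tm.var_ok _)) (hφ.rename _))
          (Form.and_ok h₁.wf.2 (Form.listAll_ok (Tm.var_ok _) (hφ.rename _)))⟩
        (.allCons v1 v0 _)).right.mp (h₁.and_intro (.hyp hΨ' List.mem_cons_self))
  refine h'.inst hl ?_
  rw [e, show (wk0 (Γ := Γ)).lift (β := α) = wk0 by funext β x; cases x <;> rfl, Form.rename_id]

theorem Form.rename_at2 {Δ Θ : Ctx} {α β : Ty} (φ : Form S (β :: α :: Γ)) (ξ : Ren Γ Δ)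
    (ζ : Ren Δ Θ) (t : Tm Θ α) (u : Tm Θ β) :
    (φ.rename ξ.lift.lift).at2 ζ t u = φ.at2 (ξ.comp ζ) t u := by
  simp only [Form.at2, Form.rename_eq_subst, Form.subst_subst]
  apply Form.subst_congr
  intro γ x
  rcases x with _ | _ | x <;> rfl

theorem HOL.inst2_rename {α β : Ty} {φ χ : Form S (β :: α :: Γ)}
    (h : HOL 𝒯 (φ :: hyps wk2 Ψ) χ) {Δ : Ctx} {ξ : Ren Γ Δ} {Ψ' : List (Form S Δ)}
    (hΨ' : ∀ ψ ∈ Ψ', ψ.Ok) (hs : ∀ ψ ∈ Ψ, ψ.rename ξ ∈ Ψ') {t : Tm Δ α} {u : Tm Δ β}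
    (ht : t.Ok) (hu : u.Ok) : HOL 𝒯 Ψ' (.imp (φ.at2 ξ t u) (χ.at2 ξ t u)) := by
  have h' := HOL.inst2 (h.rename ξ.lift.lift
    (cons_ok ((h.wf.1 φ List.mem_cons_self).rename ξ.lift.lift) (hyps_ok hΨ' wk2))
    (cons_subset (hyps_wk2_subset hs) rfl)) hΨ' ht hu
  rw [Form.rename_at2, Form.rename_at2] at h'
  exact h'

theorem Form.subst_listAll2 {Δ Θ : Ctx} {α β : Ty} (φ : Form S (β :: α :: Γ)) {ξ : Ren Γ Δ}
    {σ : Subst Δ Θ} {ζ : Ren Γ Θ} (h : ∀ γ (x : Var Γ γ), σ (ξ x) = .var (ζ x))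
    (t : Tm Δ (.list α)) (u : Tm Δ (.list β)) :
    (Form.listAll2 t u (φ.rename ξ.lift.lift)).subst σ =
      .listAll2 (t.subst σ) (u.subst σ) (φ.rename ζ.lift.lift) := by
  simp only [Form.subst, Form.rename_eq_subst, Form.subst_subst]
  congr 1
  apply Form.subst_congr
  intro γ x
  rcases x with _ | _ | x
  · rfl
  · rfl
  · simp [h, Ren.toSubst, Ren.lift, Tm.subst]

theorem HOL.botE' {φ : Form S Γ} (hφ : φ.Ok) (h : HOL 𝒯 Ψ .bot) : HOL 𝒯 Ψ φ :=
  .botE ⟨h.wf.1, hφ⟩ h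

/-- Induction on the first list for an assertion that quantifies over the second, followed by a case
analysis on the second. Lists of different shapes contradict the premise by the axioms for `All2`.
For two nonempty lists the premise splits into heads and tails: the heads are handled by the given
sequent and the tails by the induction hypothesis. -/
theorem HOL.listAll2_mono {α β : Ty} {φ χ : Form S (β :: α :: Γ)}
    (h : HOL 𝒯 (φ :: hyps wk2 Ψ) χ) (hΨ : ∀ ψ ∈ Ψ, ψ.Ok) {l₁ : Tm Γ (.list α)}
    {l₂ : Tm Γ (.list β)} (hl₁ : l₁.Ok) (hl₂ : l₂.Ok) :
    HOL 𝒯 Ψ (.imp (.listAll2 l₁ l₂ φ) (.listAll2 l₁ l₂ χ)) := by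
  have hφ : φ.Ok := h.wf.1 φ List.mem_cons_self
  have hχ : χ.Ok := h.wf.2
  -- The implication to prove, for arbitrary lists in an arbitrary extension of the context. The
  -- equations that follow say how this family behaves under substitution, under instantiation of
  -- the outer and of the inner quantifier, and under renaming of the quantified form.
  let F {Δ : Ctx} (ξ : Ren Γ Δ) (t : Tm Δ (.list α)) (u : Tm Δ (.list β)) : Form S Δ :=
    .imp (.listAll2 t u (φ.rename ξ.lift.lift)) (.listAll2 t u (χ.rename ξ.lift.lift))
  have hF {Δ : Ctx} {ξ : Ren Γ Δ} {t : Tm Δ (.list α)} {u : Tm Δ (.list β)} (ht : t.Ok)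
      (hu : u.Ok) : (F ξ t u).Ok := ⟨⟨ht, hu, hφ.rename _⟩, ht, hu, hχ.rename _⟩
  have eF {Δ Θ : Ctx} {ξ : Ren Γ Δ} {σ : Subst Δ Θ} (ζ : Ren Γ Θ)
      (hc : ∀ γ (x : Var Γ γ), σ (ξ x) = .var (ζ x)) (t : Tm Δ (.list α))
      (u : Tm Δ (.list β)) : (F ξ t u).subst σ = F ζ (t.subst σ) (u.subst σ) := by
    simp only [F]
    rw [← Form.subst_listAll2 φ hc, ← Form.subst_listAll2 χ hc]
    rfl
  have e {Δ : Ctx} (ξ : Ren Γ Δ) (t : Tm Δ (.list α)) :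
      (Form.all (.list β) (F wk2 v1 v0)).at1 ξ t =
        .all (.list β) (F (ξ.comp wk1) (t.rename wk1) v0) :=
    congrArg (Form.all (.list β)) (by
      rw [eF (σ := (Subst.cons t ξ.toSubst).lift) (ξ.comp wk1) fun _ _ => rfl]
      rfl)
  have e' {Δ Θ : Ctx} (ξ : Ren Γ Δ) (t : Tm Δ (.list α)) (ζ : Ren Δ Θ) (u : Tm Θ (.list β)) :
      (F (ξ.comp wk1) (t.rename wk1) v0).at1 ζ u = F (ξ.comp ζ) (t.rename ζ) u := by
    rw [Form.at1, eF (σ := Subst.cons u ζ.toSubst) (ξ.comp ζ) fun _ _ => rfl, Tm.subst_rename, Tm.rename_eq_subst]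
    rfl
  have er {Δ Θ : Ctx} (ξ : Ren Γ Δ) (t : Tm Δ (.list α)) (ζ : Ren Δ Θ) :
      (Form.all (.list β) (F (ξ.comp wk1) (t.rename wk1) v0)).rename ζ =
        .all (.list β) (F ((ξ.comp ζ).comp wk1) ((t.rename ζ).rename wk1) v0) := by
    rw [Form.rename_eq_subst]
    refine congrArg (Form.all (.list β)) ?_
    rw [eF (σ := ζ.toSubst.lift) ((ξ.comp ζ).comp wk1) fun _ _ => rfl,
      Tm.rename_wk1_subst_lift, Tm.rename_eq_subst t]
    rfl
  have h' : HOL 𝒯 Ψ (.all (.list α) (.all (.list β) (F wk2 v1 v0))) := by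
    refine .listInd ⟨hΨ, hF (Δ := _ :: _ :: Γ) trivial trivial⟩ ?_ ?_
    · rw [e]
      -- The inner list induction serves as the case analysis on the second list.
      refine .listInd ⟨hΨ, hF (Δ := _ :: Γ) trivial trivial⟩ ?_ ?_
      · rw [e']
        exact .intro (.basic ⟨cons_ok (Form.listAll2_ok trivial trivial (hφ.rename _)) hΨ,
          Form.listAll2_ok trivial trivial (hχ.rename _)⟩ (.all2Nil _))
      · rw [e', e']
        have hH := cons_ok (hF (ξ := wk0.comp (wk2 (α := β) (β := .list β))) (t := .nil)
          (u := v0) trivial trivial) (hyps_ok hΨ wk2)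
        have hA : (Form.listAll2 (α := α) (β := β) (.nil (Γ := .list β :: β :: Γ)) (.cons v1 v0)
            (φ.rename (wk0.comp wk2).lift.lift)).Ok :=
          ⟨trivial, ⟨trivial, trivial⟩, hφ.rename _⟩
        exact .intro (.botE' (Form.listAll2_ok trivial (Tm.cons_ok (Tm.var_ok _) (Tm.var_ok _))
          (hχ.rename _))
          ((HOL.basic ⟨cons_ok hA hH, Form.imp_ok (ψ := .bot) hA trivial⟩ (.all2NilCons _ _ _)).mp
            (.hyp (cons_ok hA hH) List.mem_cons_self)))
    · rw [e, e]
      have hI : (Form.all (.list β) (F ((wk2 (α := α) (β := .list α)).comp (wk1 (α := .list β)))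
          ((v0 (α := .list α)).rename wk1) v0)).Ok := hF (Δ := _ :: _ :: _ :: Γ) trivial trivial
      have hΨ' := cons_ok hI (hyps_ok hΨ wk2)
      refine .listInd ⟨hΨ', hF (Δ := _ :: _ :: _ :: Γ) ⟨trivial, trivial⟩ trivial⟩ ?_ ?_
      · rw [e']
        have hA : (Form.listAll2 (α := α) (β := β) ((Tm.cons v1 v0).rename
            (wk0 (Γ := .list α :: α :: Γ))) .nil (φ.rename (wk2.comp wk0).lift.lift)).Ok :=
          ⟨⟨trivial, trivial⟩, trivial, hφ.rename _⟩
        exact .intro (.botE' (Form.listAll2_ok (Tm.cons_ok (Tm.var_ok _) (Tm.var_ok _)) trivial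
          (hχ.rename _))
          ((HOL.basic ⟨cons_ok hA hΨ', Form.imp_ok (ψ := .bot) hA trivial⟩ (.all2ConsNil _ _ _)).mp
            (.hyp (cons_ok hA hΨ') List.mem_cons_self)))
      · rw [e', e']
        have hH := cons_ok (hF (ξ := (wk2 (α := α) (β := .list α)).comp
          (wk2 (α := β) (β := .list β))) (t := (Tm.cons v1 v0).rename wk2)
          (u := v0) ⟨trivial, trivial⟩ trivial) (hyps_ok hΨ' wk2)
        have hA : (Form.listAll2 ((Tm.cons v1 v0).rename (wk2 (α := β) (β := .list β)))
            (.cons v1 v0) (φ.rename ((wk2 (α := α) (β := .list α)).comp wk2).lift.lift)).Ok :=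
          ⟨⟨trivial, trivial⟩, ⟨trivial, trivial⟩, hφ.rename _⟩
        refine .intro ?_
        have hK := cons_ok hA hH
        have ax (ψ : Form S (β :: α :: Γ)) (hψ : ψ.Ok) : HOL 𝒯 _ _ := HOL.basic
          ⟨hK, Form.iff_ok
            (Form.listAll2_ok (Tm.cons_ok (Tm.var_ok _) (Tm.var_ok _))
              (Tm.cons_ok (Tm.var_ok _) (Tm.var_ok _)) (hψ.rename _))
            (Form.and_ok ((hψ.rename _).at2 _ (Tm.var_ok _) (Tm.var_ok _))
              (Form.listAll2_ok (Tm.var_ok _) (Tm.var_ok _) (hψ.rename _)))⟩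
          (.all2Cons v3 v1 v2 v0
            (ψ.rename ((wk2 (α := α) (β := .list α)).comp
              (wk2 (α := β) (β := .list β))).lift.lift))
        have h₁ := (ax φ hφ).left.mp (.hyp hK List.mem_cons_self)
        -- The outer induction hypothesis. It lies below the `All2` premise and the inner induction
        -- hypothesis, weakened past the head and tail of the second list.
        have hIH := HOL.hyp (𝒯 := 𝒯) hK (List.mem_cons_of_mem _ (List.mem_cons_of_mem _
          (List.mem_map_of_mem (f := fun ψ : Form S _ => ψ.rename wk2) List.mem_cons_self)))
        rw [er] at hIH
        have h₂ := (HOL.inst (t := v0) hIH trivial (e' _ _ _ _).symm).mp h₁.right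
        -- The given sequent at the two heads, with its parameters weakened past the heads and tails
        -- of both lists.
        have h₃ := (HOL.inst2_rename h (ξ := wk2.comp wk2) (t := v3) (u := v1) hK (fun ψ hψ =>
          List.mem_cons_of_mem _ (List.mem_cons_of_mem _ (by
            rw [← Form.rename_rename]
            exact List.mem_map_of_mem (List.mem_cons_of_mem _ (List.mem_map_of_mem hψ)))))
          trivial trivial).mp (by
            have := h₁.left
            rwa [Form.rename_at2] at this)
        refine (ax χ hχ).right.mp (.and_intro ?_ h₂)
        rw [Form.rename_at2]
        exact h₃
  have h'' := h'.inst hl₁ rfl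
  rw [e] at h''
  refine h''.inst hl₂ ?_
  rw [e']
  -- Instantiating the two quantifiers leaves the assertions moved along lifted identities, which
  -- are identities.
  have e₀ : ((wk0 (Γ := Γ)).comp wk0).lift.lift (β := β) = (wk0 (Γ := α :: Γ)).lift := by
    congr 1
    funext β x
    cases x <;> rfl
  have e₁ : (wk0 (Γ := α :: Γ)).lift (β := β) = wk0 := by
    funext β x
    cases x <;> rfl
  simp only [F, e₀, e₁, Form.rename_id]
  rw [Tm.rename_eq_subst, Tm.subst_id]

/-- Modus ponens for a relational arrow under an arbitrary substitution. The result is again a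
substitution instance, with the arguments added to the substitution, so the rule can be iterated on
curried functions, as list case analysis requires. -/
theorem HOL.arrow2_elim {Δ : Ctx} {Ψ : List (Form S Δ)} {τ₁ τ₂ σ₁ σ₂ : Ty}
    {φ' : Form S (τ₂ :: τ₁ :: Γ)} {φ : Form S (σ₂ :: σ₁ :: τ₂ :: τ₁ :: Γ)} {σ : Subst Γ Δ}
    {f₁ : Tm Δ (.arr τ₁ σ₁)} {f₂ : Tm Δ (.arr τ₂ σ₂)} {a₁ : Tm Δ τ₁} {a₂ : Tm Δ τ₂}
    (h : HOL 𝒯 Ψ ((φ'.arrow2 φ).subst (.cons f₂ (.cons f₁ σ)))) (ha₁ : a₁.Ok) (ha₂ : a₂.Ok)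
    (h' : HOL 𝒯 Ψ (φ'.subst (.cons a₂ (.cons a₁ σ)))) :
    HOL 𝒯 Ψ (φ.subst (.cons (.app f₂ a₂) (.cons (.app f₁ a₁) (.cons a₂ (.cons a₁ σ))))) := by
  have h₁ := (HOL.inst h ha₁ rfl).inst ha₂ rfl
  refine HOL.mp (ψ := φ'.subst (.cons a₂ (.cons a₁ σ))) ?_ h'
  convert h₁ using 1
  simp only [Form.subst, Form.at1, Form.at2, Form.rename_eq_subst, Form.subst_subst]
  congr 1 <;> apply Form.subst_congr <;> intro γ x <;> rcases x with _ | _ | x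
  on_goal 6 => rcases x with _ | _ | x
  all_goals simp [Tm.subst]

end

/-! ### Subtyping as entailment of refinements -/

theorem RSubtyping.ok {S : Signature.{u}} {𝒯 : Theory S} {γ : Ctx} {G : RCtx S γ} {α : Ty}
    {T U : RTy S (dbl γ) α} (h : RSubtyping 𝒯 G T U) : G.Ok ∧ T.Ok ∧ U.Ok := by
  induction h with
  | refl hG hT => exact ⟨hG, hT, hT⟩
  | trans _ _ ih₁ ih₂ => exact ⟨ih₁.1, ih₁.2.1, ih₂.2.2⟩
  | list _ _ ih => exact ih
  | refElim hG hT => exact ⟨hG, hT, hT.1⟩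
  | refIntro _ hφ ih => exact ⟨ih.1, ih.2.1, ih.2.2, hφ.wf.2⟩
  | pi _ _ ih₁ ih₂ => exact ⟨ih₁.1, ⟨ih₁.2.2, ih₂.2.1⟩, ih₁.2.1, ih₂.2.2⟩

/-- Subtyping entails implication of refinements. -/
theorem RSubtyping.hol {S : Signature.{u}} {𝒯 : Theory S} {γ : Ctx} {G : RCtx S γ} {α : Ty}
    {T U : RTy S (dbl γ) α} (h : RSubtyping 𝒯 G T U) :
    HOL 𝒯 (T.form :: hyps wk2 G.form) U.form := by
  induction h with
  | refl hG hT => exact .hyp (cons_ok hT.form (hyps_ok hG.form _)) List.mem_cons_self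
  -- Cut on the refinement of the intermediate type.
  | trans h₁ _ ih₁ ih₂ => exact (ih₂.intro.weaken_cons h₁.ok.2.1.form).mp ih₁
  | @list γ G α T₁ T₂ hu h ih =>
    obtain ⟨hG, hT₁, hT₂⟩ := h.ok
    have hΨ := cons_ok (RTy.Ok.form (T := T₁.list) hT₁) (hyps_ok hG.form wk2)
    -- A unary target makes the conclusion derivable outright. Otherwise the side condition rules
    -- out a unary source, both refinements are `All2` assertions, and monotonicity applies.
    by_cases h₂ : T₂.IsUnary
    · obtain ⟨τ, rfl⟩ := h₂
      have hτ : HOL 𝒯 (hyps wk1 (T₁.list.form :: hyps wk2 G.form)) τ.form := by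
        rw [← τ.form.subst_id]
        exact .unary τ (hyps_ok hΨ _) (Ren.toSubst_ok _)
      exact (HOL.listAll_intro (l := v1) hτ hΨ trivial).and_intro
        (.listAll_intro (l := v0) hτ hΨ trivial)
    · have h₁ := mt hu h₂
      rw [RTy.form_list h₁] at hΨ ⊢
      rw [RTy.form_list h₂]
      refine HOL.mp (HOL.listAll2_mono ?_ hΨ trivial trivial) (.hyp hΨ List.mem_cons_self)
      refine ih.rename wk2.lift.lift
        (cons_ok (hT₁.form.rename _) (hyps_ok hΨ wk2)) (cons_subset (fun ψ hψ => ?_) rfl)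
      exact hyps_wk2_subset (fun χ hχ => List.mem_cons_of_mem _ (List.mem_map_of_mem hχ)) ψ hψ
  | refElim hG hT => exact (HOL.hyp (cons_ok hT.form (hyps_ok hG.form _)) List.mem_cons_self).left
  -- The logical premise has exactly these hypotheses, since the refinement of the extended context
  -- is that of the new type followed by the weakened old ones.
  | refIntro _ hφ ih => exact ih.and_intro hφ
  | @pi γ G α β T₁ T₂ U₁ U₂ hT hU ih₁ ih₂ =>
    obtain ⟨hG, hT₂, hT₁⟩ := hT.ok
    obtain ⟨-, hU₁, hU₂⟩ := hU.ok
    have hΨ := cons_ok (hT₁.form.arrow2 hU₁.form) (hyps_ok hG.form wk2)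
    refine .gen hΨ (.gen (hyps_ok hΨ _) (.intro ?_))
    rw [hyps_hyps]
    have hK := cons_ok (hT₂.form.rename (wk2 (α := .arr α β) (β := .arr α β)).lift.lift)
      (hyps_ok hΨ (wk1.comp wk1))
    have hs := cons_subset (φ := T₂.form) (hyps_subset (Ψ := G.form) (ξ := wk2) (ζ := wk2)
      (ζ' := wk1.comp wk1) (ξ' := wk2.lift.lift) (fun χ hχ => List.mem_cons_of_mem
        (T₁.form.arrow2 U₁.form) (List.mem_map_of_mem hχ)) rfl) rfl
    -- The arguments satisfy the smaller domain, hence the larger one. The assumed arrow refinement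
    -- then gives the source codomain at the two applications, and the codomain entailment,
    -- instantiated there, gives the target codomain.
    have h₁ := ih₁.rename wk2.lift.lift hK hs
    have h₂ := HOL.arrow2_elim (𝒯 := 𝒯) (φ' := T₁.form) (φ := U₁.form) (σ := wk4.toSubst) (f₁ := v3)
      (f₂ := v2) (a₁ := v1) (a₂ := v0) (by
        convert HOL.hyp hK (List.mem_cons_of_mem _ (List.mem_map_of_mem List.mem_cons_self))
        rw [Form.rename_eq_subst]
        apply Form.subst_congr
        intro γ x
        rcases x with _ | _ | x <;> rfl) trivial trivial (by
        convert h₁ using 1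
        rw [Form.rename_eq_subst]
        apply Form.subst_congr
        intro γ x
        rcases x with _ | _ | x <;> rfl)
    refine (HOL.inst2_rename (t := .app v3 v1) (u := .app v2 v0) ih₂ hK hs ⟨trivial, trivial⟩
        ⟨trivial, trivial⟩).mp ?_
    convert h₂ using 1
    apply Form.subst_congr
    intro γ x
    rcases x with _ | _ | _ | _ | x <;> rfl

/-! ## Relational typing entails derivability in relational higher-order logic -/

/-- Typing rules mostly omit well-formedness conditions while the logics demand them at every step.
Here they are recovered from the premises, for the context, both terms and the type together. -/
theorem RTyping.ok {S : Signature.{u}} {𝒯 : Theory S} {γ : Ctx} {G : RCtx S γ} {α : Ty}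
    {t₁ t₂ : Tm γ α} {T : RTy S (dbl γ) α} (h : RTyping 𝒯 G t₁ t₂ T) :
    G.Ok ∧ t₁.Ok ∧ t₂.Ok ∧ T.Ok := by
  induction h with
  | var x hG => exact ⟨hG, trivial, trivial, hG.get x⟩
  | abs _ ih => exact ⟨ih.1.1, ih.2.1, ih.2.2.1, ih.1.2, ih.2.2.2⟩
  | app _ _ ih₁ ih₂ =>
    refine ⟨ih₁.1, ⟨ih₁.2.1, ih₂.2.1⟩, ⟨ih₁.2.2.1, ih₂.2.2.1⟩, ih₁.2.2.2.2.subst ?_⟩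
    exact .cons (ih₂.2.2.1.rename _) (.cons (ih₂.2.1.rename _) (Ren.toSubst_ok _))
  | tt hG => exact ⟨hG, trivial, trivial, trivial⟩
  | ff hG => exact ⟨hG, trivial, trivial, trivial⟩
  | zero hG => exact ⟨hG, trivial, trivial, trivial⟩
  | succ _ ih => exact ih
  | nil hG hT => exact ⟨hG, trivial, trivial, hT⟩
  | cons _ _ ih₁ ih₂ =>
    exact ⟨ih₁.1, ⟨ih₁.2.1, ih₂.2.1⟩, ⟨ih₁.2.2.1, ih₂.2.2.1⟩, ih₂.2.2.2⟩
  | sub _ hs ih => exact ⟨ih.1, ih.2.1, ih.2.2.1, hs.ok.2.2⟩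
  | letrec h hG hT hd₁ hd₂ _ ih => exact ⟨hG, ⟨hd₁, ih.2.1⟩, ⟨hd₂, ih.2.2.1⟩, hT⟩
  | caseBool _ _ _ _ ih ih₁ ih₂ =>
    exact ⟨ih.1, ⟨ih.2.1, ih₁.2.1, ih₂.2.1⟩, ⟨ih.2.2.1, ih₁.2.2.1, ih₂.2.2.1⟩, ih₁.2.2.2⟩
  | caseNat _ _ _ _ ih ih₁ ih₂ =>
    exact ⟨ih.1, ⟨ih.2.1, ih₁.2.1, ih₂.2.1⟩, ⟨ih.2.2.1, ih₁.2.2.1, ih₂.2.2.1⟩, ih₁.2.2.2⟩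
  | caseList _ _ _ _ ih ih₁ ih₂ =>
    exact ⟨ih.1, ⟨ih.2.1, ih₁.2.1, ih₂.2.1⟩, ⟨ih.2.2.1, ih₁.2.2.1, ih₂.2.2.1⟩, ih₁.2.2.2⟩

theorem RTyping.wfRHOL {S : Signature.{u}} {𝒯 : Theory S} {γ : Ctx} {G : RCtx S γ} {α : Ty}
    {t₁ t₂ : Tm γ α} {T : RTy S (dbl γ) α} (h : RTyping 𝒯 G t₁ t₂ T)
    {Ψ : List (Form S (dbl γ))} (hΨ : ∀ ψ ∈ Ψ, ψ.Ok) :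
    WfRHOL Ψ (t₁.rename left) (t₂.rename right) T.form :=
  ⟨hΨ, h.ok.2.1.rename _, h.ok.2.2.1.rename _, h.ok.2.2.2.form⟩

/-- Weakening the declared type and then instantiating its subject at the two copies of the variable
gives literally the assertion that the variable contributes to the refinement of the context. This
is all the variable rule asks for. -/
theorem RCtx.get_mem_form {S : Signature.{u}} {γ : Ctx} (G : RCtx S γ) {α : Ty} (x : Var γ α) :
    (G.get x).form.at2 wk0 (.var (left x)) (.var (right x)) ∈ G.form := by
  induction G with
  | nil => nomatch x
  | cons G T ih =>
    cases x with
    | zero =>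
      simp only [RCtx.get, RCtx.form, RTy.form_rename, Form.rename_at2]
      convert List.mem_cons_self using 1
      apply Form.subst_eq_self
      intro β y
      rcases y with _ | _ | y <;> rfl
    | succ x =>
      simp only [RCtx.get, RCtx.form, RTy.form_rename, Form.rename_at2]
      refine List.mem_cons_of_mem _ ?_
      refine (congrArg (· ∈ hyps wk2 G.form) ?_).mpr (List.mem_map_of_mem (ih x))
      simp only [Form.at2, Form.rename_eq_subst, Form.subst_subst]
      apply Form.subst_congr
      intro β y
      rcases y with _ | _ | y <;> rfl

/-! ### Consequence rules and introduction and elimination of list refinements -/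

section
variable {S : Signature.{u}} {𝒯 : Theory S} {Γ : Ctx} {Ψ : List (Form S Γ)}

theorem RHOL.wf {σ₁ σ₂ : Ty} {t₁ : Tm Γ σ₁} {t₂ : Tm Γ σ₂} {φ : Form S (σ₂ :: σ₁ :: Γ)}
    (h : RHOL 𝒯 Ψ t₁ t₂ φ) : WfRHOL Ψ t₁ t₂ φ := by
  cases h <;> assumption

theorem RHOL.conseq {σ₁ σ₂ : Ty} {t₁ : Tm Γ σ₁} {t₂ : Tm Γ σ₂} {φ χ : Form S (σ₂ :: σ₁ :: Γ)}
    (h : RHOL 𝒯 Ψ t₁ t₂ φ) (h' : HOL 𝒯 (φ :: hyps wk2 Ψ) χ) : RHOL 𝒯 Ψ t₁ t₂ χ :=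
  .sub ⟨h.wf.1, h.wf.2.1, h.wf.2.2.1, h'.wf.2⟩ h (h'.inst2 h.wf.1 h.wf.2.1 h.wf.2.2.1)

/-- The consequence rule needs some derivation about the two terms to start from; its postcondition
is irrelevant once the new one is already derivable in HOL. This turns the logical premises of the
case rules into RHOL judgments. -/
theorem RHOL.of_hol {σ₁ σ₂ : Ty} {t₁ : Tm Γ σ₁} {t₂ : Tm Γ σ₂} {φ χ : Form S (σ₂ :: σ₁ :: Γ)}
    (h : RHOL 𝒯 Ψ t₁ t₂ φ) (hχ : χ.Ok) (h' : HOL 𝒯 Ψ (χ.at2 wk0 t₁ t₂)) :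
    RHOL 𝒯 Ψ t₁ t₂ χ :=
  .sub ⟨h.wf.1, h.wf.2.1, h.wf.2.2.1, hχ⟩ h
    (h'.weaken_cons (h.wf.2.2.2.at2 wk0 h.wf.2.1 h.wf.2.2.1)).intro

theorem Form.eq_ok {α : Ty} {t u : Tm Γ α} (ht : t.Ok) (hu : u.Ok) :
    (Form.eq (S := S) t u).Ok := ⟨ht, hu⟩

theorem HOL.unary_form {α : Ty} (τ : UTy α) {Δ : Ctx} {σ : Subst (α :: α :: Δ) Γ}
    (hΨ : ∀ ψ ∈ Ψ, ψ.Ok) (hσ : σ.Ok) : HOL 𝒯 Ψ ((RTy.unary τ).form.subst σ) := by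
  have h {ζ : Ren Δ (α :: α :: Δ)} {x : Var (α :: α :: Δ) α} :
      HOL 𝒯 Ψ ((τ.form.at1 ζ (.var x)).subst σ) := by
    rw [Form.at1, Form.subst_subst]
    exact .unary τ hΨ fun β y =>
      Tm.Ok.subst (Subst.Ok.cons (Tm.var_ok _) (Ren.toSubst_ok _) β y) hσ
  exact h.and_intro h

theorem HOL.list_unary_form {α : Ty} (τ : UTy α) {Δ : Ctx}
    {σ : Subst (.list α :: .list α :: Δ) Γ} (hΨ : ∀ ψ ∈ Ψ, ψ.Ok) (hσ : σ.Ok) :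
    HOL 𝒯 Ψ ((RTy.list (.unary τ)).form.subst σ) := by
  have h {x : Var (.list α :: .list α :: Δ) (.list α)} :
      HOL 𝒯 Ψ ((Form.listAll (.var x) τ.form).subst σ) :=
    .listAll_intro (.unary τ (hyps_ok hΨ _) hσ.lift) hΨ (hσ _ x)
  exact h.and_intro h

theorem RTy.list_form_at2 {Δ : Ctx} {α : Ty} {T : RTy S Δ α} (hT : ¬ T.IsUnary)
    (ξ : Ren Δ Γ) (l₁ l₂ : Tm Γ (.list α)) :
    T.list.form.at2 ξ l₁ l₂ = .listAll2 l₁ l₂ (T.form.rename ξ.lift.lift) := by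
  rw [RTy.form_list hT, Form.at2, Form.subst_listAll2
    (σ := Subst.cons l₂ (Subst.cons l₁ ξ.toSubst)) (ζ := ξ) _ fun _ _ => rfl]
  rfl

theorem HOL.list_form_nil {Δ : Ctx} {α : Ty} {T : RTy S Δ α} (hT : T.Ok)
    (hΨ : ∀ ψ ∈ Ψ, ψ.Ok) (ξ : Ren Δ Γ) : HOL 𝒯 Ψ (T.list.form.at2 ξ .nil .nil) := by
  by_cases hu : T.IsUnary
  · obtain ⟨τ, rfl⟩ := hu
    exact .list_unary_form τ hΨ (.cons trivial (.cons trivial (Ren.toSubst_ok _)))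
  · rw [RTy.list_form_at2 hu]
    exact .basic ⟨hΨ, Form.listAll2_ok trivial trivial (hT.form.rename _)⟩ (.all2Nil _)

theorem HOL.list_form_cons {Δ : Ctx} {α : Ty} {T : RTy S Δ α} (hT : T.Ok) {ξ : Ren Δ Γ}
    {h₁ h₂ : Tm Γ α} {t₁ t₂ : Tm Γ (.list α)} (hh₁ : h₁.Ok) (hh₂ : h₂.Ok) (ht₁ : t₁.Ok)
    (ht₂ : t₂.Ok) (hh : HOL 𝒯 Ψ (T.form.at2 ξ h₁ h₂)) (ht : HOL 𝒯 Ψ (T.list.form.at2 ξ t₁ t₂)) :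
    HOL 𝒯 Ψ (T.list.form.at2 ξ (.cons h₁ t₁) (.cons h₂ t₂)) := by
  by_cases hu : T.IsUnary
  · obtain ⟨τ, rfl⟩ := hu
    exact .list_unary_form τ hh.wf.1
      (.cons (Tm.cons_ok hh₂ ht₂) (.cons (Tm.cons_ok hh₁ ht₁) (Ren.toSubst_ok _)))
  · rw [RTy.list_form_at2 hu] at ht ⊢
    have e := Form.rename_at2 T.form ξ wk0 h₁ h₂
    refine HOL.mp (HOL.basic ⟨hh.wf.1, Form.iff_ok (Form.listAll2_ok (Tm.cons_ok hh₁ ht₁)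
      (Tm.cons_ok hh₂ ht₂) (hT.form.rename _)) (Form.and_ok ?_ ht.wf.2)⟩
      (.all2Cons _ _ _ _ _)).right (.and_intro ?_ ht) <;> rw [e]
    · exact hh.wf.2
    · exact hh

/-- For non-unary elements this is the equivalence that defines `All2` on nonempty lists, read from
left to right. For unary elements both conclusions are derivable in any case. -/
theorem HOL.list_form_uncons {Δ : Ctx} {α : Ty} {T : RTy S Δ α} (hT : T.Ok) {ξ : Ren Δ Γ}
    {h₁ h₂ : Tm Γ α} {t₁ t₂ : Tm Γ (.list α)} (hh₁ : h₁.Ok) (hh₂ : h₂.Ok) (ht₁ : t₁.Ok)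
    (ht₂ : t₂.Ok) (h : HOL 𝒯 Ψ (T.list.form.at2 ξ (.cons h₁ t₁) (.cons h₂ t₂))) :
    HOL 𝒯 Ψ (T.form.at2 ξ h₁ h₂) ∧ HOL 𝒯 Ψ (T.list.form.at2 ξ t₁ t₂) := by
  by_cases hu : T.IsUnary
  · obtain ⟨τ, rfl⟩ := hu
    exact ⟨.unary_form τ h.wf.1 (.cons hh₂ (.cons hh₁ (Ren.toSubst_ok _))),
      .list_unary_form τ h.wf.1 (.cons ht₂ (.cons ht₁ (Ren.toSubst_ok _)))⟩
  · rw [RTy.list_form_at2 hu] at h ⊢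
    have e := Form.rename_at2 T.form ξ wk0 h₁ h₂
    have h' := HOL.mp (HOL.basic ⟨h.wf.1, Form.iff_ok h.wf.2 (Form.and_ok
      ((hT.form.rename _).at2 _ hh₁ hh₂) (Form.listAll2_ok ht₁ ht₂ (hT.form.rename _)))⟩
      (.all2Cons _ _ _ _ _)).left h
    rw [e] at h'
    exact ⟨h'.left, h'.right⟩

theorem HOL.ungen2 {α β : Ty} {φ : Form S (β :: α :: Γ)}
    (h : HOL 𝒯 Ψ (.all α (.all β φ))) : HOL 𝒯 (hyps wk2 Ψ) φ := by
  refine HOL.inst (t := v0) (HOL.inst (t := v1) (h.rename_hyps wk2) (Tm.var_ok _) rfl)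
    (Tm.var_ok _) ?_
  simp only [Form.at1, Form.rename_eq_subst, Form.subst_subst]
  refine (Form.subst_eq_self _ ?_).symm
  intro γ x
  rcases x with _ | _ | x <;> rfl

theorem hyps_derivable {Φ : List (Form S Γ)} (h : ∀ ψ ∈ Φ, HOL 𝒯 Ψ ψ) {Δ : Ctx}
    (ξ : Ren Γ Δ) : ∀ ψ ∈ hyps ξ Φ, HOL 𝒯 (hyps ξ Ψ) ψ := by
  intro ψ hψ
  obtain ⟨χ, hχ, rfl⟩ := List.mem_map.1 hψ
  exact (h χ hχ).rename_hyps ξ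

theorem cons_derivable {φ : Form S Γ} {Φ : List (Form S Γ)} (hφ : HOL 𝒯 Ψ φ)
    (h : ∀ ψ ∈ Φ, HOL 𝒯 Ψ ψ) : ∀ ψ ∈ φ :: Φ, HOL 𝒯 Ψ ψ :=
  List.forall_mem_cons.2 ⟨hφ, h⟩

/-- Every boolean is `tt` or `ff`. -/
theorem HOL.bool_cases (hΨ : ∀ ψ ∈ Ψ, ψ.Ok) {t : Tm Γ .bool} (ht : t.Ok) :
    HOL 𝒯 Ψ (.or (.eq t .tt) (.eq t .ff)) := by
  have h : HOL 𝒯 Ψ (.all .bool (.or (.eq v0 .tt) (.eq v0 .ff))) :=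
    .boolInd ⟨hΨ, ⟨trivial, trivial⟩, trivial, trivial⟩
      (.orI1 ⟨hΨ, ⟨trivial, trivial⟩, trivial, trivial⟩
        (.conv ⟨hΨ, trivial, trivial⟩ (.refl _)))
      (.orI2 ⟨hΨ, ⟨trivial, trivial⟩, trivial, trivial⟩
        (.conv ⟨hΨ, trivial, trivial⟩ (.refl _)))
  exact h.inst ht rfl

/-- The typing rule supplies an equivalence, whereas boolean case analysis in RHOL asks for a
disjunction of the two agreeing cases. The passage is a case distinction on both booleans. -/
theorem HOL.bool_agree {t₁ t₂ : Tm Γ .bool} (h : HOL 𝒯 Ψ (.iff (.eq t₁ .tt) (.eq t₂ .tt))) :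
    HOL 𝒯 Ψ (.or (.and (.eq t₁ .tt) (.eq t₂ .tt)) (.and (.eq t₁ .ff) (.eq t₂ .ff))) := by
  have h₁ : t₁.Ok := h.wf.2.1.1.1
  have h₂ : t₂.Ok := h.wf.2.1.2.1
  have wf {Φ : List (Form S Γ)} (hΦ : ∀ ψ ∈ Φ, ψ.Ok) : WfHOL Φ
      (.or (.and (.eq t₁ .tt) (.eq t₂ .tt)) (.and (.eq t₁ .ff) (.eq t₂ .ff))) :=
    ⟨hΦ, ⟨⟨h₁, trivial⟩, h₂, trivial⟩, ⟨h₁, trivial⟩, h₂, trivial⟩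
  have o₁ (b : Tm Γ .bool) (hb : b.Ok) : (Form.eq (S := S) t₁ b).Ok := ⟨h₁, hb⟩
  have o₂ (b : Tm Γ .bool) (hb : b.Ok) : (Form.eq (S := S) t₂ b).Ok := ⟨h₂, hb⟩
  have hΨ := h.wf.1
  refine .orE (wf hΨ) (.bool_cases hΨ h₁) ?_ ?_
  · have hK := cons_ok (o₁ .tt trivial) hΨ
    have a := HOL.hyp (𝒯 := 𝒯) hK List.mem_cons_self
    exact .orI1 (wf hK) (a.and_intro ((h.left.weaken_cons (o₁ .tt trivial)).mp a))
  · have hK := cons_ok (o₁ .ff trivial) hΨ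
    refine .orE (wf hK) (.bool_cases hK h₂) ?_ ?_
    -- In the disagreeing case the converse implication makes the first boolean true as well, so the
    -- first disjunct holds and no contradiction has to be derived.
    · have hL := cons_ok (o₂ .tt trivial) hK
      have a := HOL.hyp (𝒯 := 𝒯) hL List.mem_cons_self
      exact .orI1 (wf hL) (.and_intro
        (((h.right.weaken_cons (o₁ .ff trivial)).weaken_cons (o₂ .tt trivial)).mp a) a)
    · have hL := cons_ok (o₂ .ff trivial) hK
      exact .orI2 (wf hL) (.and_intro
        (.hyp hL (List.mem_cons_of_mem _ List.mem_cons_self)) (.hyp hL List.mem_cons_self))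

end

/-- The RHOL rules for binders weaken the body past the variable of the other side. Composed with
the lifted copying map, this is the copying map of the extended context, so the premise of the rule
has the form of the induction hypothesis. -/
theorem left_rename_abs {γ : Ctx} {α β : Ty} (t : Tm (α :: γ) β) :
    (t.rename left.lift).rename wk1 = t.rename left := by
  rw [Tm.rename_rename]
  congr 1
  funext δ x
  cases x <;> rfl

theorem right_rename_abs {γ : Ctx} {α β : Ty} (t : Tm (α :: γ) β) :
    (t.rename right.lift).rename wk1.lift = t.rename right := by
  rw [Tm.rename_rename]
  congr 1
  funext δ x
  cases x <;> rfl

theorem left_rename_rec {γ : Ctx} {α β δ : Ty} (t : Tm (β :: α :: γ) δ) :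
    (t.rename left.lift.lift).rename recL = t.rename left := by
  rw [Tm.rename_rename]
  congr 1
  funext δ x
  rcases x with _ | _ | x <;> rfl

theorem right_rename_rec {γ : Ctx} {α β δ : Ty} (t : Tm (β :: α :: γ) δ) :
    (t.rename right.lift.lift).rename recR = t.rename right := by
  rw [Tm.rename_rename]
  congr 1
  funext δ x
  rcases x with _ | _ | x <;> rfl

/-- Relational typing entails derivability in relational higher-order logic from any assertions
that entail the refinement of the context. -/
theorem RTyping.rhol {S : Signature.{u}} {𝒯 : Theory S} {γ : Ctx} {G : RCtx S γ} {α : Ty}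
    {t₁ t₂ : Tm γ α} {T : RTy S (dbl γ) α} (h : RTyping 𝒯 G t₁ t₂ T)
    {Ψ : List (Form S (dbl γ))} (hΨ : ∀ ψ ∈ Ψ, ψ.Ok) (hG : ∀ ψ ∈ G.form, HOL 𝒯 Ψ ψ) :
    RHOL 𝒯 Ψ (t₁.rename left) (t₂.rename right) T.form := by
  induction h with
  | @var γ G α x hG' =>
    exact .var ((RTyping.var (𝒯 := 𝒯) x hG').wfRHOL hΨ) (hG _ (G.get_mem_form x))
  | @abs γ G α β u₁ u₂ T U h ih =>
    refine .abs ((RTyping.abs h).wfRHOL hΨ) ?_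
    have hT := h.ok.1.2.form
    have hΨ' := cons_ok hT (hyps_ok hΨ wk2)
    rw [left_rename_abs, right_rename_abs]
    refine ih hΨ' (cons_derivable (.hyp hΨ' List.mem_cons_self) fun ψ hψ => ?_)
    exact (hyps_derivable hG wk2 ψ hψ).weaken_cons hT
  | @app γ G α β t₁ t₂ u₁ u₂ T U h₁ h₂ ih₁ ih₂ =>
    have wf := (RTyping.app h₁ h₂).wfRHOL hΨ
    -- The refinement of the substituted codomain becomes the substitution instance that the RHOL
    -- application rule concludes.
    rw [RTy.form_subst] at wf ⊢
    exact .app wf (ih₁ hΨ hG) (ih₂ hΨ hG)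
  | tt hG' =>
    exact .tt ((RTyping.tt (𝒯 := 𝒯) hG').wfRHOL hΨ)
      (.unary_form .bool hΨ (.cons trivial (.cons trivial (Ren.toSubst_ok _))))
  | ff hG' =>
    exact .ff ((RTyping.ff (𝒯 := 𝒯) hG').wfRHOL hΨ)
      (.unary_form .bool hΨ (.cons trivial (.cons trivial (Ren.toSubst_ok _))))
  | zero hG' =>
    exact .zero ((RTyping.zero (𝒯 := 𝒯) hG').wfRHOL hΨ)
      (.unary_form .nat hΨ (.cons trivial (.cons trivial (Ren.toSubst_ok _))))
  | @succ γ G t₁ t₂ h ih =>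
    have hK := cons_ok (RTy.Ok.form (S := S) (T := .unary (Δ := dbl γ) .nat) trivial)
      (hyps_ok (hyps_ok hΨ wk1) wk1)
    exact .succ ((RTyping.succ h).wfRHOL hΨ) (ih hΨ hG) (.gen hΨ (.gen (hyps_ok hΨ _)
      (.intro (.unary_form .nat hK (.cons (Tm.var_ok .zero)
        (.cons (Tm.var_ok (.succ .zero)) (Ren.toSubst_ok _)))))))
  | nil hG' hT => exact .nil ((RTyping.nil (𝒯 := 𝒯) hG' hT).wfRHOL hΨ) (.list_form_nil hT hΨ wk0)
  | @cons γ G α h₁ h₂ t₁ t₂ T hh ht ihh iht =>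
    have hT := hh.ok.2.2.2
    refine .cons ((RTyping.cons hh ht).wfRHOL hΨ) (ihh hΨ hG) (iht hΨ hG)
      (.gen hΨ (.gen (hyps_ok hΨ _) (.gen (hyps_ok (hyps_ok hΨ _) _)
        (.gen (hyps_ok (hyps_ok (hyps_ok hΨ _) _) _) (.intro (.intro ?_))))))
    have hK := cons_ok ((RTy.Ok.form (T := T.list) hT).at2 wk4 (Tm.var_ok (.succ .zero))
      (Tm.var_ok .zero)) (cons_ok (hT.form.at2 (wk4 (γ := .list α) (δ := .list α))
      (Tm.var_ok (.succ (.succ (.succ .zero)))) (Tm.var_ok (.succ (.succ .zero))))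
      (hyps_ok (hyps_ok (hyps_ok (hyps_ok hΨ wk1) wk1) wk1) wk1))
    exact .list_form_cons hT (Tm.var_ok _) (Tm.var_ok _) (Tm.var_ok _) (Tm.var_ok _)
      (.hyp hK (List.mem_cons_of_mem _ List.mem_cons_self)) (.hyp hK List.mem_cons_self)
  | sub h hs ih =>
    -- Subtyping yields an entailment from the refinement of the context; the cut replaces that
    -- refinement by the present hypotheses.
    exact (ih hΨ hG).conseq (hs.hol.cut
      (cons_ok h.ok.2.2.2.form (hyps_ok hΨ wk2))
      (cons_derivable (.hyp (cons_ok h.ok.2.2.2.form (hyps_ok hΨ wk2)) List.mem_cons_self)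
        fun ψ hψ => (hyps_derivable hG wk2 ψ hψ).weaken_cons h.ok.2.2.2.form))
  | @letrec γ G α β h e₁ e₂ T U hG' hT hd₁ hd₂ he ih =>
    refine .letrec ((RTyping.letrec h hG' hT hd₁ hd₂ he).wfRHOL hΨ) (hd₁.rename left)
      (hd₂.rename right) ?_
    rw [left_rename_rec, right_rename_rec]
    -- The hypothesis that the RHOL rule grants about recursive calls: two successive implications,
    -- from the size bound and from the domain refinement.
    set H : Form S (.arr α β :: .arr α β :: α :: α :: dbl γ) :=
      .all α (.all α (.imp (.sizeLt2 h h v1 v0 v5 v4)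
        (.imp (T.form.rename wk4.lift.lift) (U.form.at2 wk4.lift.lift (.app v3 v1) (.app v2 v0)))))
    have hsz {Δ : Ctx} {x₁ x₂ x₃ x₄ : Var Δ α} :
        (Form.sizeLt2 (S := S) h h (.var x₁) (.var x₂) (.var x₃) (.var x₄)).Ok :=
      ⟨⟨trivial, trivial⟩, ⟨trivial, trivial⟩, ⟨trivial, trivial⟩, trivial, trivial⟩
    have hH : H.Ok := Form.imp_ok hsz (Form.imp_ok (hT.1.form.rename _)
      (hT.2.form.at2 _ (Tm.app_ok (Tm.var_ok _) (Tm.var_ok _))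
        (Tm.app_ok (Tm.var_ok _) (Tm.var_ok _))))
    have hK := cons_ok hH (cons_ok (hT.1.form.rename wk2) (hyps_ok hΨ wk4))
    -- The new hypotheses have to derive the refinement of the context extended by the argument and
    -- the recursive variable. For the recursive variable, the conjunction in its domain is split
    -- and fed to the curried hypothesis; its argument and the older variables are obtained by
    -- weakening.
    refine Eq.subst (motive := fun φ => RHOL 𝒯 _ _ _ φ) (RTy.form_rename U wk2)
      (ih hK (cons_derivable ?_ (fun ψ hψ => ?_)))
    · have hF : ((RTy.ref (T.rename wk2) (.sizeLt2 h h v1 v0 v3 v2)).form.rename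
          (wk2 (Γ := α :: α :: dbl γ) (α := .arr α β) (β := .arr α β)).lift.lift).Ok :=
        Form.Ok.rename (Form.and_ok (hT.1.rename _).form hsz) _
      refine .gen hK (.gen (hyps_ok hK _) (.intro ?_))
      rw [hyps_hyps]
      change HOL 𝒯 (_ :: hyps wk2 _) _
      have hL := cons_ok hF (hyps_ok hK wk2)
      have a := HOL.hyp (𝒯 := 𝒯) hL List.mem_cons_self
      -- The curried hypothesis at the two bound arguments: the right conjunct of the domain
      -- supplies the size bound and the left one the refinement.
      have b := (HOL.ungen2 (HOL.hyp (𝒯 := 𝒯) hK List.mem_cons_self)).weaken_cons hF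
      convert (b.mp a.right).mp ?_ using 1
      · rw [RTy.form_rename, Form.rename_at2]
        congr 1
        funext δ x
        rcases x with _ | _ | x <;> rfl
      · convert a.left using 1
        rw [RTy.form_rename, Form.rename_rename]
        congr 1
        funext δ x
        rcases x with _ | _ | x <;> rfl
    · refine HOL.weaken_cons ?_ hH
      obtain ⟨χ, hχ, rfl⟩ := List.mem_map.1 hψ
      rcases List.mem_cons.1 hχ with rfl | hχ
      · exact .hyp (cons_ok (hT.1.form.rename wk2) (hyps_ok hΨ wk4)) List.mem_cons_self
      · refine HOL.weaken_cons ?_ (hT.1.form.rename wk2)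
        have := hyps_derivable (hyps_derivable hG wk2)
          (wk2 (α := .arr α β) (β := .arr α β)) _ (List.mem_map_of_mem hχ)
        rwa [hyps_hyps] at this
  | @caseBool γ G β t₁ t₂ u₁ u₂ v₁ v₂ U ht hiff hu hv iht ihu ihv =>
    have o₁ (b : Tm (dbl γ) .bool) (hb : b.Ok) : (Form.eq (S := S) (t₁.rename left) b).Ok :=
      ⟨ht.ok.2.1.rename _, hb⟩
    have o₂ (b : Tm (dbl γ) .bool) (hb : b.Ok) : (Form.eq (S := S) (t₂.rename right) b).Ok :=
      ⟨ht.ok.2.2.1.rename _, hb⟩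
    have hK (b : Tm (dbl γ) .bool) (hb : b.Ok) := cons_ok (o₂ b hb) (cons_ok (o₁ b hb) hΨ)
    refine .boolCase ((RTyping.caseBool ht hiff hu hv).wfRHOL hΨ)
      ((iht hΨ hG).of_hol ⟨⟨⟨trivial, trivial⟩, trivial, trivial⟩, ⟨trivial, trivial⟩,
        trivial, trivial⟩ (HOL.bool_agree (hiff.cut hΨ hG)))
      (ihu (hK .tt trivial) fun ψ hψ => ?_) (ihv (hK .ff trivial) fun ψ hψ => ?_)
    · exact ((hG ψ hψ).weaken_cons (o₁ .tt trivial)).weaken_cons (o₂ .tt trivial)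
    · exact ((hG ψ hψ).weaken_cons (o₁ .ff trivial)).weaken_cons (o₂ .ff trivial)
  | @caseNat γ G β t₁ t₂ u₁ u₂ v₁ v₂ U ht hiff hu hv iht ihu ihv =>
    have ht₁ := ht.ok.2.1.rename left
    have ht₂ := ht.ok.2.2.1.rename right
    have o₁ : (Form.eq (S := S) (t₁.rename left) .zero).Ok := ⟨ht₁, trivial⟩
    have o₂ : (Form.eq (S := S) (t₂.rename right) .zero).Ok := ⟨ht₂, trivial⟩
    refine .natCase ((RTyping.caseNat ht hiff hu hv).wfRHOL hΨ)
      ((iht hΨ hG).of_hol ⟨⟨⟨trivial, trivial⟩, trivial, trivial⟩, ⟨trivial, trivial⟩,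
        trivial, trivial⟩ (hiff.cut hΨ hG))
      (ihu (cons_ok o₂ (cons_ok o₁ hΨ)) fun ψ hψ => ((hG ψ hψ).weaken_cons o₁).weaken_cons o₂)
      ((ihv hΨ hG).conseq ?_)
    have hK := cons_ok hv.ok.2.2.2.form (hyps_ok hΨ wk2)
    refine .gen hK (.gen (hyps_ok hK _) (.intro (.intro ?_)))
    rw [hyps_hyps]
    have p₁ : (Form.eq (S := S) ((t₁.rename left).rename
        (wk4 (α := .arr .nat β) (β := .arr .nat β) (γ := .nat) (δ := .nat))) (.succ v1)).Ok := Form.eq_ok (ht₁.rename _) trivial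
    have p₂ : (Form.eq (S := S) ((t₂.rename right).rename
        (wk4 (α := .arr .nat β) (β := .arr .nat β) (γ := .nat) (δ := .nat))) (.succ v0)).Ok := Form.eq_ok (ht₂.rename _) trivial
    have hL := cons_ok p₂ (cons_ok p₁ (hyps_ok hK (wk1.comp wk1)))
    -- The branch is a function on all pairs of numbers, so the equations for the predecessors are
    -- not needed: the unary domain is derivable for any two arguments.
    have h₂ := HOL.arrow2_elim (𝒯 := 𝒯) (φ' := (RTy.unary .nat).form)
      (φ := (U.rename wk2).form) (σ := wk4.toSubst) (f₁ := v3)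
      (f₂ := v2) (a₁ := v1) (a₂ := v0) (by
        convert HOL.hyp hL (List.mem_cons_of_mem _ (List.mem_cons_of_mem _
          (List.mem_map_of_mem List.mem_cons_self)))
        rw [Form.rename_eq_subst]
        apply Form.subst_congr
        intro γ x
        rcases x with _ | _ | x <;> rfl) (Tm.var_ok _) (Tm.var_ok _)
      (.unary_form .nat hL (.cons (Tm.var_ok _) (.cons (Tm.var_ok _) (Ren.toSubst_ok _))))
    convert h₂ using 1
    rw [RTy.form_rename, Form.rename_eq_subst, Form.subst_subst]
    apply Form.subst_congr
    intro γ x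
    rcases x with _ | _ | x <;> rfl
  | @caseList γ G α β t₁ t₂ u₁ u₂ v₁ v₂ T U ht hiff hu hv iht ihu ihv =>
    have hT : T.Ok := ht.ok.2.2.2
    have o : (T.list.form.at2 wk0 .nil .nil).Ok :=
      (RTy.Ok.form (T := T.list) hT).at2 wk0 trivial trivial
    have hiff' : (Form.iff (S := S) (Γ := .list α :: .list α :: dbl γ)
        (.eq v1 .nil) (.eq v0 .nil)).Ok :=
      ⟨⟨⟨trivial, trivial⟩, trivial, trivial⟩, ⟨trivial, trivial⟩, trivial, trivial⟩
    have wf := ht.wfRHOL hΨ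
    -- The rule that carries an assertion about the scrutinees is the suitable one: with the list
    -- refinement as this assertion, the nonempty branch learns that heads and tails are related,
    -- which is what its typing requires.
    refine .listCaseStar (φ' := T.list.form) ((RTyping.caseList ht hiff hu hv).wfRHOL hΨ)
      (.andI ⟨hΨ, wf.2.1, wf.2.2.1, Form.and_ok wf.2.2.2 hiff'⟩ (iht hΨ hG)
        ((iht hΨ hG).of_hol hiff' (hiff.cut hΨ hG)))
      (ihu (cons_ok o hΨ) fun ψ hψ => (hG ψ hψ).weaken_cons o) ((ihv hΨ hG).conseq ?_)
    have hK := cons_ok hv.ok.2.2.2.form (hyps_ok hΨ wk2)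
    refine .gen hK (.gen (hyps_ok hK _) (.gen (hyps_ok (hyps_ok hK _) _)
      (.gen (hyps_ok (hyps_ok (hyps_ok hK _) _) _) (.intro ?_))))
    rw [hyps_hyps, hyps_hyps, hyps_hyps]
    have p : (T.list.form.at2 (wk6 (α := .arr α (.arr (.list α) β))
        (β := .arr α (.arr (.list α) β))) (.cons v3 v1) (.cons v2 v0)).Ok :=
      (RTy.Ok.form (T := T.list) hT).at2 _ (Tm.cons_ok (Tm.var_ok _) (Tm.var_ok _))
        (Tm.cons_ok (Tm.var_ok _) (Tm.var_ok _))
    have hL := cons_ok p (hyps_ok hK (wk1.comp (wk1.comp (wk1.comp wk1))))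
    obtain ⟨hh, htl⟩ := HOL.list_form_uncons (𝒯 := 𝒯) hT (Tm.var_ok _) (Tm.var_ok _)
      (Tm.var_ok _) (Tm.var_ok _) (HOL.hyp hL List.mem_cons_self)
    have h₁ := HOL.arrow2_elim (𝒯 := 𝒯) (φ' := T.form)
      (φ := (RTy.pi (.list (T.rename wk2)) (U.rename wk4)).form) (σ := wk6.toSubst) (f₁ := v5)
      (f₂ := v4) (a₁ := v3) (a₂ := v2) (by
        convert HOL.hyp hL (List.mem_cons_of_mem _ (List.mem_map_of_mem List.mem_cons_self))
        rw [Form.rename_eq_subst]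
        apply Form.subst_congr
        intro γ x
        rcases x with _ | _ | x <;> rfl) (Tm.var_ok _) (Tm.var_ok _) hh
    -- Second application of the curried branch, now to the two tails. The codomain does not mention
    -- head and tail, so only the weakened result type remains to be identified.
    have h₂ := HOL.arrow2_elim h₁ (a₁ := v1) (a₂ := v0) (Tm.var_ok _) (Tm.var_ok _) (by
      convert htl using 1
      rw [show RTy.list (T.rename wk2) = T.list.rename wk2 from rfl, RTy.form_rename,
        Form.rename_eq_subst, Form.subst_subst]
      apply Form.subst_congr
      intro γ x
      rcases x with _ | _ | x <;> rfl)
    convert h₂ using 1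
    rw [RTy.form_rename, Form.rename_eq_subst, Form.subst_subst]
    apply Form.subst_congr
    intro γ x
    rcases x with _ | _ | x <;> rfl

/-! ## Soundness of the set-theoretic interpretation -/

/-- A well-defined recursive definition has a solution. -/
theorem WDef.den_letrec {Γ : Ctx} {α β : Ty} {e : Tm (.arr α β :: α :: Γ) β} (he : WDef e)
    (h : Ind α) (ρ : Env Γ) (v : α.den) :
    (Tm.letrec h e).den ρ v = e.den ((ρ.cons v).cons (α := .arr α β) ((Tm.letrec h e).den ρ)) := by
  have hex : ∃ F : α.den → β.den, ∀ v, F v = e.den ((ρ.cons v).cons (α := .arr α β) F) := by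
    classical
    have hwf : WellFounded fun m v : α.den => α.size m < α.size v := (measure α.size).wf
    -- Values at arguments that are not smaller are filled in with a default point. Well-definedness
    -- says that the body cannot see them, so the default may be replaced by the function itself.
    refine ⟨hwf.fix fun v F => e.den ((ρ.cons v).cons (α := .arr α β)
      fun m => if hm : α.size m < α.size v then F m hm else β.point), fun v => ?_⟩
    rw [hwf.fix_eq]
    apply he
    intro m hm
    rw [dif_pos hm]
  simp only [Tm.den]
  exact Classical.epsilon_spec hex v

theorem Step.den {Γ : Ctx} {α : Ty} {t t' : Tm Γ α} (h : Step t t') (ρ : Env Γ) :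
    t.den ρ = t'.den ρ := by
  induction h with
  | beta t u =>
    rw [Tm.den_subst, Subst.one, Env.eval_cons]
    rfl
  | mu h e u hd _ =>
    rw [Tm.den_subst, Subst.two, Env.eval_cons, Env.eval_cons]
    exact hd.den_letrec h ρ _
  | _ => simp only [Tm.den, *]

theorem Conv.den {Γ : Ctx} {α : Ty} {t t' : Tm Γ α} (h : Conv t t') (ρ : Env Γ) :
    t.den ρ = t'.den ρ := by
  induction h with
  | rel t t' h => exact h.den ρ
  | refl t => rfl
  | symm t t' _ ih => exact ih.symm
  | trans t t' t'' _ _ ih₁ ih₂ => exact ih₁.trans ih₂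

theorem Env.pull_wk0 {Γ : Ctx} (ρ : Env Γ) : ρ.pull wk0 = ρ := rfl

theorem BasicAx.sound {S : Signature.{u}} (M : Interp S) {Γ : Ctx} {φ : Form S Γ}
    (h : BasicAx φ) (ρ : Env Γ) : φ.den M ρ := by
  cases h <;> simp [Form.iff, Form.den, Tm.den, Ty.size, Form.den_at1, Form.den_at2,
    Env.pull_wk0]

/-- Induction on derivations. Conversion is sound because each reduction step preserves denotations,
and the induction principles hold because types denote the standard lists, numbers and booleans. -/
theorem HOL.sound {S : Signature.{u}} {𝒯 : Theory S} (M : Interp S)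
    (hM : ∀ φ ∈ 𝒯.ax, φ.den M Env.nil) {Γ : Ctx} {Ψ : List (Form S Γ)} {φ : Form S Γ}
    (h : HOL 𝒯 Ψ φ) (ρ : Env Γ) (hρ : ∀ ψ ∈ Ψ, ψ.den M ρ) : φ.den M ρ := by
  have hh {Γ Δ : Ctx} {Ψ : List (Form S Γ)} {ρ : Env Δ} {ξ : Ren Γ Δ}
      (h : ∀ ψ ∈ Ψ, ψ.den M (ρ.pull ξ)) : ∀ ψ ∈ hyps ξ Ψ, ψ.den M ρ := by
    intro ψ hψ
    obtain ⟨χ, hχ, rfl⟩ := List.mem_map.1 hψ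
    exact (χ.den_rename M ξ ρ).2 (h χ hχ)
  induction h with
  | ax _ h => exact hρ _ h
  | theory _ h =>
    rw [Form.den_rename]
    convert hM _ h
    funext α x
    nomatch x
  | basic _ h => exact h.sound M ρ
  | conv _ h => exact h.den ρ
  | subst φ _ _ _ _ ih₁ ih₂ =>
    have h₁ := ih₁ ρ hρ
    have h₂ : _ = _ := ih₂ ρ hρ
    rw [Form.den_at1] at h₁ ⊢
    rwa [← h₂]
  | impI _ _ ih => exact fun h => ih ρ (List.forall_mem_cons.2 ⟨h, hρ⟩)
  | impE _ _ _ ih₁ ih₂ => exact ih₁ ρ hρ (ih₂ ρ hρ)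
  | allI _ _ ih => exact fun v => ih _ (hh hρ)
  | allE t _ _ _ ih =>
    rw [Form.den_at1]
    exact ih ρ hρ _
  | exI t _ _ _ ih => exact ⟨t.den ρ, (Form.den_at1 M _ wk0 t ρ).1 (ih ρ hρ)⟩
  | @exE Γ Ψ α φ χ _ _ _ ih₁ ih₂ =>
    obtain ⟨v, hv⟩ := ih₁ ρ hρ
    exact (Form.den_rename M χ wk1 (ρ.cons v)).1 (ih₂ (ρ.cons v) (List.forall_mem_cons.2 ⟨hv, hh hρ⟩))
  | topI _ => trivial
  | botE _ _ ih => exact (ih ρ hρ).elim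
  | andI _ _ _ ih₁ ih₂ => exact ⟨ih₁ ρ hρ, ih₂ ρ hρ⟩
  | andE1 _ _ ih => exact (ih ρ hρ).1
  | andE2 _ _ ih => exact (ih ρ hρ).2
  | orI1 _ _ ih => exact .inl (ih ρ hρ)
  | orI2 _ _ ih => exact .inr (ih ρ hρ)
  | orE _ _ _ _ ih ih₁ ih₂ =>
    rcases ih ρ hρ with h | h
    · exact ih₁ ρ (List.forall_mem_cons.2 ⟨h, hρ⟩)
    · exact ih₂ ρ (List.forall_mem_cons.2 ⟨h, hρ⟩)
  | @listInd Γ Ψ α φ _ _ _ ih₁ ih₂ =>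
    intro l
    change List α.den at l
    induction l with
    | nil => exact (Form.den_at1 M _ _ _ _).1 (ih₁ ρ hρ)
    | cons a l ih =>
      have := ih₂ (Env.cons (α := .list α) l (ρ.cons a)) (List.forall_mem_cons.2
        ⟨(Form.den_at1 M _ _ _ _).2 ih, hh hρ⟩)
      exact (Form.den_at1 M _ _ _ _).1 this
  | @natInd Γ Ψ φ _ _ _ ih₁ ih₂ =>
    intro n
    change ℕ at n
    induction n with
    | zero => exact (Form.den_at1 M _ _ _ _).1 (ih₁ ρ hρ)
    | succ n ih =>
      exact (Form.den_at1 M _ _ _ _).1 (ih₂ (Env.cons (α := .nat) n ρ)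
        (List.forall_mem_cons.2 ⟨ih, hh hρ⟩))
  | boolInd _ _ _ ih₁ ih₂ =>
    intro b
    change Bool at b
    cases b with
    | true => exact (Form.den_at1 M _ _ _ _).1 (ih₁ ρ hρ)
    | false => exact (Form.den_at1 M _ _ _ _).1 (ih₂ ρ hρ)
  | cons1 _ _ ih => exact (List.cons.inj (ih ρ hρ)).1
  | cons2 _ _ ih => exact (List.cons.inj (ih ρ hρ)).2
  | succ1 _ _ ih => exact Nat.succ.inj (ih ρ hρ)
  | @strongInd Γ Ψ α h φ _ _ ih =>
    intro v
    -- Strong induction is well-founded induction along the size measure.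
    induction v using (measure α.size).wf.induction with
    | _ v ihv =>
      refine ih (ρ.cons v) (List.forall_mem_cons.2 ⟨fun w hw => ?_, hh hρ⟩)
      exact (Form.den_at1 M _ _ _ _).2 (ihv w hw)

/-! ## Interpretation of refinement types -/

/-- The semantic counterpart of `HOL.unary`: it explains why unary types, and lists over them, are
interpreted by the full relation. -/
theorem UTy.den_form {S : Signature.{u}} (M : Interp S) {α : Ty} (τ : UTy α) {Γ : Ctx}
    (ρ : Env (α :: Γ)) : (τ.form (S := S)).den M ρ := by
  induction τ generalizing Γ with
  | bool => trivial
  | nat => trivial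
  | arr τ σ _ ih => exact fun v _ => (Form.den_subst M _ _ _).2 (ih _)

theorem RTy.den_list {S : Signature.{u}} (M : Interp S) {Δ : Ctx} {α : Ty} {T : RTy S Δ α}
    (hT : ¬ T.IsUnary) (θ : Env Δ) (l₁ l₂ : List α.den) :
    T.list.den M θ l₁ l₂ ↔ List.Forall₂ (fun v₁ v₂ => T.den M θ v₁ v₂) l₁ l₂ := by
  cases T with
  | unary τ => exact (hT ⟨τ, rfl⟩).elim
  | _ => rfl

/-- The interpretation of a refinement type is that of its refinement. -/
theorem RTy.den_form {S : Signature.{u}} (M : Interp S) {Δ : Ctx} {α : Ty} (T : RTy S Δ α)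
    (θ : Env Δ) (v₁ v₂ : α.den) :
    T.form.den M ((θ.cons v₁).cons v₂) ↔ T.den M θ v₁ v₂ := by
  induction T with
  | unary τ =>
    exact ⟨fun _ => trivial, fun _ => ⟨(Form.den_subst M _ _ _).2 (τ.den_form M _),
      (Form.den_subst M _ _ _).2 (τ.den_form M _)⟩⟩
  | list T ih =>
    by_cases hT : T.IsUnary
    · obtain ⟨τ, rfl⟩ := hT
      exact ⟨fun _ => trivial, fun _ => ⟨fun _ _ => τ.den_form M _, fun _ _ => τ.den_form M _⟩⟩
    · rw [RTy.den_list M hT, RTy.form_list hT]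
      simp only [Form.den, Form.den_rename, Env.pull_lift]
      refine iff_of_eq (congrArg (fun R => List.Forall₂ R v₁ v₂) ?_)
      funext w₁ w₂
      exact propext (ih θ w₁ w₂)
  | pi T U ih₁ ih₂ =>
    simp only [RTy.form, Form.arrow2, Form.den, Form.den_rename, Form.den_at2, Env.pull_lift,
      RTy.den]
    exact forall₂_congr fun w₁ w₂ => imp_congr (ih₁ θ w₁ w₂) (ih₂ _ _ _)
  | ref T φ ih => exact and_congr (ih θ v₁ v₂) Iff.rfl

theorem RCtx.models_form {S : Signature.{u}} (M : Interp S) {γ : Ctx} (G : RCtx S γ)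
    {θ : Env (dbl γ)} (h : G.Models M θ) : ∀ ψ ∈ G.form, ψ.den M θ := by
  induction G with
  | nil => exact fun _ h => nomatch h
  | cons G T ih =>
    intro ψ hψ
    rcases List.mem_cons.1 hψ with rfl | hψ
    · convert (RTy.den_form M T _ _ _).2 h.2
      funext α x
      rcases x with _ | _ | x <;> rfl
    · obtain ⟨χ, hχ, rfl⟩ := List.mem_map.1 hψ
      exact (Form.den_rename M χ wk2 θ).2 (ih h.1 χ hχ)

/-- No new induction is needed: the interpretation is that of the refinement, and refinements
commute with substitution both syntactically and semantically. -/
theorem RTy.den_subst {S : Signature.{u}} (M : Interp S) {Γ Δ : Ctx} {α : Ty} (T : RTy S Γ α)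
    (σ : Subst Γ Δ) (θ : Env Δ) (v₁ v₂ : α.den) :
    (T.subst σ).den M θ v₁ v₂ ↔ T.den M (θ.eval σ) v₁ v₂ := by
  rw [← RTy.den_form, ← RTy.den_form, RTy.form_subst, Form.den_subst, Env.eval_lift,
    Env.eval_lift]

theorem RTy.den_rename {S : Signature.{u}} (M : Interp S) {Γ Δ : Ctx} {α : Ty} (T : RTy S Γ α)
    (ξ : Ren Γ Δ) (θ : Env Δ) (v₁ v₂ : α.den) :
    (T.rename ξ).den M θ v₁ v₂ ↔ T.den M (θ.pull ξ) v₁ v₂ := by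
  rw [RTy.rename_eq_subst, RTy.den_subst, Env.eval_toSubst]

/-! ### Semantic soundness of subtyping and typing -/

theorem RCtx.models_get {S : Signature.{u}} (M : Interp S) {γ : Ctx} (G : RCtx S γ)
    {θ : Env (dbl γ)} (h : G.Models M θ) {α : Ty} (x : Var γ α) :
    (G.get x).den M θ (θ (left x)) (θ (right x)) := by
  induction G with
  | nil => nomatch x
  | cons G T ih =>
    cases x with
    | zero => exact (RTy.den_rename M T wk2 θ _ _).2 h.2
    | succ x => exact (RTy.den_rename M _ wk2 θ _ _).2 (ih h.1 x)

/-- Obtained by interpreting the HOL derivation attached to the subtyping, and not by a second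
induction on subtyping. -/
theorem RSubtyping.sound {S : Signature.{u}} {𝒯 : Theory S} (M : Interp S)
    (hM : ∀ φ ∈ 𝒯.ax, φ.den M Env.nil) {γ : Ctx} {G : RCtx S γ} {α : Ty}
    {T U : RTy S (dbl γ) α} (h : RSubtyping 𝒯 G T U) {θ : Env (dbl γ)} (hθ : G.Models M θ)
    {v₁ v₂ : α.den} (hv : T.den M θ v₁ v₂) : U.den M θ v₁ v₂ := by
  rw [← RTy.den_form]
  refine h.hol.sound M hM _ (List.forall_mem_cons.2 ⟨(RTy.den_form M T θ v₁ v₂).2 hv, ?_⟩)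
  intro ψ hψ
  obtain ⟨χ, hχ, rfl⟩ := List.mem_map.1 hψ
  exact (Form.den_rename M χ wk2 _).2 (G.models_form M hθ χ hχ)

theorem Env.pull_left_cons {γ : Ctx} {α : Ty} (θ : Env (dbl γ)) (v₁ v₂ : α.den) :
    ((θ.cons v₁).cons v₂).pull (left (γ := α :: γ)) = (θ.pull left).cons v₁ := by
  funext β x
  cases x <;> rfl

theorem Env.pull_right_cons {γ : Ctx} {α : Ty} (θ : Env (dbl γ)) (v₁ v₂ : α.den) :
    ((θ.cons v₁).cons v₂).pull (right (γ := α :: γ)) = (θ.pull right).cons v₂ := by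
  funext β x
  cases x <;> rfl

/-- Soundness of relational typing. -/
theorem RTyping.sound {S : Signature.{u}} {𝒯 : Theory S} (M : Interp S)
    (hM : ∀ φ ∈ 𝒯.ax, φ.den M Env.nil) {γ : Ctx} {G : RCtx S γ} {α : Ty} {t₁ t₂ : Tm γ α}
    {T : RTy S (dbl γ) α} (h : RTyping 𝒯 G t₁ t₂ T) {θ : Env (dbl γ)} (hθ : G.Models M θ) :
    T.den M θ (t₁.den (θ.pull left)) (t₂.den (θ.pull right)) := by
  induction h with
  | @var γ G α x _ => exact G.models_get M hθ x
  | @abs γ G α β u₁ u₂ T U _ ih =>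
    intro v₁ v₂ hv
    have := ih (θ := (θ.cons v₁).cons v₂) ⟨hθ, hv⟩
    rwa [Env.pull_left_cons, Env.pull_right_cons] at this
  | app _ _ ih₁ ih₂ =>
    rw [RTy.den_subst, Subst.two, Env.eval_cons, Env.eval_cons, Tm.den_rename, Tm.den_rename]
    exact ih₁ hθ _ _ (ih₂ hθ)
  | tt _ => trivial
  | ff _ => trivial
  | zero _ => trivial
  | succ _ _ => trivial
  | @nil γ G α T _ _ =>
    by_cases hT : T.IsUnary
    · obtain ⟨τ, rfl⟩ := hT
      trivial
    · exact (RTy.den_list M hT _ _ _).2 .nil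
  | @cons γ G α h₁ h₂ t₁ t₂ T _ _ ih₁ ih₂ =>
    by_cases hT : T.IsUnary
    · obtain ⟨τ, rfl⟩ := hT
      trivial
    · exact (RTy.den_list M hT _ _ _).2 (.cons (ih₁ hθ) ((RTy.den_list M hT _ _ _).1 (ih₂ hθ)))
  | sub _ hs ih => exact hs.sound M hM hθ (ih hθ)
  | @letrec γ G α β h e₁ e₂ T U _ _ hd₁ hd₂ _ ih =>
    -- The componentwise order on pairs of sizes, with one strict component, strictly decreases
    -- their sum, so strong induction on the sum covers every admitted recursive call.
    have key (n : ℕ) : ∀ v₁ v₂ : α.den, α.size v₁ + α.size v₂ = n → T.den M θ v₁ v₂ →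
        U.den M ((θ.cons v₁).cons v₂) ((Tm.letrec h e₁).den (θ.pull left) v₁)
          ((Tm.letrec h e₂).den (θ.pull right) v₂) := by
      induction n using Nat.strong_induction_on with
      | _ n ihn =>
        rintro v₁ v₂ hn hv
        rw [hd₁.den_letrec, hd₂.den_letrec]
        -- After unfolding both definitions once, the recursive variables are valued by the
        -- definitions themselves. Such a valuation models the context because the induction
        -- hypothesis relates them at smaller pairs of related arguments.
        have := ih (θ := Env.cons (α := .arr α β) ((Tm.letrec h e₂).den (θ.pull right))
          (Env.cons (α := .arr α β) ((Tm.letrec h e₁).den (θ.pull left))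
            ((θ.cons v₁).cons v₂))) ⟨⟨hθ, hv⟩, ?_⟩
        · rw [RTy.den_rename, Env.pull_left_cons, Env.pull_right_cons, Env.pull_left_cons,
            Env.pull_right_cons] at this
          exact this
        · rintro w₁ w₂ ⟨hw, h₁, h₂, h₃⟩
          rw [RTy.den_rename] at hw ⊢
          rw [Env.pull_lift, Env.pull_lift]
          refine ihn (α.size w₁ + α.size w₂) ?_ w₁ w₂ rfl hw
          rcases h₃ with h₃ | h₃ <;> simp only [Form.den] at h₁ h₂ h₃ <;>
            change α.size w₁ ≤ α.size v₁ at h₁ <;> change α.size w₂ ≤ α.size v₂ at h₂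
          · change α.size w₁ < α.size v₁ at h₃
            omega
          · change α.size w₂ < α.size v₂ at h₃
            omega
    exact fun v₁ v₂ hv => key _ v₁ v₂ rfl hv
  | @caseBool γ G β t₁ t₂ u₁ u₂ v₁ v₂ U _ hiff _ _ _ ihu ihv =>
    have h := hiff.sound M hM θ (G.models_form M hθ)
    simp only [Form.iff, Form.den, Tm.den_rename, Tm.den] at h
    simp only [Tm.den]
    generalize t₁.den (θ.pull left) = b₁ at h
    generalize t₂.den (θ.pull right) = b₂ at h
    change Bool at b₁ b₂
    -- The logical premise, read in the model, excludes that the two scrutinees take different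
    -- branches; the same argument serves numbers and lists.
    cases b₁ <;> cases b₂
    · exact ihv hθ
    · exact absurd (h.2 rfl) Bool.false_ne_true
    · exact absurd (h.1 rfl) Bool.false_ne_true
    · exact ihu hθ
  | @caseNat γ G β t₁ t₂ u₁ u₂ v₁ v₂ U _ hiff _ _ _ ihu ihv =>
    have h := hiff.sound M hM θ (G.models_form M hθ)
    simp only [Form.iff, Form.den, Tm.den_rename, Tm.den] at h
    simp only [Tm.den]
    generalize t₁.den (θ.pull left) = n₁ at h
    generalize t₂.den (θ.pull right) = n₂ at h
    change ℕ at n₁ n₂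
    cases n₁ with
    | zero =>
      cases n₂ with
      | zero => exact ihu hθ
      | succ n₂ => exact absurd (h.1 rfl) (Nat.succ_ne_zero _)
    | succ n₁ =>
      cases n₂ with
      | zero => exact absurd (h.2 rfl) (Nat.succ_ne_zero _)
      | succ n₂ => exact (RTy.den_rename M U wk2 _ _ _).1 (ihv hθ n₁ n₂ trivial)
  | @caseList γ G α β t₁ t₂ u₁ u₂ v₁ v₂ T U _ hiff _ _ iht ihu ihv =>
    have h := hiff.sound M hM θ (G.models_form M hθ)
    have ht := iht hθ
    simp only [Form.iff, Form.den, Tm.den_rename, Tm.den] at h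
    simp only [Tm.den]
    generalize t₁.den (θ.pull left) = l₁ at h ht
    generalize t₂.den (θ.pull right) = l₂ at h ht
    change List α.den at l₁ l₂
    cases l₁ with
    | nil =>
      cases l₂ with
      | nil => exact ihu hθ
      | cons a₂ l₂ => exact absurd (h.1 rfl) (List.cons_ne_nil _ _)
    | cons a₁ l₁ =>
      cases l₂ with
      | nil => exact absurd (h.2 rfl) (List.cons_ne_nil _ _)
      | cons a₂ l₂ =>
        -- Relatedness of nonempty lists passes to heads and tails; for unary elements both
        -- relations are full.
        have hl : T.den M θ a₁ a₂ ∧ T.list.den M θ l₁ l₂ := by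
          by_cases hT : T.IsUnary
          · obtain ⟨τ, rfl⟩ := hT
            exact ⟨trivial, trivial⟩
          · rw [RTy.den_list M hT] at ht ⊢
            exact List.forall₂_cons.1 ht
        have := ihv hθ a₁ a₂ hl.1 l₁ l₂
          ((RTy.den_rename M T.list wk2 ((θ.cons a₁).cons a₂) l₁ l₂).2 hl.2)
        exact (RTy.den_rename M U wk4 _ _ _).1 this

end RelHOL

/-! ### The embedding theorem -/

theorem mainTheorem6 {S : RelHOL.Signature.{u}} (𝒯 : RelHOL.Theory S) :
    (∀ {γ : RelHOL.Ctx} (G : RelHOL.RCtx S γ) {α : RelHOL.Ty} (t₁ t₂ : RelHOL.Tm γ α)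
        (T : RelHOL.RTy S (RelHOL.dbl γ) α),
      RelHOL.RTyping 𝒯 G t₁ t₂ T →
        RelHOL.RHOL 𝒯 G.form (t₁.rename RelHOL.left) (t₂.rename RelHOL.right) T.form) ∧
    (∀ {γ : RelHOL.Ctx} (G : RelHOL.RCtx S γ) {α : RelHOL.Ty}
        (T U : RelHOL.RTy S (RelHOL.dbl γ) α),
      RelHOL.RSubtyping 𝒯 G T U →
        RelHOL.HOL 𝒯 (T.form :: RelHOL.hyps RelHOL.wk2 G.form) U.form) ∧
    (∀ M : RelHOL.Interp S, (∀ φ ∈ 𝒯.ax, φ.den M RelHOL.Env.nil) →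
      ∀ {γ : RelHOL.Ctx} (G : RelHOL.RCtx S γ) {α : RelHOL.Ty} (t₁ t₂ : RelHOL.Tm γ α)
          (T : RelHOL.RTy S (RelHOL.dbl γ) α),
        RelHOL.RTyping 𝒯 G t₁ t₂ T →
          ∀ θ : RelHOL.Env (RelHOL.dbl γ), G.Models M θ →
            T.den M θ ((t₁.rename RelHOL.left).den θ) ((t₂.rename RelHOL.right).den θ)) := by
  refine ⟨fun G _ t₁ t₂ T h => ?_, fun G _ T U h => h.hol, fun M hM _ G _ t₁ t₂ T h θ hθ => ?_⟩
  · have hG := h.ok.1.form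
    -- The generalized statement at the refinement of the context, where each hypothesis derives
    -- itself.
    exact h.rhol hG fun ψ hψ => .hyp hG hψ
  · rw [RelHOL.Tm.den_rename, RelHOL.Tm.den_rename]
    exact h.sound M hM hθ
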